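/- Let $(a_j)_{j\ge 0}$ and $(b_j)_{j\ge 0}$ be bounded real sequences with all $b_j>0$. Let $H_{[0,\infty)}$ be the bounded operator on $\ell^2$ given by the tridiagonal matrix with diagonal $a_0,a_1,a_2,\dots$, subdiagonal $b_0,b_1,b_2,\dots$ and superdiagonal $-b_0,b_1,b_2,\dots$, let $H_{[0,n]}$ be its upper left corner of size $n+1$, and put $m_{[0,\infty)}(z)=-\langle e_0,(H_{[0,\infty)}-z)^{-1}e_0\rangle$. Suppose that in the open upper half-plane $\mathbb C^+$ this function has the representations $$m_{[0,\infty)}(z)=\frac{1}{(z-\lambda_\infty)(z-\overline{\lambda_\infty})}\Big(z+d+\int_{t_1}^{t_2}\frac{d\sigma(t)}{t-z}\Big),\qquad \frac{-1}{m_{[0,\infty)}(z)}=a_0-z+b_0^2\int_{t_3}^{t_4}\frac{d\mu(t)}{t-z},$$ where $\lambda_\infty\in\mathbb C^+$, $d\in\mathbb R$, $\sigma$ is a finite Borel measure on $[t_1,t_2]$ and $\mu$ is a Borel probability measure on $[t_3,t_4]$, neither of them supported on a finite set. Put $$g=\frac{|\lambda_\infty-t_4|+|\lambda_\infty-t_3|}{t_4-t_3}>1,\qquad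 R(\varepsilon)=g+\varepsilon\sqrt{g^2-1},$$ and for $R>1$ let $L_R$ be the closed set bounded by the ellipse $\partial L_R$ with foci $t_3,t_4$ whose semi-axes have sum $(t_4-t_3)R/2$. An eigenvalue of nonpositive type of $H_{[0,n]}$ is an eigenvalue in $\mathbb C^+\cup\mathbb R$ with an eigenvector $f$ such that $\langle f,\eta f\rangle\le 0$, where $\eta=\mathrm{diag}(-1,1,\dots,1)$. Then for every $\varepsilon\in(0,1)$ the maximum $\max_{z\in\partial L_{R(\varepsilon)}}|m_{[0,\infty)}(z)|$ exists, and for every integer $n\ge 0$ with $$n>N_\varepsilon:=\frac{\log\left(\dfrac{8b_0^2\,g\,\max_{z\in\partial L_{R(\varepsilon)}}|m_{[0,\infty)}(z)|}{(g-1)^2(t_4-t_3)}\right)}{\log\left(1+\varepsilon\sqrt{1-g^{-2}}\right)}$$ the matrix $H_{[0,n]}$ has exactly one eigenvalue $\lambda_n$ of nonpositive type, and $\lambda_n\in\mathbb C\setminus L_{R(\varepsilon)}$. In particular, $\lambda_n\notin[t_3,t_4]$. -/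

import Mathlib

open MeasureTheory

noncomputable section

/-- The complex Hilbert space `ℓ²` of square summable sequences indexed by `0, 1, 2, …`. -/
abbrev SeqSpace : Type := lp (fun _ : ℕ => ℂ) 2

theorem sum_weightedComp_le {c : ℕ → ℂ} {φ : ℕ → ℕ} {C : ℝ} (hC : ∀ k, ‖c k‖ ≤ C)
    (hφ : Set.InjOn φ {k | c k ≠ 0}) (x : SeqSpace) (s : Finset ℕ) :
    ∑ k ∈ s, ‖c k * x (φ k)‖ ^ (2 : ENNReal).toReal ≤ (C * ‖x‖) ^ (2 : ENNReal).toReal := by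
  classical
  have hC0 : 0 ≤ C := (norm_nonneg _).trans (hC 0)
  have h2 : (0 : ℝ) < (2 : ENNReal).toReal := by simp
  have hz : ((0 : ℝ) ^ (2 : ENNReal).toReal) = 0 := Real.zero_rpow h2.ne'
  calc ∑ k ∈ s, ‖c k * x (φ k)‖ ^ (2 : ENNReal).toReal
      = ∑ k ∈ s with c k ≠ 0, ‖c k * x (φ k)‖ ^ (2 : ENNReal).toReal := by
        refine (Finset.sum_filter_of_ne ?_).symm
        intro k _ hk hck
        exact hk (by simp [hck])
    _ ≤ ∑ k ∈ s with c k ≠ 0,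
          C ^ (2 : ENNReal).toReal * ‖x (φ k)‖ ^ (2 : ENNReal).toReal := by
        refine Finset.sum_le_sum fun k _ => ?_
        rw [norm_mul, Real.mul_rpow (norm_nonneg _) (norm_nonneg _)]
        gcongr
        exact hC k
    _ = C ^ (2 : ENNReal).toReal *
          ∑ j ∈ (s.filter fun k => c k ≠ 0).image φ, ‖x j‖ ^ (2 : ENNReal).toReal := by
        rw [← Finset.mul_sum, Finset.sum_image]
        intro i hi j hj hij
        exact hφ (by simpa using (Finset.mem_filter.1 hi).2)
          (by simpa using (Finset.mem_filter.1 hj).2) hij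
    _ ≤ C ^ (2 : ENNReal).toReal * ‖x‖ ^ (2 : ENNReal).toReal := by
        gcongr
        exact lp.sum_rpow_le_norm_rpow h2 x _
    _ = (C * ‖x‖) ^ (2 : ENNReal).toReal :=
        (Real.mul_rpow hC0 (norm_nonneg _)).symm

/-- The bounded operator on `ℓ²` sending `x` to the sequence `k ↦ c k * x (φ k)`, for bounded
weights `c` and an index map `φ` that is injective where `c` does not vanish. -/
def weightedComp (c : ℕ → ℂ) (φ : ℕ → ℕ) (hc : ∃ C : ℝ, ∀ k, ‖c k‖ ≤ C)
    (hφ : Set.InjOn φ {k | c k ≠ 0}) : SeqSpace →L[ℂ] SeqSpace :=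
  LinearMap.mkContinuousOfExistsBound
    { toFun := fun x => ⟨fun k => c k * x (φ k),
        memℓp_gen' fun s => sum_weightedComp_le hc.choose_spec hφ x s⟩
      map_add' := by
        intro x y
        ext k
        exact mul_add _ _ _
      map_smul' := by
        intro r x
        ext k
        simp [mul_left_comm] }
    ⟨hc.choose, fun x => lp.norm_le_of_forall_sum_le (by simp)
      (mul_nonneg ((norm_nonneg _).trans (hc.choose_spec 0)) (norm_nonneg _))
      fun s => sum_weightedComp_le hc.choose_spec hφ x s⟩

theorem weightedComp_apply (c : ℕ → ℂ) (φ : ℕ → ℕ) (hc : ∃ C : ℝ, ∀ k, ‖c k‖ ≤ C)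
    (hφ : Set.InjOn φ {k | c k ≠ 0}) (x : SeqSpace) (k : ℕ) :
    weightedComp c φ hc hφ x k = c k * x (φ k) := rfl

/-- Bounded real sequences `(a_j)` and `(b_j)`, `j = 0, 1, 2, …`, with all `b_j` positive. -/
structure JacobiData where
  a : ℕ → ℝ
  b : ℕ → ℝ
  a_bounded : ∃ C : ℝ, ∀ j, |a j| ≤ C
  b_bounded : ∃ C : ℝ, ∀ j, |b j| ≤ C
  b_pos : ∀ j, 0 < b j

namespace JacobiData

variable (J : JacobiData)

/-- The weights above the diagonal: `-b_0, b_1, b_2, …`. -/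
def upper (k : ℕ) : ℝ := if k = 0 then -J.b 0 else J.b k

/-- The weights below the diagonal, listed by rows: `0` (no entry in row `0`), `b_0, b_1, …`. -/
def lower (k : ℕ) : ℝ := if k = 0 then 0 else J.b (k - 1)

/-- The entries of the non-symmetric infinite tridiagonal matrix with diagonal `a_0, a_1, …`,
subdiagonal `b_0, b_1, b_2, …` and superdiagonal `-b_0, b_1, b_2, …`. -/
def entry (i j : ℕ) : ℝ :=
  if i = j then J.a i else if j = i + 1 then J.upper i else if i = j + 1 then J.b j else 0

/-- The bounded operator `H_{[0,∞)}` on `ℓ²` given by that infinite matrix: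
`(H x)_0 = a_0 x_0 - b_0 x_1` and `(H x)_k = b_{k-1} x_{k-1} + a_k x_k + b_k x_{k+1}` for
`k ≥ 1`. -/
def H : SeqSpace →L[ℂ] SeqSpace :=
  weightedComp (fun k => (J.a k : ℂ)) id (by simpa using J.a_bounded)
      Function.injective_id.injOn +
  weightedComp (fun k => (J.upper k : ℂ)) (fun k => k + 1)
      (by
        obtain ⟨C, hC⟩ := J.b_bounded
        refine ⟨C, fun k => ?_⟩
        rcases Nat.eq_zero_or_pos k with rfl | hk
        · simpa [upper] using hC 0
        · simpa [upper, hk.ne'] using hC k)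
      (fun i _ j _ h => Nat.succ_injective h) +
  weightedComp (fun k => (J.lower k : ℂ)) (fun k => k - 1)
      (by
        obtain ⟨C, hC⟩ := J.b_bounded
        refine ⟨C, fun k => ?_⟩
        rcases Nat.eq_zero_or_pos k with rfl | hk
        · simpa [lower] using (abs_nonneg _).trans (hC 0)
        · simpa [lower, hk.ne'] using hC (k - 1))
      (by
        intro i hi j hj h
        have hi' : i ≠ 0 := by rintro rfl; simp [lower] at hi
        have hj' : j ≠ 0 := by rintro rfl; simp [lower] at hj
        simp only at h
        omega)

theorem H_apply_zero (x : SeqSpace) : J.H x 0 = J.a 0 * x 0 - J.b 0 * x 1 := by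
  simp [H, weightedComp_apply, upper, lower, sub_eq_add_neg]

theorem H_apply_succ (x : SeqSpace) (k : ℕ) :
    J.H x (k + 1) = J.b k * x k + J.a (k + 1) * x (k + 1) + J.b (k + 1) * x (k + 2) := by
  simp [H, weightedComp_apply, upper, lower]
  ring

/-- The basis vector `e_0` of `ℓ²`. -/
def e0 : SeqSpace := lp.single 2 0 1

/-- The function `m_{[0,∞)}(z) = -⟨e_0, (H_{[0,∞)} - z)⁻¹ e_0⟩`. -/
def m (z : ℂ) : ℂ :=
  -inner ℂ e0 (Ring.inverse (J.H - algebraMap ℂ (SeqSpace →L[ℂ] SeqSpace) z) e0)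

/-- The finite truncation `H_{[0,n]}`, of size `n + 1`. -/
def truncation (n : ℕ) : Matrix (Fin (n + 1)) (Fin (n + 1)) ℂ :=
  Matrix.of fun i j => (J.entry i j : ℂ)

end JacobiData

/-- The fundamental symmetry `diag(-1, 1, …, 1)` of size `n + 1`. -/
def fundSymm (n : ℕ) : Matrix (Fin (n + 1)) (Fin (n + 1)) ℂ :=
  Matrix.diagonal fun i => if i = 0 then -1 else 1

/-- `w` is an eigenvalue of nonpositive type of `A`: it lies in the closed upper half-plane and has
an eigenvector `f` with `⟨f, η f⟩ ≤ 0`, where `η = diag(-1, 1, …, 1)`. -/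
def IsEigenvalueOfNonposType {n : ℕ} (A : Matrix (Fin (n + 1)) (Fin (n + 1)) ℂ) (w : ℂ) : Prop :=
  0 ≤ w.im ∧ ∃ f : Fin (n + 1) → ℂ, f ≠ 0 ∧ Matrix.mulVec A f = w • f ∧
    (dotProduct (star f) (Matrix.mulVec (fundSymm n) f)).re ≤ 0

/-- A finite Borel measure, supported on `[s, t]`, that is nontrivial, that is, not supported on
a finite set. All its moments are then finite. -/
def IsNontrivialOn (ν : Measure ℝ) (s t : ℝ) : Prop :=
  IsFiniteMeasure ν ∧ ν (Set.Icc s t)ᶜ = 0 ∧ ∀ F : Finset ℝ, ν ((F : Set ℝ)ᶜ) ≠ 0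

namespace JacobiData

variable (J : JacobiData)

/-- The representation
`m_{[0,∞)}(z) = (z + d + ∫ dσ(t) / (t - z)) / ((z - lam) (z - conj lam))`
in the upper half-plane, with `d` real and `σ` a nontrivial measure on a compact interval. -/
def HasPoleForm (lam : ℂ) : Prop :=
  ∃ (d t₁ t₂ : ℝ) (σ : Measure ℝ), IsNontrivialOn σ t₁ t₂ ∧
    ∀ z : ℂ, 0 < z.im → z ∈ resolventSet ℂ J.H → z ≠ lam →
      J.m z = 1 / ((z - lam) * (z - (starRingEnd ℂ) lam)) *
        (z + d + ∫ t : ℝ, 1 / ((t : ℂ) - z) ∂σ)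

/-- The representation `-1 / m_{[0,∞)}(z) = a_0 - z + b_0² ∫ dμ(t) / (t - z)` in the upper
half-plane, with `μ` a nontrivial probability measure on `[t₃, t₄]`. -/
def HasStieltjesForm (μ : Measure ℝ) (t₃ t₄ : ℝ) : Prop :=
  IsProbabilityMeasure μ ∧ IsNontrivialOn μ t₃ t₄ ∧
    ∀ z : ℂ, 0 < z.im → z ∈ resolventSet ℂ J.H →
      -1 / J.m z = J.a 0 - z + (J.b 0 : ℂ) ^ 2 * ∫ t : ℝ, 1 / ((t : ℂ) - z) ∂μ

end JacobiData

/-- The larger semi-axis of the ellipse with foci `t₃, t₄` whose semi-axes have sum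
`(t₄ - t₃) R / 2`. -/
def semiMajor (t₃ t₄ R : ℝ) : ℝ := (t₄ - t₃) / 4 * (R + R⁻¹)

/-- The smaller semi-axis of that ellipse. -/
def semiMinor (t₃ t₄ R : ℝ) : ℝ := (t₄ - t₃) / 4 * (R - R⁻¹)

theorem semiMajor_add_semiMinor (t₃ t₄ R : ℝ) :
    semiMajor t₃ t₄ R + semiMinor t₃ t₄ R = (t₄ - t₃) * R / 2 := by
  unfold semiMajor semiMinor
  ring

theorem semiMajor_sq_sub_semiMinor_sq (t₃ t₄ : ℝ) {R : ℝ} (hR : R ≠ 0) :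
    semiMajor t₃ t₄ R ^ 2 - semiMinor t₃ t₄ R ^ 2 = ((t₄ - t₃) / 2) ^ 2 := by
  unfold semiMajor semiMinor
  field_simp
  ring

/-- For `R > 1`, the ellipse `∂L_R` with foci `t₃, t₄` and sum of semi-axes `(t₄ - t₃) R / 2`. -/
def ellipseCurve (t₃ t₄ R : ℝ) : Set ℂ :=
  {z | ‖z - t₃‖ + ‖z - t₄‖ = 2 * semiMajor t₃ t₄ R}

/-- For `R > 1`, the closed region `L_R` bounded by that ellipse. -/
def ellipseRegion (t₃ t₄ R : ℝ) : Set ℂ :=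
  {z | ‖z - t₃‖ + ‖z - t₄‖ ≤ 2 * semiMajor t₃ t₄ R}

/-- The reciprocal of the eccentricity of the ellipse through `lam` with foci `t₃, t₄`. -/
def recipEccentricity (t₃ t₄ : ℝ) (lam : ℂ) : ℝ :=
  (‖lam - t₄‖ + ‖lam - t₃‖) / (t₄ - t₃)

/-- `R(ε) = g + ε √(g² - 1)`. -/
def ellipseParam (g ε : ℝ) : ℝ := g + ε * √(g ^ 2 - 1)

end

/-! Write `F(z) = a_0 - z + b_0² S(z)`, with `S` the Stieltjes transform of `μ` (`charFun`). The
proof compares the zeros of `F` with those of its Gauss quadrature analogue `F_n(z) = a_0 - z + b_0²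
∑ c_j / (t_j - z)`.

The asymptotics of `(H - z)⁻¹ e_0` along the imaginary axis show that the polynomials `P_k` of the
Jacobi matrix with row and column `0` removed are orthonormal in `L²(μ)`. Hence that tail operator
has no spectrum off `[t₃, t₄]`, and eliminating the tail (a Schur complement) gives `m F = -1`
there, wherever `F ≠ 0`. The pole form forces `F(lam) = 0`. Dividing out `lam` and its conjugate
leaves the Stieltjes transform of a positive measure, so `F` has no other zero off `[t₃, t₄]`. As
`lam` lies outside the ellipse, `m` is continuous on the curve, its maximum modulus `M` exists, and
`|F| ≥ 1 / M` there.

For the truncation, existence and uniqueness of the eigenvalue `l` of nonpositive type is Pontryagin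
space linear algebra: one negative square. Diagonalizing the symmetric part of `H_{[0,n]}` gives
`F_n(l) = 0` together with `b_0² ∑ c_j / |t_j - l|² ≤ 1` (`exists_quadrature`). These two facts
factor `F_n` as `F` was factored, so if `l` were in the ellipse, `F_n` would have no zero outside
(`finite_charFun_ne_zero`).

A Chebyshev expansion in the Joukowski coordinate bounds the quadrature error, and for `n > N_ε`
this yields `|F - F_n| < |F|` on the curve. A Rouché type argument on the exterior, including
infinity (`ne_zero_of_norm_sub_lt`), would then make `F` zero-free outside, contradicting `F(lam) =
0`. -/

/-! ### Separation from an interval, and Stieltjes transforms. -/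

/-- A compact real interval is strictly separated from every complex number outside it. -/
theorem exists_separating_functional {s t : ℝ} {z : ℂ}
    (hz : z ∉ ((↑) : ℝ → ℂ) '' Set.Icc s t) :
    ∃ c : ℂ, ‖c‖ = 1 ∧ ∃ δ > 0, ∀ x ∈ Set.Icc s t, δ ≤ (c * (x - z)).re := by
  rcases lt_trichotomy z.im 0 with h | h | h
  · exact ⟨-Complex.I, by simp, -z.im, by linarith, fun x _ => by simp⟩
  · have hz' : z = (z.re : ℂ) := Complex.ext (by simp) (by simpa using h)
    rcases lt_or_ge z.re s with h1 | h1
    · exact ⟨1, by simp, s - z.re, by linarith, fun x hx => by simpa using hx.1⟩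
    · rcases lt_or_ge t z.re with h2 | h2
      · exact ⟨-1, by simp, z.re - t, by linarith, fun x hx => by simp; linarith [hx.2]⟩
      · exact absurd ⟨z.re, ⟨h1, h2⟩, hz'.symm⟩ hz
  · exact ⟨Complex.I, by simp, z.im, h, fun x _ => by simp⟩

theorem ofReal_sub_ne_zero {s t : ℝ} {z : ℂ} (hz : z ∉ ((↑) : ℝ → ℂ) '' Set.Icc s t) {x : ℝ}
    (hx : x ∈ Set.Icc s t) : (x : ℂ) - z ≠ 0 :=
  fun h => hz ⟨x, hx, sub_eq_zero.1 h⟩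

theorem notMem_ofReal_Icc {s t : ℝ} {z : ℂ} (hz : z.im ≠ 0) :
    z ∉ ((↑) : ℝ → ℂ) '' Set.Icc s t := by
  rintro ⟨x, -, rfl⟩
  simp at hz

theorem exists_norm_sub_ge {s t : ℝ} {z : ℂ} (hz : z ∉ ((↑) : ℝ → ℂ) '' Set.Icc s t) :
    ∃ δ > 0, ∀ x ∈ Set.Icc s t, δ ≤ ‖(x : ℂ) - z‖ := by
  obtain ⟨c, hc, δ, hδ, h⟩ := exists_separating_functional hz
  refine ⟨δ, hδ, fun x hx => (h x hx).trans ?_⟩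
  simpa [hc] using Complex.re_le_norm (c * (x - z))

/-- A continuous function on a compact interval is integrable for a finite measure that is
concentrated on this interval. -/
theorem integrable_of_continuousOn_Icc {E : Type*} [NormedAddCommGroup E]
    {μ : Measure ℝ} [IsFiniteMeasure μ] {s t : ℝ} (hμ : μ (Set.Icc s t)ᶜ = 0) {f : ℝ → E}
    (hf : ContinuousOn f (Set.Icc s t)) : Integrable f μ := by
  have h := hf.integrableOn_compact (μ := μ) isCompact_Icc
  rwa [IntegrableOn, Measure.restrict_eq_self_of_ae_mem] at h
  exact hμ

/-- The Stieltjes transform of a measure on the real line. -/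
noncomputable def stieltjes (μ : Measure ℝ) (z : ℂ) : ℂ := ∫ t : ℝ, 1 / ((t : ℂ) - z) ∂μ

section Stieltjes

variable {μ : Measure ℝ} {s t : ℝ}

theorem continuousOn_one_div_sub {z : ℂ} (hz : z ∉ ((↑) : ℝ → ℂ) '' Set.Icc s t) :
    ContinuousOn (fun x : ℝ => 1 / ((x : ℂ) - z)) (Set.Icc s t) :=
  continuousOn_const.div (by fun_prop) fun _ hx => ofReal_sub_ne_zero hz hx

theorem ae_mem_Icc (hμ : μ (Set.Icc s t)ᶜ = 0) : ∀ᵐ x ∂μ, x ∈ Set.Icc s t := hμ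

theorem stieltjes_conj (z : ℂ) :
    stieltjes μ ((starRingEnd ℂ) z) = (starRingEnd ℂ) (stieltjes μ z) := by
  rw [stieltjes, stieltjes, ← integral_conj]
  simp

variable [IsFiniteMeasure μ]

theorem integrable_one_div_sub (hμ : μ (Set.Icc s t)ᶜ = 0) {z : ℂ}
    (hz : z ∉ ((↑) : ℝ → ℂ) '' Set.Icc s t) :
    Integrable (fun x : ℝ => 1 / ((x : ℂ) - z)) μ :=
  integrable_of_continuousOn_Icc hμ (continuousOn_one_div_sub hz)

/-- The difference of two values of a Stieltjes transform. -/
theorem stieltjes_sub_stieltjes (hμ : μ (Set.Icc s t)ᶜ = 0) {z w : ℂ}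
    (hz : z ∉ ((↑) : ℝ → ℂ) '' Set.Icc s t) (hw : w ∉ ((↑) : ℝ → ℂ) '' Set.Icc s t) :
    stieltjes μ z - stieltjes μ w =
      (z - w) * ∫ x : ℝ, 1 / ((x : ℂ) - w) * (1 / ((x : ℂ) - z)) ∂μ := by
  rw [stieltjes, stieltjes, ← integral_sub (integrable_one_div_sub hμ hz)
    (integrable_one_div_sub hμ hw), ← integral_const_mul]
  refine integral_congr_ae ?_
  filter_upwards [ae_mem_Icc hμ] with x hx
  have := ofReal_sub_ne_zero hz hx
  have := ofReal_sub_ne_zero hw hx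
  field_simp
  ring

/-- An integral of `w(t) / (t - z)` with a positive weight `w` does not vanish off the support. -/
theorem integral_weight_mul_one_div_ne_zero [NeZero μ] (hμ : μ (Set.Icc s t)ᶜ = 0) {z : ℂ}
    (hz : z ∉ ((↑) : ℝ → ℂ) '' Set.Icc s t) {w : ℝ → ℝ} (hw : ContinuousOn w (Set.Icc s t))
    (hw0 : ∀ x ∈ Set.Icc s t, 0 < w x) :
    ∫ x : ℝ, (w x : ℂ) * (1 / ((x : ℂ) - z)) ∂μ ≠ 0 := by
  obtain ⟨c, hc, δ, hδ, h⟩ := exists_separating_functional hz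
  have hc0 : c ≠ 0 := by rintro rfl; simp at hc
  intro h0
  have hcont : ContinuousOn (fun x : ℝ => c⁻¹ * ((w x : ℂ) * (1 / ((x : ℂ) - z))))
      (Set.Icc s t) :=
    continuousOn_const.mul ((Complex.continuous_ofReal.comp_continuousOn hw).mul
      (continuousOn_one_div_sub hz))
  have hint := integrable_of_continuousOn_Icc hμ hcont
  -- Inversion preserves the sign of the real part, so after rotation by `c⁻¹` the whole integrand
  -- lies in the open right half-plane.
  have hpos : ∀ x ∈ Set.Icc s t, 0 < (c⁻¹ * ((w x : ℂ) * (1 / ((x : ℂ) - z)))).re := by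
    intro x hx
    have h1 : 0 < (c * (x - z)).re := hδ.trans_le (h x hx)
    have h2 : c⁻¹ * ((w x : ℂ) * (1 / ((x : ℂ) - z))) = (w x : ℂ) * (c * (x - z))⁻¹ := by
      rw [mul_inv]; ring
    rw [h2, Complex.re_ofReal_mul, Complex.inv_re]
    refine mul_pos (hw0 x hx) (div_pos h1 (Complex.normSq_pos.2 ?_))
    intro h3
    simp [h3] at h1
  have h1 : ∫ x : ℝ, (c⁻¹ * ((w x : ℂ) * (1 / ((x : ℂ) - z)))).re ∂μ = 0 := by
    have := integral_re hint
    simp only [RCLike.re_eq_complex_re] at this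
    rw [this, integral_const_mul, h0]
    simp
  rw [integral_eq_zero_iff_of_nonneg_ae] at h1
  · have h2 : ∀ᵐ x ∂μ, False := by
      filter_upwards [h1, ae_mem_Icc hμ] with x hx hx'
      exact (hpos x hx').ne' hx
    exact NeZero.ne μ (by simpa using h2)
  · filter_upwards [ae_mem_Icc hμ] with x hx using (hpos x hx).le
  · exact hint.re

theorem hasDerivAt_stieltjes (hμ : μ (Set.Icc s t)ᶜ = 0) {z : ℂ}
    (hz : z ∉ ((↑) : ℝ → ℂ) '' Set.Icc s t) :
    HasDerivAt (stieltjes μ) (∫ x : ℝ, 1 / ((x : ℂ) - z) ^ 2 ∂μ) z := by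
  obtain ⟨δ, hδ, h⟩ := exists_norm_sub_ge hz
  have hball : ∀ w ∈ Metric.ball z (δ / 2), ∀ x ∈ Set.Icc s t, δ / 2 ≤ ‖(x : ℂ) - w‖ := by
    intro w hw x hx
    have h1 := h x hx
    have h2 : ‖w - z‖ < δ / 2 := by simpa [dist_eq_norm] using hw
    have h3 : ‖(x : ℂ) - z‖ ≤ ‖(x : ℂ) - w‖ + ‖w - z‖ := by
      simpa using norm_add_le ((x : ℂ) - w) (w - z)
    linarith
  have hnot : ∀ w ∈ Metric.ball z (δ / 2), w ∉ ((↑) : ℝ → ℂ) '' Set.Icc s t := by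
    rintro w hw ⟨x, hx, rfl⟩
    have := hball _ hw x hx
    simp at this
    linarith
  refine (hasDerivAt_integral_of_dominated_loc_of_deriv_le (μ := μ)
    (F := fun z (x : ℝ) => 1 / ((x : ℂ) - z)) (F' := fun z (x : ℝ) => 1 / ((x : ℂ) - z) ^ 2)
    (bound := fun _ => 1 / (δ / 2) ^ 2)
    (Metric.ball_mem_nhds z (half_pos hδ)) ?_ (integrable_one_div_sub hμ hz) ?_ ?_
    (integrable_const _) ?_).2
  · filter_upwards [Metric.ball_mem_nhds z (half_pos hδ)] with w hw
    exact (integrable_one_div_sub hμ (hnot w hw)).aestronglyMeasurable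
  · refine (integrable_of_continuousOn_Icc hμ (E := ℂ) ?_).aestronglyMeasurable
    exact continuousOn_const.div (by fun_prop) fun x hx => pow_ne_zero 2 (ofReal_sub_ne_zero hz hx)
  · filter_upwards [ae_mem_Icc hμ] with x hx w hw
    rw [norm_div, norm_one, norm_pow]
    have := hball w hw x hx
    gcongr
  · filter_upwards [ae_mem_Icc hμ] with x hx w hw
    have h1 := ofReal_sub_ne_zero (hnot w hw) hx
    have h2 := ((hasDerivAt_id w).const_sub (x : ℂ)).inv h1
    simpa [one_div, Pi.inv_def] using h2

theorem continuousAt_stieltjes (hμ : μ (Set.Icc s t)ᶜ = 0) {z : ℂ}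
    (hz : z ∉ ((↑) : ℝ → ℂ) '' Set.Icc s t) : ContinuousAt (stieltjes μ) z :=
  (hasDerivAt_stieltjes hμ hz).continuousAt

theorem stieltjes_im_nonneg (hμ : μ (Set.Icc s t)ᶜ = 0) {z : ℂ} (hz : 0 < z.im) :
    0 ≤ (stieltjes μ z).im := by
  have hint := integrable_one_div_sub hμ (notMem_ofReal_Icc (s := s) (t := t) hz.ne')
  have := integral_im hint
  simp only [RCLike.im_eq_complex_im] at this
  rw [stieltjes, ← this]
  refine integral_nonneg fun x => ?_
  simp only [one_div, Complex.inv_im, Pi.zero_apply]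
  refine div_nonneg ?_ (Complex.normSq_nonneg _)
  simpa using hz.le

/-- If `a - z + β S(z)` vanishes at a nonreal point `w`, where `S` is the Stieltjes transform of
`μ`, then it is the product of `(z - w) (z - w̄)` and of a Stieltjes transform. -/
theorem sub_add_mul_stieltjes_eq (hμ : μ (Set.Icc s t)ᶜ = 0) {a β : ℝ} {w : ℂ} (hw : w.im ≠ 0)
    (h0 : (a : ℂ) - w + β * stieltjes μ w = 0) {z : ℂ}
    (hz : z ∉ ((↑) : ℝ → ℂ) '' Set.Icc s t) :
    (a : ℂ) - z + β * stieltjes μ z = β * ((z - w) * (z - (starRingEnd ℂ) w)) *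
      ∫ x : ℝ, ((1 / Complex.normSq ((x : ℂ) - w) : ℝ) : ℂ) * (1 / ((x : ℂ) - z)) ∂μ := by
  have hw' : ((starRingEnd ℂ) w).im ≠ 0 := by simpa using hw
  have hwn := notMem_ofReal_Icc (s := s) (t := t) hw
  have hwn' := notMem_ofReal_Icc (s := s) (t := t) hw'
  have hwc : w - (starRingEnd ℂ) w ≠ 0 := by
    intro h
    apply hw
    have := congrArg Complex.im h
    simp at this
    linarith
  have hK := stieltjes_sub_stieltjes hμ hwn' hwn
  have hZ := stieltjes_sub_stieltjes hμ hz hwn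
  set K := ∫ x : ℝ, 1 / ((x : ℂ) - w) * (1 / ((x : ℂ) - (starRingEnd ℂ) w)) ∂μ with hKdef
  set A := ∫ x : ℝ, 1 / ((x : ℂ) - w) * (1 / ((x : ℂ) - z)) ∂μ with hAdef
  have hcont := continuousOn_one_div_sub hwn
  have hcont' := continuousOn_one_div_sub hwn'
  have hcontz := continuousOn_one_div_sub hz
  have hAK : A - K = (z - (starRingEnd ℂ) w) *
      ∫ x : ℝ, ((1 / Complex.normSq ((x : ℂ) - w) : ℝ) : ℂ) * (1 / ((x : ℂ) - z)) ∂μ := by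
    rw [hKdef, hAdef, ← integral_sub (integrable_of_continuousOn_Icc hμ (hcont.fun_mul hcontz))
      (integrable_of_continuousOn_Icc hμ (hcont.fun_mul hcont')), ← integral_const_mul]
    refine integral_congr_ae ?_
    filter_upwards [ae_mem_Icc hμ] with x hx
    have h1 := ofReal_sub_ne_zero hz hx
    have h2 := ofReal_sub_ne_zero hwn hx
    have h3 := ofReal_sub_ne_zero hwn' hx
    have h4 : ((Complex.normSq ((x : ℂ) - w) : ℝ) : ℂ) =
        ((x : ℂ) - w) * (x - (starRingEnd ℂ) w) := by
      rw [Complex.normSq_eq_conj_mul_self]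
      simp [mul_comm]
    push_cast
    rw [h4]
    field_simp
    ring
  -- The coefficients are real, so the conjugate of `w` is a zero too. Subtracting the two equations
  -- gives `β K = 1`, and then `F(z) - F(w) = (z - w)(β A - 1) = β (z - w)(A - K)`.
  have h0' : (a : ℂ) - (starRingEnd ℂ) w + β * stieltjes μ ((starRingEnd ℂ) w) = 0 := by
    rw [stieltjes_conj]
    have := congrArg (starRingEnd ℂ) h0
    simpa using this
  have hβK : (β : ℂ) * K = 1 := by
    have : (w - (starRingEnd ℂ) w) * (1 - β * K) = 0 := by
      linear_combination h0' - h0 - β * hK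
    have := (mul_eq_zero.1 this).resolve_left hwc
    linear_combination -this
  linear_combination h0 + β * hZ + β * (z - w) * hAK + (z - w) * hβK

end Stieltjes

/-! ### Orthogonal polynomials of the tail Jacobi matrix. -/

namespace JacobiData

variable (J : JacobiData)

open Polynomial in
/-- The polynomials generated by the three-term recurrence of the Jacobi matrix with diagonal
`a_1, a_2, …` and off-diagonal `b_1, b_2, …`. -/
noncomputable def orthPoly : ℕ → ℝ[X]
  | 0 => 1
  | 1 => C (J.b 1)⁻¹ * (X - C (J.a 1))
  | k + 2 => C (J.b (k + 2))⁻¹ *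
      ((X - C (J.a (k + 2))) * orthPoly (k + 1) - C (J.b (k + 1)) * orthPoly k)

@[simp] theorem orthPoly_zero : J.orthPoly 0 = 1 := by rw [orthPoly]

open Polynomial in
theorem X_mul_orthPoly_zero :
    X * J.orthPoly 0 = C (J.b 1) * J.orthPoly 1 + C (J.a 1) * J.orthPoly 0 := by
  rw [orthPoly, orthPoly, ← mul_assoc, ← C_mul, mul_inv_cancel₀ (J.b_pos 1).ne']
  simp

open Polynomial in
theorem X_mul_orthPoly_succ (k : ℕ) :
    X * J.orthPoly (k + 1) = C (J.b (k + 2)) * J.orthPoly (k + 2) +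
      C (J.a (k + 2)) * J.orthPoly (k + 1) + C (J.b (k + 1)) * J.orthPoly k := by
  conv_rhs => rw [orthPoly]
  rw [← mul_assoc, ← C_mul, mul_inv_cancel₀ (J.b_pos _).ne']
  simp
  ring

/-- The entries of the symmetric Jacobi matrix with diagonal `a_1, a_2, …` and off-diagonal
`b_1, b_2, …`. -/
def symmEntry (i j : ℕ) : ℝ :=
  if i = j then J.a (i + 1) else if j = i + 1 then J.b (i + 1) else
    if i = j + 1 then J.b (j + 1) else 0

theorem symmEntry_comm (i j : ℕ) : J.symmEntry i j = J.symmEntry j i := by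
  unfold symmEntry
  split_ifs <;> first | rfl | omega | (subst_vars; rfl)

section Functional

open Polynomial

variable {J} (Φ : ℝ[X] →ₗ[ℝ] ℝ)

/-- A functional that annihilates all `P_k` with `k ≥ 1` and is normalized makes the `P_k`
orthonormal. -/
theorem functional_orthPoly_mul (hΦ : ∀ k, Φ (J.orthPoly k) = if k = 0 then 1 else 0) (j k : ℕ) :
    Φ (J.orthPoly j * J.orthPoly k) = if j = k then 1 else 0 := by
  have hC : ∀ (c : ℝ) (p : ℝ[X]), Φ (C c * p) = c * Φ p := fun c p => by
    rw [← smul_eq_C_mul, map_smul, smul_eq_mul]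
  have hX : ∀ j k, Φ (J.orthPoly j * (X * J.orthPoly k)) = Φ ((X * J.orthPoly j) * J.orthPoly k) :=
    fun j k => by congr 1; ring
  have h0 : ∀ j, Φ (J.orthPoly j * (X * J.orthPoly 0)) =
      J.b 1 * Φ (J.orthPoly j * J.orthPoly 1) + J.a 1 * Φ (J.orthPoly j * J.orthPoly 0) := by
    intro j
    rw [X_mul_orthPoly_zero, ← hC, ← hC, ← map_add]
    congr 1; ring
  have h1 : ∀ j k, Φ (J.orthPoly j * (X * J.orthPoly (k + 1))) =
      J.b (k + 2) * Φ (J.orthPoly j * J.orthPoly (k + 2)) +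
        J.a (k + 2) * Φ (J.orthPoly j * J.orthPoly (k + 1)) +
        J.b (k + 1) * Φ (J.orthPoly j * J.orthPoly k) := by
    intro j k
    rw [X_mul_orthPoly_succ, ← hC, ← hC, ← hC, ← map_add, ← map_add]
    congr 1; ring
  have h0' : ∀ k, Φ ((X * J.orthPoly 0) * J.orthPoly k) =
      J.b 1 * Φ (J.orthPoly 1 * J.orthPoly k) + J.a 1 * Φ (J.orthPoly 0 * J.orthPoly k) := by
    intro j
    rw [X_mul_orthPoly_zero, ← hC, ← hC, ← map_add]
    congr 1; ring
  have h1' : ∀ j k, Φ ((X * J.orthPoly (k + 1)) * J.orthPoly j) =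
      J.b (k + 2) * Φ (J.orthPoly (k + 2) * J.orthPoly j) +
        J.a (k + 2) * Φ (J.orthPoly (k + 1) * J.orthPoly j) +
        J.b (k + 1) * Φ (J.orthPoly k * J.orthPoly j) := by
    intro j k
    rw [X_mul_orthPoly_succ, ← hC, ← hC, ← hC, ← map_add, ← map_add]
    congr 1; ring
  -- The recurrence trades the top index on the left for a factor `X`. Moving that factor to the
  -- right-hand polynomial leaves only smaller first indices, where the induction hypothesis
  -- applies; the column `k = 0` is the assumption on `Φ`.
  induction j using Nat.strong_induction_on generalizing k with
  | _ j ih =>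
    match j, ih with
    | 0, _ => simp [hΦ, eq_comm]
    | 1, ih =>
      have ih0 := ih 0 (by omega)
      have e := h0' k
      have hb := (J.b_pos 1).ne'
      rcases k with _ | k
      · simp [hΦ]
      · rw [← hX, h1, ih0, ih0, ih0] at e
        rcases k with _ | k
        · simp at e ⊢
          exact (mul_left_cancel₀ hb (by linarith)).symm
        · simp at e ⊢
          exact e.resolve_left hb
    | j + 2, ih =>
      have ih0 := ih (j + 1) (by omega)
      have ih1 := ih j (by omega)
      have e := h1' k j
      have hb := (J.b_pos (j + 2)).ne'
      rcases k with _ | k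
      · simp [hΦ]
      · rw [← hX, h1, ih0, ih0, ih0, ih1] at e
        refine mul_left_cancel₀ hb ?_
        obtain h | h | h | h : k = j + 1 ∨ j = k + 1 ∨ j = k ∨ (k ≠ j + 1 ∧ j ≠ k + 1 ∧ j ≠ k) := by
          omega
        · subst h
          rw [if_neg (by omega), if_neg (by omega), if_pos (by omega), if_neg (by omega)] at e
          rw [if_pos (by omega)]
          simp only [add_assoc, Nat.reduceAdd] at e ⊢
          linarith
        · subst h
          rw [if_pos (by omega), if_neg (by omega), if_neg (by omega), if_pos (by omega)] at e
          rw [if_neg (by omega)]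
          simp only [add_assoc, Nat.reduceAdd] at e ⊢
          linarith
        · subst h
          rw [if_neg (by omega), if_pos (by omega), if_neg (by omega), if_neg (by omega)] at e
          rw [if_neg (by omega)]
          linarith
        · rw [if_neg (by omega), if_neg (by omega), if_neg (by omega), if_neg (by omega)] at e
          rw [if_neg (by omega)]
          linarith

/-- For a functional that makes the `P_k` orthonormal, the matrix of multiplication by the variable
is the Jacobi matrix. -/
theorem functional_X_mul_orthPoly_mul
    (hΦ : ∀ j k, Φ (J.orthPoly j * J.orthPoly k) = if j = k then 1 else 0) (j k : ℕ) :
    Φ (X * (J.orthPoly j * J.orthPoly k)) = J.symmEntry j k := by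
  have hC : ∀ (c : ℝ) (p : ℝ[X]), Φ (C c * p) = c * Φ p := fun c p => by
    rw [← smul_eq_C_mul, map_smul, smul_eq_mul]
  rcases j with _ | j
  · rw [← mul_assoc, X_mul_orthPoly_zero, add_mul, mul_assoc, mul_assoc, map_add, hC, hC, hΦ, hΦ,
      symmEntry]
    rcases k with _ | _ | k <;> simp
  · rw [← mul_assoc, X_mul_orthPoly_succ, add_mul, add_mul, mul_assoc, mul_assoc, mul_assoc,
      map_add, map_add, hC, hC, hC, hΦ, hΦ, hΦ, symmEntry]
    split_ifs <;> first | omega | (subst_vars; simp)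

/-- Powers of the variable are combinations of the polynomials `P_k`. -/
theorem X_pow_mem_span (n i : ℕ) (hi : i < n) :
    (X : ℝ[X]) ^ i ∈ Submodule.span ℝ (J.orthPoly '' Set.Iio n) := by
  induction i generalizing n with
  | zero => exact Submodule.subset_span ⟨0, by simpa using hi, by simp⟩
  | succ i ih =>
    obtain ⟨n, rfl⟩ : ∃ m, n = m + 1 := ⟨n - 1, by omega⟩
    have h := ih n (by omega)
    rw [pow_succ']
    have hs : ∀ (c : ℝ) (k : ℕ), k < n + 1 →
        C c * J.orthPoly k ∈ Submodule.span ℝ (J.orthPoly '' Set.Iio (n + 1)) := by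
      intro c k hk
      rw [← smul_eq_C_mul]
      exact Submodule.smul_mem _ _ (Submodule.subset_span ⟨k, hk, rfl⟩)
    refine Submodule.span_induction (p := fun q _ => X * q ∈ _) ?_ (by simp) ?_ ?_ h
    · rintro _ ⟨k, hk, rfl⟩
      simp only [Set.mem_Iio] at hk
      rcases k with _ | k
      · rw [X_mul_orthPoly_zero]
        exact Submodule.add_mem _ (hs _ _ (by omega)) (hs _ _ (by omega))
      · rw [X_mul_orthPoly_succ]
        exact Submodule.add_mem _ (Submodule.add_mem _ (hs _ _ (by omega)) (hs _ _ (by omega)))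
          (hs _ _ (by omega))
    · intro p q _ _ hp hq
      rw [mul_add]
      exact Submodule.add_mem _ hp hq
    · intro c p _ hp
      rw [mul_smul_comm]
      exact Submodule.smul_mem _ _ hp

/-- A functional that vanishes on the products `P_j P_k` with `j, k < n` vanishes on all
polynomials of degree less than `2n - 1`. -/
theorem functional_eq_zero_of_natDegree_lt {n : ℕ}
    (hΦ : ∀ j < n, ∀ k < n, Φ (J.orthPoly j * J.orthPoly k) = 0) {p : ℝ[X]}
    (hp : p.natDegree < 2 * n - 1) : Φ p = 0 := by
  have key : ∀ q ∈ Submodule.span ℝ (J.orthPoly '' Set.Iio n),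
      ∀ r ∈ Submodule.span ℝ (J.orthPoly '' Set.Iio n), Φ (q * r) = 0 := by
    intro q hq r hr
    refine Submodule.span_induction (p := fun q _ => Φ (q * r) = 0) ?_ (by simp) ?_ ?_ hq
    · rintro _ ⟨j, hj, rfl⟩
      refine Submodule.span_induction (p := fun r _ => Φ (_ * r) = 0) ?_ (by simp) ?_ ?_ hr
      · rintro _ ⟨k, hk, rfl⟩
        exact hΦ j hj k hk
      · intro p q _ _ hp hq
        rw [mul_add, map_add, hp, hq, add_zero]
      · intro c p _ hp
        rw [mul_smul_comm, map_smul, hp, smul_zero]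
    · intro p q _ _ hp hq
      rw [add_mul, map_add, hp, hq, add_zero]
    · intro c p _ hp
      rw [smul_mul_assoc, map_smul, hp, smul_zero]
  rw [p.as_sum_range_C_mul_X_pow, map_sum]
  refine Finset.sum_eq_zero fun i hi => ?_
  rw [Finset.mem_range] at hi
  rw [← smul_eq_C_mul, map_smul]
  -- As `i ≤ 2n - 2`, both exponents are at most `n - 1`.
  have : (X : ℝ[X]) ^ i = X ^ (min i (n - 1)) * X ^ (i - min i (n - 1)) := by
    rw [← pow_add]; congr 1; omega
  rw [this, key _ (X_pow_mem_span n _ (by omega)) _ (X_pow_mem_span n _ (by omega)), smul_zero]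

end Functional

end JacobiData

/-! ### Moments and functions of the second kind. -/

section Moments

open Polynomial

variable {μ : Measure ℝ} [IsFiniteMeasure μ] {s t : ℝ}

theorem integrable_eval (hμ : μ (Set.Icc s t)ᶜ = 0) (p : ℝ[X]) :
    Integrable (fun x => p.eval x) μ :=
  integrable_of_continuousOn_Icc hμ p.continuous.continuousOn

/-- Integration of polynomials against a finite measure with compact support. -/
noncomputable def momentFunctional (hμ : μ (Set.Icc s t)ᶜ = 0) : ℝ[X] →ₗ[ℝ] ℝ where
  toFun p := ∫ x, p.eval x ∂μ
  map_add' p q := by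
    simp only [eval_add]
    exact integral_add (integrable_eval hμ p) (integrable_eval hμ q)
  map_smul' c p := by
    simp only [eval_smul, smul_eq_mul, RingHom.id_apply]
    exact integral_const_mul _ _

theorem momentFunctional_apply (hμ : μ (Set.Icc s t)ᶜ = 0) (p : ℝ[X]) :
    momentFunctional hμ p = ∫ x, p.eval x ∂μ := rfl

end Moments

open Polynomial in
/-- The Stieltjes transform of the measure with density `p` with respect to `μ`. -/
noncomputable def polyStieltjes (μ : Measure ℝ) (p : ℝ[X]) (z : ℂ) : ℂ :=
  ∫ x : ℝ, ((p.eval x : ℝ) : ℂ) * (1 / ((x : ℂ) - z)) ∂μ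

section PolyStieltjes

open Polynomial

variable {μ : Measure ℝ} {s t : ℝ}

theorem polyStieltjes_one (z : ℂ) : polyStieltjes μ 1 z = stieltjes μ z := by
  simp [polyStieltjes, stieltjes]

variable [IsFiniteMeasure μ]

theorem integrable_eval_mul_one_div (hμ : μ (Set.Icc s t)ᶜ = 0) (p : ℝ[X]) {z : ℂ}
    (hz : z ∉ ((↑) : ℝ → ℂ) '' Set.Icc s t) :
    Integrable (fun x : ℝ => ((p.eval x : ℝ) : ℂ) * (1 / ((x : ℂ) - z))) μ :=
  integrable_of_continuousOn_Icc hμ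
    ((Complex.continuous_ofReal.comp p.continuous).continuousOn.mul (continuousOn_one_div_sub hz))

theorem polyStieltjes_add (hμ : μ (Set.Icc s t)ᶜ = 0) (p q : ℝ[X]) {z : ℂ}
    (hz : z ∉ ((↑) : ℝ → ℂ) '' Set.Icc s t) :
    polyStieltjes μ (p + q) z = polyStieltjes μ p z + polyStieltjes μ q z := by
  rw [polyStieltjes, polyStieltjes, polyStieltjes,
    ← integral_add (integrable_eval_mul_one_div hμ p hz) (integrable_eval_mul_one_div hμ q hz)]
  simp [add_mul]

omit [IsFiniteMeasure μ] in
theorem polyStieltjes_C_mul (c : ℝ) (p : ℝ[X]) (z : ℂ) :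
    polyStieltjes μ (C c * p) z = c * polyStieltjes μ p z := by
  rw [polyStieltjes, polyStieltjes, ← integral_const_mul]
  simp [mul_assoc]

/-- Write `x = z + (x - z)` under the integral. Functions of the second kind thus obey the
recurrence of the `P_k` up to a moment term, and this term vanishes once the `P_k` with `k ≥ 1` have
mean zero. -/
theorem polyStieltjes_X_mul (hμ : μ (Set.Icc s t)ᶜ = 0) (p : ℝ[X]) {z : ℂ}
    (hz : z ∉ ((↑) : ℝ → ℂ) '' Set.Icc s t) :
    polyStieltjes μ (X * p) z = z * polyStieltjes μ p z + (∫ x, p.eval x ∂μ : ℝ) := by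
  rw [polyStieltjes, polyStieltjes, ← integral_const_mul, ← integral_complex_ofReal,
    ← integral_add ((integrable_eval_mul_one_div hμ p hz).const_mul z)
      (g := fun x => ((p.eval x : ℝ) : ℂ)) (integrable_eval hμ p).ofReal]
  refine integral_congr_ae ?_
  filter_upwards [ae_mem_Icc hμ] with x hx
  have := ofReal_sub_ne_zero hz hx
  simp only [eval_mul, eval_X]
  push_cast
  field_simp
  ring

theorem tendsto_polyStieltjes_mul_I (hμ : μ (Set.Icc s t)ᶜ = 0) (p : ℝ[X]) :
    Filter.Tendsto (fun y : ℝ => polyStieltjes μ p (y * Complex.I)) Filter.atTop (nhds 0) := by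
  have hlim : Filter.Tendsto (fun y : ℝ => (∫ x, |p.eval x| ∂μ) * y⁻¹) Filter.atTop (nhds 0) := by
    simpa using tendsto_inv_atTop_zero.const_mul (∫ x, |p.eval x| ∂μ)
  refine squeeze_zero_norm' ?_ hlim
  filter_upwards [Filter.eventually_gt_atTop 0] with y hy
  rw [← integral_mul_const]
  refine norm_integral_le_of_norm_le ((integrable_eval hμ p).abs.mul_const _) ?_
  refine Filter.Eventually.of_forall fun x => ?_
  rw [norm_mul, Complex.norm_real, Real.norm_eq_abs, norm_div, norm_one, one_div]
  gcongr
  have := Complex.abs_im_le_norm ((x : ℂ) - y * Complex.I)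
  simpa [abs_of_pos hy] using this

end PolyStieltjes

/-! ### The resolvent vector and the orthogonality of the `P_k` for `μ`. -/

namespace JacobiData

variable (J : JacobiData)

/-- The vector `(H - z)⁻¹ e_0`. -/
noncomputable def resolventVec (z : ℂ) : SeqSpace :=
  Ring.inverse (J.H - algebraMap ℂ (SeqSpace →L[ℂ] SeqSpace) z) e0

theorem m_eq_neg_resolventVec (z : ℂ) : J.m z = -J.resolventVec z 0 := by
  rw [m, e0, lp.inner_single_left]
  simp [resolventVec, e0]

theorem e0_zero : (e0 : ℕ → ℂ) 0 = 1 := by simp [e0]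

theorem e0_succ (k : ℕ) : (e0 : ℕ → ℂ) (k + 1) = 0 := by simp [e0]

theorem isUnit_H_sub {z : ℂ} (hz : z ∈ resolventSet ℂ J.H) :
    IsUnit (J.H - algebraMap ℂ (SeqSpace →L[ℂ] SeqSpace) z) := by
  rw [spectrum.mem_resolventSet_iff, ← IsUnit.neg_iff] at hz
  simpa using hz

variable {J} in
theorem H_resolventVec {z : ℂ} (hz : z ∈ resolventSet ℂ J.H) :
    J.H (J.resolventVec z) = z • J.resolventVec z + e0 := by
  have h := Ring.mul_inverse_cancel _ (J.isUnit_H_sub hz)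
  have h' := congrArg (fun T : SeqSpace →L[ℂ] SeqSpace => T e0) h
  simp only [mul_apply_eq_comp, one_apply_eq_self, sub_apply, Algebra.algebraMap_eq_smul_one,
    smul_apply] at h'
  rw [← h', resolventVec, Algebra.algebraMap_eq_smul_one]
  abel

theorem eventually_mem_resolventSet :
    ∀ᶠ y : ℝ in Filter.atTop, (y * Complex.I : ℂ) ∈ resolventSet ℂ J.H := by
  filter_upwards [Filter.eventually_gt_atTop (‖J.H‖ * ‖(1 : SeqSpace →L[ℂ] SeqSpace)‖),
    Filter.eventually_gt_atTop 0] with y hy hy0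
  refine spectrum.mem_resolventSet_of_norm_lt_mul ?_
  simpa [abs_of_pos hy0] using hy

/-- The equation `(H - iy) u = e_0` gives `(y - ‖H‖) ‖u‖ ≤ ‖e_0‖`. -/
theorem tendsto_resolventVec (k : ℕ) :
    Filter.Tendsto (fun y : ℝ => J.resolventVec (y * Complex.I) k) Filter.atTop (nhds 0) := by
  have hlim : Filter.Tendsto (fun y : ℝ => ‖(e0 : SeqSpace)‖ * (y - ‖J.H‖)⁻¹) Filter.atTop
      (nhds 0) := by
    simpa [← sub_eq_add_neg] using (tendsto_inv_atTop_zero.comp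
      (Filter.tendsto_atTop_add_const_right _ (-‖J.H‖) Filter.tendsto_id)).const_mul
        ‖(e0 : SeqSpace)‖
  refine squeeze_zero_norm' ?_ hlim
  filter_upwards [J.eventually_mem_resolventSet, Filter.eventually_gt_atTop ‖J.H‖,
    Filter.eventually_gt_atTop 0] with y hy hyH hy0
  refine (lp.norm_apply_le_norm (by simp) _ k).trans ?_
  rw [← div_eq_mul_inv, le_div_iff₀ (by linarith)]
  have h1 : (y * Complex.I : ℂ) • J.resolventVec (y * Complex.I) =
      J.H (J.resolventVec (y * Complex.I)) - e0 := by
    rw [H_resolventVec hy]; abel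
  have h2 := congrArg norm h1
  rw [norm_smul] at h2
  have h3 := norm_sub_le (J.H (J.resolventVec (y * Complex.I))) e0
  have h4 := J.H.le_opNorm (J.resolventVec (y * Complex.I))
  simp [abs_of_pos hy0] at h2
  linarith

variable {J} in
theorem resolventVec_zero {z : ℂ} (hz : z ∈ resolventSet ℂ J.H) :
    z * J.resolventVec z 0 = J.a 0 * J.resolventVec z 0 - J.b 0 * J.resolventVec z 1 - 1 := by
  have h := congrArg (fun x : SeqSpace => x 0) (H_resolventVec hz)
  simp only [H_apply_zero, lp.coeFn_add, lp.coeFn_smul, Pi.add_apply, Pi.smul_apply, e0_zero,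
    smul_eq_mul] at h
  linear_combination -h

variable {J} in
theorem resolventVec_succ {z : ℂ} (hz : z ∈ resolventSet ℂ J.H) (k : ℕ) :
    z * J.resolventVec z (k + 1) = J.b k * J.resolventVec z k +
      J.a (k + 1) * J.resolventVec z (k + 1) + J.b (k + 1) * J.resolventVec z (k + 2) := by
  have h := congrArg (fun x : SeqSpace => x (k + 1)) (H_resolventVec hz)
  simp only [H_apply_succ, lp.coeFn_add, lp.coeFn_smul, Pi.add_apply, Pi.smul_apply, e0_succ,
    smul_eq_mul] at h
  linear_combination -h

/-- Row `0` of the resolvent equation writes `z u_0` as `-1` plus multiples of components that tend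
to zero. -/
theorem tendsto_mul_resolventVec_zero :
    Filter.Tendsto (fun y : ℝ => (y * Complex.I) * J.resolventVec (y * Complex.I) 0) Filter.atTop
      (nhds (-1)) := by
  have h : Filter.Tendsto (fun y : ℝ => J.a 0 * J.resolventVec (y * Complex.I) 0 -
      J.b 0 * J.resolventVec (y * Complex.I) 1 - 1) Filter.atTop (nhds (-1)) := by
    simpa using (((J.tendsto_resolventVec 0).const_mul (J.a 0 : ℂ)).sub
      ((J.tendsto_resolventVec 1).const_mul (J.b 0 : ℂ))).sub_const 1
  refine h.congr' ?_
  filter_upwards [J.eventually_mem_resolventSet] with y hy using (resolventVec_zero hy).symm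

theorem tendsto_mul_resolventVec_succ (k : ℕ) :
    Filter.Tendsto (fun y : ℝ => (y * Complex.I) * J.resolventVec (y * Complex.I) (k + 1))
      Filter.atTop (nhds 0) := by
  have h : Filter.Tendsto (fun y : ℝ => J.b k * J.resolventVec (y * Complex.I) k +
      J.a (k + 1) * J.resolventVec (y * Complex.I) (k + 1) +
      J.b (k + 1) * J.resolventVec (y * Complex.I) (k + 2)) Filter.atTop (nhds 0) := by
    simpa using (((J.tendsto_resolventVec k).const_mul (J.b k : ℂ)).add
      ((J.tendsto_resolventVec (k + 1)).const_mul (J.a (k + 1) : ℂ))).add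
      ((J.tendsto_resolventVec (k + 2)).const_mul (J.b (k + 1) : ℂ))
  refine h.congr' ?_
  filter_upwards [J.eventually_mem_resolventSet] with y hy using (resolventVec_succ hy k).symm

variable {J} {μ : Measure ℝ} {t₃ t₄ : ℝ}

/-- Since `m = -u_0`, the representation of `-1 / m` is row `0` of the resolvent equation divided by
`u_0`. It is used nowhere else; later arguments only use the orthogonality deduced from it. -/
theorem HasStieltjesForm.eventually_resolventVec_one (h : J.HasStieltjesForm μ t₃ t₄) :
    ∀ᶠ y : ℝ in Filter.atTop, J.resolventVec (y * Complex.I) 1 =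
      -J.b 0 * J.resolventVec (y * Complex.I) 0 *
        polyStieltjes μ (J.orthPoly 0) (y * Complex.I) := by
  have hb : (J.b 0 : ℂ) ≠ 0 := by exact_mod_cast (J.b_pos 0).ne'
  have hne : ∀ᶠ y : ℝ in Filter.atTop,
      (y * Complex.I) * J.resolventVec (y * Complex.I) 0 ≠ 0 :=
    J.tendsto_mul_resolventVec_zero.eventually_ne (by norm_num)
  filter_upwards [J.eventually_mem_resolventSet, Filter.eventually_gt_atTop 0, hne]
    with y hy hy0 hne
  have h1 := h.2.2 (y * Complex.I) (by simpa using hy0) hy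
  have h2 := resolventVec_zero hy
  have h3 := right_ne_zero_of_mul hne
  rw [m_eq_neg_resolventVec, neg_div_neg_eq, div_eq_iff h3] at h1
  rw [orthPoly_zero, polyStieltjes_one, stieltjes]
  refine mul_left_cancel₀ hb ?_
  linear_combination h2 - h1

theorem polyStieltjes_orthPoly_one [IsFiniteMeasure μ] (hμ : μ (Set.Icc t₃ t₄)ᶜ = 0)
    {z : ℂ} (hz : z ∉ ((↑) : ℝ → ℂ) '' Set.Icc t₃ t₄) :
    J.b 1 * polyStieltjes μ (J.orthPoly 1) z = (z - J.a 1) * polyStieltjes μ (J.orthPoly 0) z +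
      (∫ x, (J.orthPoly 0).eval x ∂μ : ℝ) := by
  have h := polyStieltjes_X_mul hμ (J.orthPoly 0) hz
  rw [X_mul_orthPoly_zero, polyStieltjes_add hμ _ _ hz, polyStieltjes_C_mul,
    polyStieltjes_C_mul] at h
  linear_combination h

theorem polyStieltjes_orthPoly_succ [IsFiniteMeasure μ] (hμ : μ (Set.Icc t₃ t₄)ᶜ = 0)
    {z : ℂ} (hz : z ∉ ((↑) : ℝ → ℂ) '' Set.Icc t₃ t₄) (k : ℕ) :
    J.b (k + 2) * polyStieltjes μ (J.orthPoly (k + 2)) z =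
      (z - J.a (k + 2)) * polyStieltjes μ (J.orthPoly (k + 1)) z -
        J.b (k + 1) * polyStieltjes μ (J.orthPoly k) z +
      (∫ x, (J.orthPoly (k + 1)).eval x ∂μ : ℝ) := by
  have h := polyStieltjes_X_mul hμ (J.orthPoly (k + 1)) hz
  rw [X_mul_orthPoly_succ, polyStieltjes_add hμ _ _ hz, polyStieltjes_add hμ _ _ hz,
    polyStieltjes_C_mul, polyStieltjes_C_mul, polyStieltjes_C_mul] at h
  linear_combination h

/-- Every polynomial `P_k` with `k ≥ 1` has mean zero, and the components of `(H - z)⁻¹ e_0` are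
given by functions of the second kind. -/
theorem HasStieltjesForm.integral_orthPoly_succ_aux (h : J.HasStieltjesForm μ t₃ t₄) (k : ℕ) :
    (∫ x, (J.orthPoly (k + 1)).eval x ∂μ = 0) ∧
    (∀ᶠ y : ℝ in Filter.atTop, J.resolventVec (y * Complex.I) (k + 1) =
      -J.b 0 * J.resolventVec (y * Complex.I) 0 *
        polyStieltjes μ (J.orthPoly k) (y * Complex.I)) ∧
    (∀ᶠ y : ℝ in Filter.atTop, J.resolventVec (y * Complex.I) (k + 2) =
      -J.b 0 * J.resolventVec (y * Complex.I) 0 *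
        polyStieltjes μ (J.orthPoly (k + 1)) (y * Complex.I)) := by
  have := h.1
  have hμ := h.2.1.2.1
  have hb : ∀ k, (J.b k : ℂ) ≠ 0 := fun k => by exact_mod_cast (J.b_pos k).ne'
  have hz : ∀ y : ℝ, 0 < y → (y * Complex.I : ℂ) ∉ ((↑) : ℝ → ℂ) '' Set.Icc t₃ t₄ :=
    fun y hy => notMem_ofReal_Icc (by simpa using hy.ne')
  -- The components `u_{k+1}` and the functions `-b_0 u_0 Q_k`, with `Q_k` of the second kind, obey
  -- the same recurrence up to the term `∫ P_{k+1}`. Multiplied by `iy`, every other term tends to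
  -- zero as `y → ∞`, while `iy u_0 → -1`, so a nonzero multiple of this integral must vanish.
  have step : ∀ k,
      (∀ᶠ y : ℝ in Filter.atTop, J.resolventVec (y * Complex.I) (k + 1) =
        -J.b 0 * J.resolventVec (y * Complex.I) 0 *
          polyStieltjes μ (J.orthPoly k) (y * Complex.I)) →
      (∀ᶠ y : ℝ in Filter.atTop, J.resolventVec (y * Complex.I) (k + 2) =
        -J.b 0 * J.resolventVec (y * Complex.I) 0 *
          polyStieltjes μ (J.orthPoly (k + 1)) (y * Complex.I)) →
      ∫ x, (J.orthPoly (k + 1)).eval x ∂μ = 0 := by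
    intro k h1 h2
    set c : ℝ := ∫ x, (J.orthPoly (k + 1)).eval x ∂μ with hc
    have hL : Filter.Tendsto (fun y : ℝ => (J.b (k + 2) : ℂ) * ((y * Complex.I) *
        J.resolventVec (y * Complex.I) (k + 3))) Filter.atTop (nhds 0) := by
      simpa using (J.tendsto_mul_resolventVec_succ (k + 2)).const_mul (J.b (k + 2) : ℂ)
    have hR : Filter.Tendsto (fun y : ℝ => -(J.b 0 : ℂ) *
        ((y * Complex.I) * J.resolventVec (y * Complex.I) 0) *
        (J.b (k + 2) * polyStieltjes μ (J.orthPoly (k + 2)) (y * Complex.I) - c)) Filter.atTop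
        (nhds (-(J.b 0 : ℂ) * (-1) * (J.b (k + 2) * 0 - c))) :=
      (J.tendsto_mul_resolventVec_zero.const_mul _).mul
        (((tendsto_polyStieltjes_mul_I hμ _).const_mul _).sub_const _)
    have heq : -(J.b 0 : ℂ) * (-1) * (J.b (k + 2) * 0 - c) = 0 := by
      refine tendsto_nhds_unique (hR.congr' ?_) hL
      filter_upwards [h1, h2, Filter.eventually_gt_atTop 0, J.eventually_mem_resolventSet]
        with y h1 h2 hy hy'
      have h3 := polyStieltjes_orthPoly_succ (J := J) hμ (hz y hy) k
      have h4 := resolventVec_succ hy' (k + 1)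
      simp only [add_assoc, Nat.reduceAdd] at h4
      rw [h1, h2] at h4
      rw [h3]
      linear_combination (y * Complex.I) * h4
    have : (c : ℂ) = 0 := by
      have := hb 0
      simpa [this] using heq
    exact_mod_cast this
  induction k with
  | zero =>
    have h0 := h.eventually_resolventVec_one
    have h1 : ∀ᶠ y : ℝ in Filter.atTop, J.resolventVec (y * Complex.I) 2 =
        -J.b 0 * J.resolventVec (y * Complex.I) 0 *
          polyStieltjes μ (J.orthPoly 1) (y * Complex.I) := by
      filter_upwards [h0, Filter.eventually_gt_atTop 0, J.eventually_mem_resolventSet]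
        with y h0 hy hy'
      have h3 := polyStieltjes_orthPoly_one (J := J) hμ (hz y hy)
      have h4 := resolventVec_succ hy' 0
      have h5 : ∫ x, (J.orthPoly 0).eval x ∂μ = 1 := by simp
      rw [h5] at h3
      simp only [zero_add] at h4
      rw [h0] at h4
      refine mul_left_cancel₀ (hb 1) ?_
      push_cast at h3
      linear_combination -h4 + J.b 0 * J.resolventVec (y * Complex.I) 0 * h3
    exact ⟨step 0 h0 h1, h0, h1⟩
  | succ k ih =>
    obtain ⟨hi, h1, h2⟩ := ih
    -- With mean zero known for `P_{k+1}`, the two recurrences agree and the representation moves up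
    -- by one index.
    have h3 : ∀ᶠ y : ℝ in Filter.atTop, J.resolventVec (y * Complex.I) (k + 3) =
        -J.b 0 * J.resolventVec (y * Complex.I) 0 *
          polyStieltjes μ (J.orthPoly (k + 2)) (y * Complex.I) := by
      filter_upwards [h1, h2, Filter.eventually_gt_atTop 0, J.eventually_mem_resolventSet]
        with y h1 h2 hy hy'
      have h3 := polyStieltjes_orthPoly_succ (J := J) hμ (hz y hy) k
      have h4 := resolventVec_succ hy' (k + 1)
      simp only [add_assoc, Nat.reduceAdd] at h4
      rw [h1, h2] at h4
      rw [hi] at h3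
      push_cast at h3
      refine mul_left_cancel₀ (hb (k + 2)) ?_
      linear_combination -h4 + J.b 0 * J.resolventVec (y * Complex.I) 0 * h3
    exact ⟨step (k + 1) h2 h3, h2, h3⟩

theorem HasStieltjesForm.integral_orthPoly (h : J.HasStieltjesForm μ t₃ t₄) (k : ℕ) :
    ∫ x, (J.orthPoly k).eval x ∂μ = if k = 0 then 1 else 0 := by
  have := h.1
  rcases k with _ | k
  · simp
  · simpa using (h.integral_orthPoly_succ_aux k).1

end JacobiData

/-! ### Orthonormal expansions in `L²(μ)`. -/

section Expansions

open Polynomial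

variable {J : JacobiData} {μ : Measure ℝ} {t₃ t₄ : ℝ}

/-- The function `∑_{k < N} c_k P_k` on the real line. -/
noncomputable def JacobiData.expansion (J : JacobiData) (N : ℕ) (c : ℕ → ℂ) (x : ℝ) : ℂ :=
  ∑ k ∈ Finset.range N, c k * ((J.orthPoly k).eval x : ℝ)

theorem JacobiData.continuous_expansion (N : ℕ) (c : ℕ → ℂ) : Continuous (J.expansion N c) :=
  continuous_finsetSum _ fun k _ =>
    continuous_const.mul (Complex.continuous_ofReal.comp (J.orthPoly k).continuous)

theorem JacobiData.HasStieltjesForm.measure_compl (h : J.HasStieltjesForm μ t₃ t₄) :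
    μ (Set.Icc t₃ t₄)ᶜ = 0 := h.2.1.2.1

/-- The integral of a polynomial against the squared modulus of an expansion. -/
theorem integral_eval_mul_normSq_expansion [IsFiniteMeasure μ] (hμ : μ (Set.Icc t₃ t₄)ᶜ = 0)
    (q : ℝ[X]) (N : ℕ) (c : ℕ → ℂ) :
    ((∫ x, q.eval x * Complex.normSq (J.expansion N c x) ∂μ : ℝ) : ℂ) =
      ∑ j ∈ Finset.range N, ∑ k ∈ Finset.range N, (starRingEnd ℂ) (c j) * c k *
        (momentFunctional hμ (q * (J.orthPoly j * J.orthPoly k)) : ℝ) := by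
  have hint : ∀ j k, Integrable (fun x : ℝ => (starRingEnd ℂ) (c j) * c k *
      (((q * (J.orthPoly j * J.orthPoly k)).eval x : ℝ) : ℂ)) μ := fun j k =>
    (integrable_eval hμ _).ofReal.const_mul _
  rw [← integral_complex_ofReal]
  have hpt : ∀ x : ℝ, ((q.eval x * Complex.normSq (J.expansion N c x) : ℝ) : ℂ) =
      ∑ j ∈ Finset.range N, ∑ k ∈ Finset.range N, (starRingEnd ℂ) (c j) * c k *
        (((q * (J.orthPoly j * J.orthPoly k)).eval x : ℝ) : ℂ) := by
    intro x
    rw [Complex.ofReal_mul, Complex.normSq_eq_conj_mul_self, JacobiData.expansion, map_sum,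
      Finset.sum_mul_sum, Finset.mul_sum]
    refine Finset.sum_congr rfl fun j _ => ?_
    rw [Finset.mul_sum]
    refine Finset.sum_congr rfl fun k _ => ?_
    simp only [eval_mul, map_mul, Complex.conj_ofReal, Complex.ofReal_mul]
    ring
  simp_rw [hpt]
  rw [integral_finsetSum _ fun j _ => integrable_finsetSum _ fun k _ => hint j k]
  refine Finset.sum_congr rfl fun j _ => ?_
  rw [integral_finsetSum _ fun k _ => hint j k]
  refine Finset.sum_congr rfl fun k _ => ?_
  rw [integral_const_mul, momentFunctional_apply, integral_complex_ofReal]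

variable (h : J.HasStieltjesForm μ t₃ t₄)
include h

theorem JacobiData.HasStieltjesForm.momentFunctional_orthPoly_mul [IsFiniteMeasure μ] (j k : ℕ) :
    momentFunctional h.measure_compl (J.orthPoly j * J.orthPoly k) = if j = k then 1 else 0 :=
  JacobiData.functional_orthPoly_mul _ h.integral_orthPoly j k

theorem JacobiData.HasStieltjesForm.integral_normSq_expansion (N : ℕ) (c : ℕ → ℂ) :
    ∫ x, Complex.normSq (J.expansion N c x) ∂μ =
      ∑ k ∈ Finset.range N, Complex.normSq (c k) := by
  have := h.1
  have h1 := integral_eval_mul_normSq_expansion (J := J) h.measure_compl 1 N c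
  simp only [eval_one, one_mul, h.momentFunctional_orthPoly_mul] at h1
  have h2 : ((∫ x, Complex.normSq (J.expansion N c x) ∂μ : ℝ) : ℂ) =
      ((∑ k ∈ Finset.range N, Complex.normSq (c k) : ℝ) : ℂ) := by
    rw [h1, Complex.ofReal_sum]
    refine Finset.sum_congr rfl fun j hj => ?_
    rw [Finset.sum_eq_single_of_mem j hj]
    · simp [Complex.normSq_eq_conj_mul_self]
    · intro k _ hk
      simp [hk.symm]
  exact_mod_cast h2

theorem JacobiData.HasStieltjesForm.integral_mul_normSq_expansion (N : ℕ) (c : ℕ → ℂ) :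
    ((∫ x, x * Complex.normSq (J.expansion N c x) ∂μ : ℝ) : ℂ) =
      ∑ j ∈ Finset.range N, ∑ k ∈ Finset.range N,
        (starRingEnd ℂ) (c j) * c k * (J.symmEntry j k : ℝ) := by
  have := h.1
  have h1 := integral_eval_mul_normSq_expansion (J := J) h.measure_compl X N c
  simpa only [eval_X, JacobiData.functional_X_mul_orthPoly_mul _ h.momentFunctional_orthPoly_mul]
    using h1

/-- The quadratic form of the Jacobi matrix inherits the separation of a point from the interval
`[t₃, t₄]`. -/
theorem JacobiData.HasStieltjesForm.le_re_quadraticForm {z γ : ℂ} {δ : ℝ}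
    (hδ : ∀ x ∈ Set.Icc t₃ t₄, δ ≤ (γ * (x - z)).re) (N : ℕ) (c : ℕ → ℂ) :
    δ * ∑ k ∈ Finset.range N, Complex.normSq (c k) ≤
      (γ * (∑ j ∈ Finset.range N, ∑ k ∈ Finset.range N,
        (starRingEnd ℂ) (c j) * c k * (J.symmEntry j k : ℝ) -
        z * (∑ k ∈ Finset.range N, Complex.normSq (c k) : ℝ))).re := by
  have := h.1
  have hint : Integrable (fun x => Complex.normSq (J.expansion N c x)) μ :=
    integrable_of_continuousOn_Icc h.measure_compl
      (Complex.continuous_normSq.comp (JacobiData.continuous_expansion N c)).continuousOn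
  have hintx : Integrable (fun x => x * Complex.normSq (J.expansion N c x)) μ :=
    integrable_of_continuousOn_Icc h.measure_compl
      (continuous_id.mul
        (Complex.continuous_normSq.comp (JacobiData.continuous_expansion N c))).continuousOn
  rw [← h.integral_mul_normSq_expansion, ← h.integral_normSq_expansion]
  have h1 : (γ * (((∫ x, x * Complex.normSq (J.expansion N c x) ∂μ : ℝ) : ℂ) -
      z * (∫ x, Complex.normSq (J.expansion N c x) ∂μ : ℝ))).re =
      ∫ x, γ.re * (x * Complex.normSq (J.expansion N c x)) -
        (γ * z).re * Complex.normSq (J.expansion N c x) ∂μ := by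
    rw [integral_sub (hintx.const_mul _) (hint.const_mul _), integral_const_mul,
      integral_const_mul, mul_sub, ← mul_assoc, Complex.sub_re, Complex.re_mul_ofReal,
      Complex.re_mul_ofReal]
  rw [h1, ← integral_const_mul]
  refine integral_mono_ae (hint.const_mul _) ((hintx.const_mul _).sub (hint.const_mul _)) ?_
  filter_upwards [ae_mem_Icc h.measure_compl] with x hx
  have h2 := hδ x hx
  rw [mul_sub, Complex.sub_re, Complex.re_mul_ofReal] at h2
  have h3 := mul_le_mul_of_nonneg_right h2 (Complex.normSq_nonneg (J.expansion N c x))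
  linarith

/-- Bessel's inequality for the function `1 / (x - z)`. -/
theorem JacobiData.HasStieltjesForm.sum_normSq_polyStieltjes_le {z : ℂ}
    (hz : z ∉ ((↑) : ℝ → ℂ) '' Set.Icc t₃ t₄) (N : ℕ) :
    ∑ k ∈ Finset.range N, Complex.normSq (polyStieltjes μ (J.orthPoly k) z) ≤
      ∫ x : ℝ, Complex.normSq (1 / ((x : ℂ) - z)) ∂μ := by
  have := h.1
  have hμ := h.measure_compl
  set c : ℕ → ℂ := fun k => polyStieltjes μ (J.orthPoly k) z with hc
  set f : ℝ → ℂ := fun x => 1 / ((x : ℂ) - z) with hf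
  have hfc : ContinuousOn f (Set.Icc t₃ t₄) := continuousOn_one_div_sub hz
  have hgc : Continuous (J.expansion N c) := JacobiData.continuous_expansion N c
  have hi1 : Integrable (fun x => Complex.normSq (f x)) μ :=
    integrable_of_continuousOn_Icc hμ (Complex.continuous_normSq.comp_continuousOn hfc)
  have hi2 : Integrable (fun x => Complex.normSq (J.expansion N c x)) μ :=
    integrable_of_continuousOn_Icc hμ (Complex.continuous_normSq.comp hgc).continuousOn
  have hi3 : Integrable (fun x => f x * (starRingEnd ℂ) (J.expansion N c x)) μ :=
    integrable_of_continuousOn_Icc hμ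
      (hfc.mul (Complex.continuous_conj.comp hgc).continuousOn)
  have hcross : ∫ x, f x * (starRingEnd ℂ) (J.expansion N c x) ∂μ =
      ((∑ k ∈ Finset.range N, Complex.normSq (c k) : ℝ) : ℂ) := by
    have hpt : ∀ x, f x * (starRingEnd ℂ) (J.expansion N c x) =
        ∑ k ∈ Finset.range N,
          (starRingEnd ℂ) (c k) * ((((J.orthPoly k).eval x : ℝ) : ℂ) * (1 / ((x : ℂ) - z))) := by
      intro x
      rw [JacobiData.expansion, map_sum, Finset.mul_sum]
      refine Finset.sum_congr rfl fun k _ => ?_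
      simp only [map_mul, Complex.conj_ofReal, hf]
      ring
    simp_rw [hpt]
    rw [integral_finsetSum _ fun k _ => (integrable_eval_mul_one_div hμ _ hz).const_mul _,
      Complex.ofReal_sum]
    refine Finset.sum_congr rfl fun k _ => ?_
    rw [integral_const_mul, Complex.normSq_eq_conj_mul_self]
    rfl
  have hcross' : ∫ x, (f x * (starRingEnd ℂ) (J.expansion N c x)).re ∂μ =
      ∑ k ∈ Finset.range N, Complex.normSq (c k) := by
    have h1 := integral_re hi3
    simp only [RCLike.re_eq_complex_re] at h1
    rw [h1, hcross, Complex.ofReal_re]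
  -- The `P_k` are real, so the `c k` are the Fourier coefficients of `f`; the cross term and the
  -- square of the expansion both equal `∑ |c_k|²`.
  have hpos : 0 ≤ ∫ x, Complex.normSq (f x - J.expansion N c x) ∂μ :=
    integral_nonneg fun x => Complex.normSq_nonneg _
  simp_rw [Complex.normSq_sub] at hpos
  have hi3' : Integrable (fun x => (f x * (starRingEnd ℂ) (J.expansion N c x)).re) μ := hi3.re
  rw [integral_sub (hi1.fun_add hi2) (hi3'.const_mul _), integral_add hi1 hi2, integral_const_mul,
    hcross', h.integral_normSq_expansion] at hpos
  linarith

end Expansions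

/-! ### The tail operator and the Schur complement. -/

/-- The right shift on `ℓ²`. -/
noncomputable def rightShift : SeqSpace →L[ℂ] SeqSpace :=
  weightedComp (fun k => if k = 0 then 0 else 1) (fun k => k - 1)
    ⟨1, fun k => by split_ifs <;> simp⟩ (by
      intro i hi j hj hij
      simp only [ne_eq, ite_eq_left_iff, Set.mem_ofPred_eq] at hi hj
      have hi' : i ≠ 0 := by rintro rfl; simp at hi
      have hj' : j ≠ 0 := by rintro rfl; simp at hj
      simp only at hij
      omega)

/-- The left shift on `ℓ²`. -/
noncomputable def leftShift : SeqSpace →L[ℂ] SeqSpace :=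
  weightedComp (fun _ => 1) (fun k => k + 1) ⟨1, fun k => by simp⟩
    (fun _ _ _ _ h => Nat.succ_injective h)

@[simp] theorem rightShift_zero (x : SeqSpace) : rightShift x 0 = 0 := by
  exact (weightedComp_apply _ _ _ _ _ _).trans (by simp)

@[simp] theorem rightShift_succ (x : SeqSpace) (k : ℕ) : rightShift x (k + 1) = x k := by
  exact (weightedComp_apply _ _ _ _ _ _).trans (by simp)

@[simp] theorem leftShift_apply (x : SeqSpace) (k : ℕ) : leftShift x k = x (k + 1) := by
  exact (weightedComp_apply _ _ _ _ _ _).trans (by simp)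

theorem SeqSpace.add_apply (x y : SeqSpace) (k : ℕ) : (x + y) k = x k + y k := rfl

theorem SeqSpace.sub_apply (x y : SeqSpace) (k : ℕ) : (x - y) k = x k - y k := rfl

theorem SeqSpace.smul_apply (c : ℂ) (x : SeqSpace) (k : ℕ) : (c • x) k = c * x k := rfl

theorem SeqSpace.ext_iff {x y : SeqSpace} : x = y ↔ ∀ k, x k = y k :=
  ⟨fun h k => by rw [h], fun h => lp.ext (funext h)⟩

namespace JacobiData

variable (J : JacobiData)

/-- The selfadjoint Jacobi operator with diagonal `a_1, a_2, …` and off-diagonal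
`b_1, b_2, …`. -/
noncomputable def tailOp : SeqSpace →L[ℂ] SeqSpace := leftShift ∘L J.H ∘L rightShift

theorem tailOp_zero (x : SeqSpace) : J.tailOp x 0 = J.a 1 * x 0 + J.b 1 * x 1 := by
  simp [tailOp, H_apply_succ]

theorem tailOp_succ (x : SeqSpace) (k : ℕ) : J.tailOp x (k + 1) =
    J.b (k + 1) * x k + J.a (k + 2) * x (k + 1) + J.b (k + 2) * x (k + 2) := by
  simp [tailOp, H_apply_succ]

/-- The block form of `H` with respect to `e_0` and its complement: the tail feels `x_0` only
through a multiple of `e_0`. -/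
theorem leftShift_H (x : SeqSpace) :
    leftShift (J.H x) = J.tailOp (leftShift x) + (J.b 0 * x 0) • e0 := by
  rw [SeqSpace.ext_iff]
  rintro (_ | k)
  · rw [leftShift_apply, H_apply_succ, SeqSpace.add_apply, SeqSpace.smul_apply, tailOp_zero,
      e0_zero, leftShift_apply, leftShift_apply]
    ring
  · rw [leftShift_apply, H_apply_succ, SeqSpace.add_apply, SeqSpace.smul_apply, tailOp_succ,
      e0_succ, leftShift_apply, leftShift_apply, leftShift_apply]
    ring

theorem tailOp_single (k j : ℕ) :
    J.tailOp (lp.single 2 k (1 : ℂ)) j = J.symmEntry j k := by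
  rcases j with _ | j
  · rw [tailOp_zero]
    rcases k with _ | _ | k <;> simp [symmEntry]
  · rw [tailOp_succ]
    simp only [lp.single_apply, Pi.single_apply, symmEntry]
    split_ifs <;> first | omega | (subst_vars; simp)

variable {J} {μ : Measure ℝ} {t₃ t₄ : ℝ}

/-- On finitely supported sequences the form of `tailOp` is that of multiplication by the variable
in `L²(μ)`. Such sequences are dense and the inequality is a closed condition. -/
theorem HasStieltjesForm.le_re_inner_tailOp (h : J.HasStieltjesForm μ t₃ t₄) {z γ : ℂ} {δ : ℝ}
    (hδ : ∀ x ∈ Set.Icc t₃ t₄, δ ≤ (γ * (x - z)).re) (x : SeqSpace) :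
    δ * ‖x‖ ^ 2 ≤ (γ * inner ℂ x (J.tailOp x - z • x)).re := by
  have hclosed : IsClosed {x : SeqSpace |
      δ * ‖x‖ ^ 2 ≤ (γ * inner ℂ x (J.tailOp x - z • x)).re} :=
    isClosed_le (by fun_prop)
      (Complex.continuous_re.comp (continuous_const.mul
        (continuous_id.inner (J.tailOp.continuous.sub (continuous_id.const_smul z)))))
  have hlim := (lp.hasSum_single (p := 2) (by simp) x).tendsto_sum_nat
  refine hclosed.mem_of_tendsto hlim (Filter.Eventually.of_forall fun N => ?_)
  have hx : ∀ k, lp.single 2 k (x k) = x k • (lp.single 2 k (1 : ℂ) : SeqSpace) := by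
    intro k
    rw [← lp.single_smul, smul_eq_mul, mul_one]
  have hinner : ∀ j k, inner ℂ (lp.single 2 j (1 : ℂ) : SeqSpace) (lp.single 2 k (1 : ℂ)) =
      if j = k then 1 else 0 := by
    intro j k
    rw [lp.inner_single_left]
    simp [Pi.single_apply]
  have hinner' : ∀ j k, inner ℂ (lp.single 2 j (1 : ℂ) : SeqSpace)
      (J.tailOp (lp.single 2 k (1 : ℂ))) = J.symmEntry j k := by
    intro j k
    rw [lp.inner_single_left, tailOp_single]
    simp
  set y : SeqSpace := ∑ k ∈ Finset.range N, lp.single 2 k (x k) with hy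
  have hyy : inner ℂ y y = ((∑ k ∈ Finset.range N, Complex.normSq (x k) : ℝ) : ℂ) := by
    simp only [hy, hx, sum_inner, inner_sum, inner_smul_left, inner_smul_right, hinner]
    rw [Complex.ofReal_sum]
    refine Finset.sum_congr rfl fun j hj => ?_
    rw [Finset.sum_eq_single_of_mem j hj]
    · simp [Complex.normSq_eq_conj_mul_self, mul_comm]
    · intro k _ hk
      simp [hk]
  have hyT : inner ℂ y (J.tailOp y) = ∑ j ∈ Finset.range N, ∑ k ∈ Finset.range N,
      (starRingEnd ℂ) (x j) * x k * (J.symmEntry j k : ℝ) := by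
    simp only [hy, hx, map_sum, map_smul, sum_inner, inner_sum, inner_smul_left,
      inner_smul_right, hinner']
    simp only [Finset.mul_sum]
    rw [Finset.sum_comm]
    refine Finset.sum_congr rfl fun j _ => Finset.sum_congr rfl fun k _ => ?_
    ring
  have hnorm : ‖y‖ ^ 2 = ∑ k ∈ Finset.range N, Complex.normSq (x k) := by
    have := inner_self_eq_norm_sq_to_K (𝕜 := ℂ) y
    rw [hyy] at this
    have h2 : ((∑ k ∈ Finset.range N, Complex.normSq (x k) : ℝ) : ℂ) = ((‖y‖ ^ 2 : ℝ) : ℂ) := by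
      rw [this]; simp
    exact (Complex.ofReal_injective h2).symm
  simp only [Set.mem_ofPred_eq]
  rw [hnorm, inner_sub_right, inner_smul_right, hyy, hyT]
  exact h.le_re_quadraticForm hδ N (fun k => x k)

/-- The form bound makes `tailOp - z` coercive, so it is invertible in the manner of Lax–Milgram. -/
theorem HasStieltjesForm.isUnit_tailOp_sub (h : J.HasStieltjesForm μ t₃ t₄) {z : ℂ}
    (hz : z ∉ ((↑) : ℝ → ℂ) '' Set.Icc t₃ t₄) :
    IsUnit (J.tailOp - z • (1 : SeqSpace →L[ℂ] SeqSpace)) := by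
  obtain ⟨γ, hγ, δ, hδ, hsep⟩ := exists_separating_functional hz
  refine ContinuousLinearMap.isUnit_of_forall_le_norm_inner_map _ (c := ⟨δ, hδ.le⟩) hδ fun x => ?_
  have h1 := h.le_re_inner_tailOp hsep x
  have h2 := Complex.re_le_norm (γ * inner ℂ x (J.tailOp x - z • x))
  rw [norm_mul, hγ, one_mul, norm_inner_symm] at h2
  simp only [sub_apply, smul_apply, one_apply_eq_self]
  change ‖x‖ ^ 2 * δ ≤ _
  linarith

/-- The vector of functions of the second kind, which solves `(tailOp - z) q = e_0`. -/
theorem HasStieltjesForm.exists_tailOp_eq (h : J.HasStieltjesForm μ t₃ t₄) {z : ℂ}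
    (hz : z ∉ ((↑) : ℝ → ℂ) '' Set.Icc t₃ t₄) :
    ∃ q : SeqSpace, J.tailOp q = z • q + e0 ∧ q 0 = stieltjes μ z := by
  have := h.1
  have hμ := h.measure_compl
  -- Bessel's inequality bounds the partial sums uniformly, so the sequence is in `ℓ²`.
  have hmem : Memℓp (fun k => polyStieltjes μ (J.orthPoly k) z) 2 := by
    refine memℓp_gen' (C := ∫ x : ℝ, Complex.normSq (1 / ((x : ℂ) - z)) ∂μ) fun s => ?_
    obtain ⟨N, hN⟩ := s.exists_nat_subset_range
    refine le_trans ?_ (h.sum_normSq_polyStieltjes_le hz N)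
    refine le_trans (Finset.sum_le_sum_of_subset_of_nonneg hN fun _ _ _ => by positivity) ?_
    refine Finset.sum_le_sum fun k _ => ?_
    rw [Complex.normSq_eq_norm_sq]
    norm_num
  refine ⟨⟨_, hmem⟩, ?_, ?_⟩
  · rw [SeqSpace.ext_iff]
    rintro (_ | k)
    · have h1 := polyStieltjes_orthPoly_one (J := J) hμ hz
      rw [h.integral_orthPoly] at h1
      rw [tailOp_zero]
      simp only [lp.coeFn_add, lp.coeFn_smul, Pi.add_apply, Pi.smul_apply, e0_zero, smul_eq_mul]
      simp only [if_true, Complex.ofReal_one] at h1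
      linear_combination h1
    · have h1 := polyStieltjes_orthPoly_succ (J := J) hμ hz k
      rw [h.integral_orthPoly] at h1
      rw [tailOp_succ]
      simp only [lp.coeFn_add, lp.coeFn_smul, Pi.add_apply, Pi.smul_apply, e0_succ, smul_eq_mul]
      simp only [Nat.add_eq_zero_iff, one_ne_zero, and_false, if_false, Complex.ofReal_zero] at h1
      linear_combination h1
  · change polyStieltjes μ (J.orthPoly 0) z = _
    rw [orthPoly_zero, polyStieltjes_one]

/-- The function `a_0 - z + b_0² S(z)`, where `S` is the Stieltjes transform of `μ`. -/
noncomputable def charFun (J : JacobiData) (μ : Measure ℝ) (z : ℂ) : ℂ :=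
  (J.a 0 : ℂ) - z + ((J.b 0 ^ 2 : ℝ) : ℂ) * stieltjes μ z

/-- Off `[t₃, t₄]` the tail can be eliminated with `(tailOp - z)⁻¹`, whose value at `e_0` is `q`.
What remains is a scalar equation for `x_0` with coefficient `charFun`; if this is nonzero, `H - z`
is bijective. -/
theorem HasStieltjesForm.mem_resolventSet (h : J.HasStieltjesForm μ t₃ t₄) {z : ℂ}
    (hz : z ∉ ((↑) : ℝ → ℂ) '' Set.Icc t₃ t₄) (hF : J.charFun μ z ≠ 0) :
    z ∈ resolventSet ℂ J.H := by
  obtain ⟨q, hq, hq0⟩ := h.exists_tailOp_eq hz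
  have hT := ContinuousLinearMap.isUnit_iff_bijective.1 (h.isUnit_tailOp_sub hz)
  have hTq : (J.tailOp - z • (1 : SeqSpace →L[ℂ] SeqSpace)) q = e0 := by simp [hq]
  rw [spectrum.mem_resolventSet_iff, ← IsUnit.neg_iff, neg_sub,
    ContinuousLinearMap.isUnit_iff_bijective, Algebra.algebraMap_eq_smul_one]
  unfold charFun at hF
  push_cast at hF
  constructor
  · rw [injective_iff_map_eq_zero]
    intro x hx
    have hx' : J.H x = z • x := by simpa [sub_eq_zero] using hx
    have h1 : leftShift x = -(J.b 0 * x 0) • q := by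
      apply hT.1
      rw [map_smul, hTq]
      have h2 := J.leftShift_H x
      rw [hx', map_smul] at h2
      simp only [sub_apply, smul_apply, one_apply_eq_self, h2]
      module
    have h2 := congrArg (fun y : SeqSpace => y 0) h1
    have h3 := congrArg (fun y : SeqSpace => y 0) hx'
    simp only [H_apply_zero, lp.coeFn_smul, Pi.smul_apply, leftShift_apply, zero_add,
      smul_eq_mul, hq0] at h2 h3
    have h4 : (J.a 0 - z + J.b 0 ^ 2 * stieltjes μ z) * x 0 = 0 := by
      linear_combination h3 + J.b 0 * h2
    have hx0 : x 0 = 0 := (mul_eq_zero.1 h4).resolve_left hF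
    rw [hx0, mul_zero, neg_zero, zero_smul] at h1
    rw [SeqSpace.ext_iff]
    rintro (_ | k)
    · simpa using hx0
    · have := congrArg (fun y : SeqSpace => y k) h1
      simpa using this
  · intro y
    obtain ⟨g, hg⟩ := hT.2 (leftShift y)
    have hg' : J.tailOp g = z • g + leftShift y := by
      rw [← hg]; simp
    -- The tail rows force the tail of a solution to be `g - b_0 x_0 q`. Inserting this into row `0`
    -- determines `x_0`, which is `c`.
    set c : ℂ := (y 0 + J.b 0 * g 0) / (J.a 0 - z + J.b 0 ^ 2 * stieltjes μ z) with hc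
    have hc' : c * (J.a 0 - z + J.b 0 ^ 2 * stieltjes μ z) = y 0 + J.b 0 * g 0 :=
      div_mul_cancel₀ _ hF
    set x : SeqSpace := c • e0 + rightShift (g - (J.b 0 * c) • q) with hx
    have hx0 : x 0 = c := by
      rw [hx, SeqSpace.add_apply, SeqSpace.smul_apply, e0_zero, rightShift_zero]
      ring
    have hxl : leftShift x = g - (J.b 0 * c) • q := by
      rw [SeqSpace.ext_iff]
      intro k
      rw [leftShift_apply, hx, SeqSpace.add_apply, SeqSpace.smul_apply, e0_succ, rightShift_succ]
      ring
    have hx1 : x 1 = g 0 - J.b 0 * c * stieltjes μ z := by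
      have := congrArg (fun y : SeqSpace => y 0) hxl
      simpa only [leftShift_apply, SeqSpace.sub_apply, SeqSpace.smul_apply, hq0] using this
    refine ⟨x, ?_⟩
    have hl : leftShift (J.H x - z • x) = leftShift y := by
      rw [map_sub, leftShift_H, map_smul, hxl, hx0, map_sub, map_smul, hg', hq]
      module
    rw [SeqSpace.ext_iff]
    rintro (_ | k)
    · simp only [sub_apply, smul_apply, one_apply_eq_self, lp.coeFn_sub, lp.coeFn_smul,
        Pi.sub_apply, Pi.smul_apply, H_apply_zero, smul_eq_mul, hx0, hx1]
      linear_combination hc'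
    · have := congrArg (fun y : SeqSpace => y k) hl
      simpa only [leftShift_apply, sub_apply, smul_apply, one_apply_eq_self] using this

/-- The same elimination, applied to the resolvent vector. The hypothesis on `-1 / m` covers only
the upper half-plane; the ellipse also needs real points and the lower half-plane. -/
theorem HasStieltjesForm.m_mul_charFun (h : J.HasStieltjesForm μ t₃ t₄) {z : ℂ}
    (hz : z ∉ ((↑) : ℝ → ℂ) '' Set.Icc t₃ t₄) (hzr : z ∈ resolventSet ℂ J.H) :
    J.m z * J.charFun μ z = -1 := by
  obtain ⟨q, hq, hq0⟩ := h.exists_tailOp_eq hz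
  have hT := ContinuousLinearMap.isUnit_iff_bijective.1 (h.isUnit_tailOp_sub hz)
  have hu := H_resolventVec hzr
  set u := J.resolventVec z with hudef
  have h1 : leftShift u = -(J.b 0 * u 0) • q := by
    apply hT.1
    have h2 := J.leftShift_H u
    rw [hu, map_add, map_smul] at h2
    have h3 : leftShift e0 = 0 := by
      rw [SeqSpace.ext_iff]
      intro k
      simp [e0_succ]
    rw [h3, add_zero] at h2
    simp only [sub_apply, smul_apply, one_apply_eq_self, h2, map_smul, hq]
    module
  have h2 := congrArg (fun y : SeqSpace => y 0) h1
  simp only [lp.coeFn_smul, Pi.smul_apply, leftShift_apply, zero_add, smul_eq_mul, hq0] at h2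
  have h3 := resolventVec_zero hzr
  rw [m_eq_neg_resolventVec, charFun]
  push_cast
  rw [← hudef] at h3 ⊢
  linear_combination h3 - J.b 0 * h2

end JacobiData

/-! ### The zeros of `a_0 - z + b_0² S(z)`. -/

namespace JacobiData

variable {J : JacobiData} {μ : Measure ℝ} {t₃ t₄ : ℝ}

theorem HasStieltjesForm.lt (h : J.HasStieltjesForm μ t₃ t₄) : t₃ < t₄ := by
  by_contra hle
  refine h.2.1.2.2 {t₃} (measure_mono_null ?_ h.measure_compl)
  refine Set.compl_subset_compl.2 fun x hx => ?_
  have : x = t₃ := le_antisymm (hx.2.trans (not_lt.1 hle)) hx.1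
  simp [this]

theorem HasStieltjesForm.continuousAt_charFun (h : J.HasStieltjesForm μ t₃ t₄) {z : ℂ}
    (hz : z ∉ ((↑) : ℝ → ℂ) '' Set.Icc t₃ t₄) : ContinuousAt (J.charFun μ) z := by
  have := h.1
  exact (continuousAt_const.sub continuousAt_id).add
    (continuousAt_const.mul (continuousAt_stieltjes h.measure_compl hz))

/-- The pole of `m` is a zero of `a_0 - z + b_0² S(z)`. -/
theorem HasStieltjesForm.charFun_pole (h : J.HasStieltjesForm μ t₃ t₄) {lam : ℂ}
    (hlam : 0 < lam.im) (hpole : J.HasPoleForm lam) : J.charFun μ lam = 0 := by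
  obtain ⟨d, t₁, t₂, σ, hσ, hm⟩ := hpole
  have := hσ.1
  by_contra hF
  have hlam' := notMem_ofReal_Icc (s := t₃) (t := t₄) hlam.ne'
  have hlam'' := notMem_ofReal_Icc (s := t₁) (t := t₂) hlam.ne'
  have hFc := h.continuousAt_charFun hlam'
  have hNc : ContinuousAt (fun z : ℂ => z + d + stieltjes σ z) lam :=
    (continuousAt_id.add continuousAt_const).add (continuousAt_stieltjes hσ.2.1 hlam'')
  -- If `charFun` is nonzero at `lam`, nearby points are in the resolvent set, and `m F = -1`
  -- becomes an identity without denominators. Its limit at `lam` says that the numerator `lam + d +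
  -- S_σ(lam)` vanishes, but its imaginary part is at least `Im lam > 0`.
  have hev : ∀ᶠ z in nhdsWithin lam {lam}ᶜ, (z + d + stieltjes σ z) * J.charFun μ z =
      -((z - lam) * (z - (starRingEnd ℂ) lam)) := by
    have him : ∀ᶠ z : ℂ in nhds lam, 0 < z.im :=
      Complex.continuous_im.continuousAt.eventually (lt_mem_nhds hlam)
    filter_upwards [nhdsWithin_le_nhds him, nhdsWithin_le_nhds (hFc.eventually_ne hF),
      self_mem_nhdsWithin] with z hz hFz hne
    have hz' := notMem_ofReal_Icc (s := t₃) (t := t₄) hz.ne'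
    have hzr := h.mem_resolventSet hz' hFz
    have h1 := h.m_mul_charFun hz' hzr
    have h2 := hm z hz hzr hne
    have h3 : z - lam ≠ 0 := sub_ne_zero.2 hne
    have h4 : z - (starRingEnd ℂ) lam ≠ 0 := by
      intro h0
      have := congrArg Complex.im h0
      simp at this
      linarith
    rw [h2] at h1
    change 1 / ((z - lam) * (z - (starRingEnd ℂ) lam)) * (z + d + stieltjes σ z) *
      J.charFun μ z = -1 at h1
    field_simp at h1
    linear_combination h1
  have hl1 := ((hNc.mul hFc).tendsto.mono_left (nhdsWithin_le_nhds (s := {lam}ᶜ)))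
  have hl2 : Filter.Tendsto (fun z : ℂ => -((z - lam) * (z - (starRingEnd ℂ) lam)))
      (nhdsWithin lam {lam}ᶜ) (nhds (-((lam - lam) * (lam - (starRingEnd ℂ) lam)))) :=
    (Continuous.tendsto (by fun_prop) lam).mono_left nhdsWithin_le_nhds
  have heq := tendsto_nhds_unique (hl1.congr' hev) hl2
  simp only [sub_self, zero_mul, neg_zero] at heq
  have hN := (mul_eq_zero.1 heq).resolve_right hF
  have h5 := stieltjes_im_nonneg hσ.2.1 hlam
  have h6 := congrArg Complex.im hN
  simp at h6
  linarith

/-- As `charFun` vanishes at `lam`, dividing out `lam` and its conjugate leaves a positive multiple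
of the Stieltjes transform of the measure with density `1 / |x - lam|²`, which has no zero off the
interval. -/
theorem HasStieltjesForm.charFun_ne_zero (h : J.HasStieltjesForm μ t₃ t₄) {lam : ℂ}
    (hlam : 0 < lam.im) (hpole : J.HasPoleForm lam) {z : ℂ}
    (hz : z ∉ ((↑) : ℝ → ℂ) '' Set.Icc t₃ t₄) (h1 : z ≠ lam) (h2 : z ≠ (starRingEnd ℂ) lam) :
    J.charFun μ z ≠ 0 := by
  have := h.1
  have h0 := h.charFun_pole hlam hpole
  rw [charFun] at h0 ⊢
  rw [sub_add_mul_stieltjes_eq h.measure_compl hlam.ne' h0 hz]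
  have hpos : ∀ x : ℝ, 0 < Complex.normSq ((x : ℂ) - lam) := by
    intro x
    rw [Complex.normSq_pos, sub_ne_zero]
    rintro rfl
    simp at hlam
  refine mul_ne_zero (mul_ne_zero ?_ (mul_ne_zero (sub_ne_zero.2 h1) (sub_ne_zero.2 h2)))
    (integral_weight_mul_one_div_ne_zero (w := fun x => 1 / Complex.normSq ((x : ℂ) - lam))
      h.measure_compl hz ?_ fun x _ => one_div_pos.2 (hpos x))
  · exact_mod_cast (pow_pos (J.b_pos 0) 2).ne'
  · exact continuousOn_const.div
      (Complex.continuous_normSq.comp (by fun_prop)).continuousOn fun x _ => (hpos x).ne'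

end JacobiData

/-! ### Confocal ellipses. -/

section Ellipse

variable {t₃ t₄ R : ℝ}

theorem mem_ellipseRegion {z : ℂ} :
    z ∈ ellipseRegion t₃ t₄ R ↔ ‖z - t₃‖ + ‖z - t₄‖ ≤ 2 * semiMajor t₃ t₄ R := Iff.rfl

theorem mem_ellipseCurve {z : ℂ} :
    z ∈ ellipseCurve t₃ t₄ R ↔ ‖z - t₃‖ + ‖z - t₄‖ = 2 * semiMajor t₃ t₄ R := Iff.rfl

theorem sub_lt_two_mul_semiMajor (ht : t₃ < t₄) (hR : 1 < R) :
    t₄ - t₃ < 2 * semiMajor t₃ t₄ R := by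
  have hR0 : 0 < R := by linarith
  have h1 : 2 < R + R⁻¹ := by
    have : 0 < (R - 1) ^ 2 / R := by have : 0 < R - 1 := by linarith
                                     positivity
    have h2 : (R - 1) ^ 2 / R = R + R⁻¹ - 2 := by field_simp; ring
    linarith
  unfold semiMajor
  nlinarith

theorem norm_ofReal_sub_add_norm_ofReal_sub {x : ℝ} (hx : x ∈ Set.Icc t₃ t₄) :
    ‖(x : ℂ) - t₃‖ + ‖(x : ℂ) - t₄‖ = t₄ - t₃ := by
  rw [← Complex.ofReal_sub, ← Complex.ofReal_sub, Complex.norm_real, Complex.norm_real,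
    Real.norm_eq_abs, Real.norm_eq_abs, abs_of_nonneg (by linarith [hx.1]),
    abs_of_nonpos (by linarith [hx.2])]
  ring

theorem ofReal_mem_ellipseRegion (ht : t₃ < t₄) (hR : 1 < R) {x : ℝ} (hx : x ∈ Set.Icc t₃ t₄) :
    (x : ℂ) ∈ ellipseRegion t₃ t₄ R := by
  have := norm_ofReal_sub_add_norm_ofReal_sub hx
  have h2 := sub_lt_two_mul_semiMajor ht hR
  rw [mem_ellipseRegion]
  linarith

theorem notMem_Icc_of_mem_ellipseCurve (ht : t₃ < t₄) (hR : 1 < R) {z : ℂ}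
    (hz : z ∈ ellipseCurve t₃ t₄ R) : z ∉ ((↑) : ℝ → ℂ) '' Set.Icc t₃ t₄ := by
  rintro ⟨x, hx, rfl⟩
  have := norm_ofReal_sub_add_norm_ofReal_sub hx
  have h2 := sub_lt_two_mul_semiMajor ht hR
  rw [mem_ellipseCurve] at hz
  linarith

theorem norm_conj_sub_ofReal (z : ℂ) (x : ℝ) : ‖(starRingEnd ℂ) z - x‖ = ‖z - x‖ := by
  rw [← Complex.norm_conj (z - x)]
  simp

theorem conj_mem_ellipseRegion {z : ℂ} :
    (starRingEnd ℂ) z ∈ ellipseRegion t₃ t₄ R ↔ z ∈ ellipseRegion t₃ t₄ R := by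
  simp only [ellipseRegion, Set.mem_ofPred_eq, norm_conj_sub_ofReal]

theorem ellipseCurve_subset_ellipseRegion : ellipseCurve t₃ t₄ R ⊆ ellipseRegion t₃ t₄ R :=
  fun _ h => le_of_eq h

theorem isCompact_ellipseCurve : IsCompact (ellipseCurve t₃ t₄ R) := by
  refine Metric.isCompact_of_isClosed_isBounded (isClosed_eq (by fun_prop) continuous_const) ?_
  refine (Metric.isBounded_closedBall (x := (t₃ : ℂ)) (r := 2 * semiMajor t₃ t₄ R)).subset ?_
  intro z hz
  rw [Metric.mem_closedBall, dist_eq_norm]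
  rw [mem_ellipseCurve] at hz
  linarith [norm_nonneg (z - t₄)]

theorem ellipseCurve_nonempty (ht : t₃ < t₄) (hR : 1 < R) : (ellipseCurve t₃ t₄ R).Nonempty := by
  have h := sub_lt_two_mul_semiMajor ht hR
  refine ⟨(((t₃ + t₄) / 2 + semiMajor t₃ t₄ R : ℝ) : ℂ), ?_⟩
  rw [mem_ellipseCurve]
  rw [← Complex.ofReal_sub, ← Complex.ofReal_sub, Complex.norm_real, Complex.norm_real,
    Real.norm_eq_abs, Real.norm_eq_abs, abs_of_nonneg (by linarith), abs_of_nonneg (by linarith)]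
  ring

theorem one_lt_recipEccentricity (ht : t₃ < t₄) {lam : ℂ} (hlam : 0 < lam.im) :
    1 < recipEccentricity t₃ t₄ lam := by
  rw [recipEccentricity, one_lt_div (by linarith)]
  have h1 : lam.re - t₃ < ‖lam - t₃‖ := by
    refine lt_of_le_of_lt (le_abs_self _) ?_
    have := (Complex.abs_re_lt_norm (z := lam - t₃)).2 (by simpa using hlam.ne')
    simpa using this
  have h2 : t₄ - lam.re < ‖lam - t₄‖ := by
    refine lt_of_le_of_lt (le_abs_self _) ?_
    rw [abs_sub_comm]
    have := (Complex.abs_re_lt_norm (z := lam - t₄)).2 (by simpa using hlam.ne')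
    simpa using this
  linarith

theorem one_lt_ellipseParam {g ε : ℝ} (hg : 1 < g) (hε : ε ∈ Set.Ioo (0 : ℝ) 1) :
    1 < ellipseParam g ε := by
  have : 0 ≤ ε * √(g ^ 2 - 1) := mul_nonneg hε.1.le (Real.sqrt_nonneg _)
  unfold ellipseParam
  linarith

/-- Membership would mean `R + R⁻¹ ≥ 2g`, that is, `(R - g)² ≥ g² - 1`; but `R - g = ε √(g² - 1)`
with `0 < ε < 1`. -/
theorem lam_notMem_ellipseRegion (ht : t₃ < t₄) {lam : ℂ} (hlam : 0 < lam.im) {ε : ℝ}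
    (hε : ε ∈ Set.Ioo (0 : ℝ) 1) :
    lam ∉ ellipseRegion t₃ t₄ (ellipseParam (recipEccentricity t₃ t₄ lam) ε) := by
  have hg := one_lt_recipEccentricity ht hlam
  have hR := one_lt_ellipseParam hg hε
  set g := recipEccentricity t₃ t₄ lam with hgdef
  set R := ellipseParam g ε with hRdef
  have hsum : ‖lam - t₄‖ + ‖lam - t₃‖ = g * (t₄ - t₃) := by
    rw [hgdef, recipEccentricity, div_mul_cancel₀]
    linarith
  intro hmem
  rw [mem_ellipseRegion] at hmem
  have hs : √(g ^ 2 - 1) ^ 2 = g ^ 2 - 1 := Real.sq_sqrt (by nlinarith)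
  have h1 : (R - g) ^ 2 < g ^ 2 - 1 := by
    have : R - g = ε * √(g ^ 2 - 1) := by rw [hRdef, ellipseParam]; ring
    rw [this, mul_pow, hs]
    have h3 : ε ^ 2 < 1 := by nlinarith [hε.1, hε.2]
    have h4 : 0 < g ^ 2 - 1 := by nlinarith
    nlinarith
  have h2 : R + R⁻¹ < 2 * g := by
    have : R + R⁻¹ - 2 * g = ((R - g) ^ 2 - (g ^ 2 - 1)) / R := by
      field_simp; ring
    have h5 : ((R - g) ^ 2 - (g ^ 2 - 1)) / R < 0 :=
      div_neg_of_neg_of_pos (by linarith) (by linarith)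
    linarith
  unfold semiMajor at hmem
  nlinarith

end Ellipse

/-- The maximum of `|m|` on the ellipse exists and controls `a_0 - z + b_0² S(z)` from below. -/
theorem JacobiData.HasStieltjesForm.exists_isGreatest {J : JacobiData} {μ : Measure ℝ}
    {t₃ t₄ : ℝ} (h : J.HasStieltjesForm μ t₃ t₄) {lam : ℂ}
    (hlam : 0 < lam.im) (hpole : J.HasPoleForm lam) {R : ℝ} (hR : 1 < R)
    (hlR : lam ∉ ellipseRegion t₃ t₄ R) :
    ∃ M : ℝ, IsGreatest ((fun z : ℂ => ‖J.m z‖) '' ellipseCurve t₃ t₄ R) M ∧ 0 < M ∧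
      ∀ z ∈ ellipseCurve t₃ t₄ R, 1 ≤ M * ‖J.charFun μ z‖ := by
  have hmF : ∀ z ∈ ellipseCurve t₃ t₄ R, z ∉ ((↑) : ℝ → ℂ) '' Set.Icc t₃ t₄ ∧
      J.charFun μ z ≠ 0 ∧ J.m z * J.charFun μ z = -1 := by
    intro z hz
    have hz' := notMem_Icc_of_mem_ellipseCurve h.lt hR hz
    have hzR := ellipseCurve_subset_ellipseRegion hz
    have hF : J.charFun μ z ≠ 0 := by
      refine h.charFun_ne_zero hlam hpole hz' ?_ ?_
      · rintro rfl; exact hlR hzR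
      · rintro rfl; exact hlR (conj_mem_ellipseRegion.1 hzR)
    exact ⟨hz', hF, h.m_mul_charFun hz' (h.mem_resolventSet hz' hF)⟩
  -- Continuity of `m` on the curve is read off from `m = -1 / F`, avoiding the continuity of the
  -- resolvent.
  have hcont : ContinuousOn (fun z : ℂ => ‖J.m z‖) (ellipseCurve t₃ t₄ R) := by
    have h1 : ContinuousOn (fun z : ℂ => ‖-1 / J.charFun μ z‖) (ellipseCurve t₃ t₄ R) :=
      (ContinuousOn.div continuousOn_const
        (fun z hz => (h.continuousAt_charFun (hmF z hz).1).continuousWithinAt)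
        fun z hz => (hmF z hz).2.1).norm
    refine h1.congr fun z hz => ?_
    simp only
    rw [eq_div_of_mul_eq (hmF z hz).2.1 (hmF z hz).2.2]
  obtain ⟨z₀, hz₀, hmax⟩ := isCompact_ellipseCurve.exists_isMaxOn
    (ellipseCurve_nonempty h.lt hR) hcont
  refine ⟨‖J.m z₀‖, ⟨⟨z₀, hz₀, rfl⟩, ?_⟩, ?_, ?_⟩
  · rintro _ ⟨z, hz, rfl⟩
    exact hmax hz
  · rw [norm_pos_iff]
    intro h0
    have := (hmF z₀ hz₀).2.2
    simp [h0] at this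
  · intro z hz
    have h1 : ‖J.m z‖ * ‖J.charFun μ z‖ = 1 := by
      rw [← norm_mul, (hmF z hz).2.2]; simp
    rw [← h1]
    exact mul_le_mul_of_nonneg_right (hmax hz) (norm_nonneg _)

/-! ### Matrices selfadjoint for a form with one negative square. -/

section Pontryagin

open Matrix

variable {n : ℕ}

theorem re_fundSymm_form (f : Fin (n + 1) → ℂ) :
    (star f ⬝ᵥ (fundSymm n *ᵥ f)).re =
      -Complex.normSq (f 0) + ∑ i : Fin n, Complex.normSq (f i.succ) := by
  rw [dotProduct, Fin.sum_univ_succ, Complex.add_re, Complex.re_sum]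
  simp only [fundSymm, mulVec_diagonal, Fin.succ_ne_zero, if_true, if_false]
  congr 1
  · simp [Complex.normSq_apply]
  · refine Finset.sum_congr rfl fun i _ => ?_
    simp [Complex.normSq_apply]

/-- The form is positive definite on vectors without first component. Eigenvectors of nonpositive
type therefore have a nonzero first component. -/
theorem eq_zero_of_fundSymm_form_nonpos {f : Fin (n + 1) → ℂ} (h0 : f 0 = 0)
    (h : (star f ⬝ᵥ (fundSymm n *ᵥ f)).re ≤ 0) : f = 0 := by
  rw [re_fundSymm_form, h0, map_zero, neg_zero, zero_add] at h
  have h1 := (Finset.sum_eq_zero_iff_of_nonneg fun i _ => Complex.normSq_nonneg _).1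
    (le_antisymm h (Finset.sum_nonneg fun i _ => Complex.normSq_nonneg _))
  funext i
  refine Fin.cases h0 (fun j => ?_) i
  simpa using h1 j (Finset.mem_univ _)

variable {A : Matrix (Fin (n + 1)) (Fin (n + 1)) ℂ}

theorem fundSymm_form_mulVec (hA : Aᴴ * fundSymm n = fundSymm n * A) (f g : Fin (n + 1) → ℂ) :
    star (A *ᵥ f) ⬝ᵥ (fundSymm n *ᵥ g) = star f ⬝ᵥ (fundSymm n *ᵥ (A *ᵥ g)) := by
  rw [star_mulVec, ← dotProduct_mulVec, mulVec_mulVec, mulVec_mulVec, hA]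

/-- Eigenvectors for eigenvalues that are not conjugate to each other are orthogonal with respect
to the indefinite inner product. -/
theorem fundSymm_form_eigenvectors (hA : Aᴴ * fundSymm n = fundSymm n * A)
    {f g : Fin (n + 1) → ℂ} {v w : ℂ} (hf : A *ᵥ f = v • f) (hg : A *ᵥ g = w • g)
    (hvw : w ≠ (starRingEnd ℂ) v) : star f ⬝ᵥ (fundSymm n *ᵥ g) = 0 := by
  have h := fundSymm_form_mulVec hA f g
  rw [hf, hg, star_smul, smul_dotProduct, mulVec_smul, dotProduct_smul, smul_eq_mul,
    smul_eq_mul] at h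
  have h1 : (w - (starRingEnd ℂ) v) * (star f ⬝ᵥ (fundSymm n *ᵥ g)) = 0 := by
    rw [sub_mul, ← h]
    simp
  exact (mul_eq_zero.1 h1).resolve_left (sub_ne_zero.2 hvw)

/-- Distinct points of the closed upper half-plane are not conjugate, so the eigenvectors are
orthogonal for the form and span a nonpositive subspace. The combination that kills the first
component is then zero, which makes the eigenvectors proportional. -/
theorem eigenvalue_of_nonpos_type_unique (hA : Aᴴ * fundSymm n = fundSymm n * A) {v w : ℂ}
    (hv : IsEigenvalueOfNonposType A v) (hw : IsEigenvalueOfNonposType A w) : v = w := by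
  obtain ⟨hv0, f, hf0, hf, hff⟩ := hv
  obtain ⟨hw0, g, hg0, hg, hgg⟩ := hw
  by_contra hne
  have hconj : ∀ {v w : ℂ}, 0 ≤ v.im → 0 ≤ w.im → v ≠ w → w ≠ (starRingEnd ℂ) v := by
    intro v w hv hw hne heq
    apply hne
    have h1 := congrArg Complex.im heq
    have h2 := congrArg Complex.re heq
    simp at h1 h2
    exact Complex.ext h2.symm (by linarith)
  have hfg := fundSymm_form_eigenvectors hA hf hg (hconj hv0 hw0 hne)
  have hgf := fundSymm_form_eigenvectors hA hg hf (hconj hw0 hv0 (Ne.symm hne))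
  have hf00 : f 0 ≠ 0 := fun h => hf0 (eq_zero_of_fundSymm_form_nonpos h hff)
  have hg00 : g 0 ≠ 0 := fun h => hg0 (eq_zero_of_fundSymm_form_nonpos h hgg)
  set k : Fin (n + 1) → ℂ := g 0 • f - f 0 • g with hk
  have hk0 : k = 0 := by
    refine eq_zero_of_fundSymm_form_nonpos (by simp [hk]; ring) ?_
    have : star k ⬝ᵥ (fundSymm n *ᵥ k) =
        (Complex.normSq (g 0) : ℂ) * (star f ⬝ᵥ (fundSymm n *ᵥ f)) +
        (Complex.normSq (f 0) : ℂ) * (star g ⬝ᵥ (fundSymm n *ᵥ g)) := by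
      rw [hk, star_sub, star_smul, star_smul, mulVec_sub, mulVec_smul, mulVec_smul,
        sub_dotProduct, dotProduct_sub, dotProduct_sub, smul_dotProduct, smul_dotProduct,
        smul_dotProduct, smul_dotProduct, dotProduct_smul, dotProduct_smul, dotProduct_smul,
        dotProduct_smul, hfg, hgf, Complex.normSq_eq_conj_mul_self,
        Complex.normSq_eq_conj_mul_self]
      simp only [smul_eq_mul, Complex.star_def]
      ring
    rw [this, Complex.add_re, Complex.re_ofReal_mul, Complex.re_ofReal_mul]
    have h1 := mul_nonpos_of_nonneg_of_nonpos (Complex.normSq_nonneg (g 0)) hff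
    have h2 := mul_nonpos_of_nonneg_of_nonpos (Complex.normSq_nonneg (f 0)) hgg
    linarith
  have h1 : g 0 • f = f 0 • g := sub_eq_zero.1 hk0
  have h2 := congrArg (fun x => A *ᵥ x) h1
  simp only [mulVec_smul, hf, hg] at h2
  have h3 := congrFun h2 0
  simp only [Pi.smul_apply, smul_eq_mul] at h3
  apply hne
  refine mul_left_cancel₀ (mul_ne_zero hf00 hg00) ?_
  linear_combination h3

/-- Otherwise every eigenvector is positive. Then all eigenvalues are real, there are no Jordan
chains, and eigenspaces are mutually orthogonal, so the form would be nonnegative everywhere,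
although its value at the first basis vector is `-1`. -/
theorem exists_eigenvalue_of_nonpos_type (hA : Aᴴ * fundSymm n = fundSymm n * A)
    (hreal : ∀ i j, (starRingEnd ℂ) (A i j) = A i j) : ∃ w, IsEigenvalueOfNonposType A w := by
  by_contra! hno
  have hpos : ∀ (w : ℂ) (f : Fin (n + 1) → ℂ), f ≠ 0 → A *ᵥ f = w • f →
      0 < (star f ⬝ᵥ (fundSymm n *ᵥ f)).re := by
    intro w f hf0 hf
    by_contra! hle
    rcases le_total 0 w.im with h | h
    · exact hno w ⟨h, f, hf0, hf, hle⟩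
    -- The matrix is real, so an eigenvector for an eigenvalue in the lower half-plane can be
    -- conjugated.
    · refine hno ((starRingEnd ℂ) w) ⟨by simpa using h, star f, by simpa using hf0, ?_, ?_⟩
      · have h1 := congrArg star hf
        rw [star_smul] at h1
        rw [← Complex.star_def, ← h1]
        funext i
        simp [mulVec, dotProduct, hreal]
      · rw [re_fundSymm_form] at hle ⊢
        simpa using hle
  have him : ∀ (w : ℂ) (f : Fin (n + 1) → ℂ), f ≠ 0 → A *ᵥ f = w • f →
      w = (starRingEnd ℂ) w := by
    intro w f hf0 hf
    by_contra hne
    have := hpos w f hf0 hf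
    rw [fundSymm_form_eigenvectors hA hf hf hne] at this
    simp at this
  set T : Module.End ℂ (Fin (n + 1) → ℂ) := A.mulVecLin with hT
  have hsub : ∀ (w : ℂ) (f : Fin (n + 1) → ℂ), (T - algebraMap ℂ _ w) f = A *ᵥ f - w • f := by
    intro w f
    simp [hT]
  -- A Jordan chain of length two would give an eigenvector `g = (A - w) f` with `[g, g] = [f, (A -
  -- w) g] = 0`, contrary to positivity.
  have hker : ∀ (w : ℂ) (f : Fin (n + 1) → ℂ),
      (T - algebraMap ℂ _ w) ((T - algebraMap ℂ _ w) f) = 0 → (T - algebraMap ℂ _ w) f = 0 := by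
    intro w f hf
    by_contra hne
    set g := (T - algebraMap ℂ _ w) f with hg
    have hgw : A *ᵥ g = w • g := by
      rw [hsub, sub_eq_zero] at hf
      exact hf
    have hp := hpos w g hne hgw
    have hw := him w g hne hgw
    have h0 : star g ⬝ᵥ (fundSymm n *ᵥ g) = 0 := by
      have hg' : star g = star (A *ᵥ f - w • f) := by rw [hg, hsub]
      rw [hg', star_sub, sub_dotProduct, fundSymm_form_mulVec hA, hgw, star_smul,
        smul_dotProduct, mulVec_smul, dotProduct_smul, Complex.star_def, ← hw, sub_self]
    rw [h0] at hp
    simp at hp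
  have hpow : ∀ (w : ℂ) (k : ℕ) (f : Fin (n + 1) → ℂ),
      ((T - algebraMap ℂ _ w) ^ k) f = 0 → (T - algebraMap ℂ _ w) f = 0 := by
    intro w k
    induction k with
    | zero => intro f hf; simp at hf; simp [hf]
    | succ k ih =>
      intro f hf
      rw [pow_succ, Module.End.mul_apply] at hf
      exact hker w f (ih _ hf)
  have htop := Module.End.iSup_maxGenEigenspace_eq_top T
  have hmem : (Pi.single 0 1 : Fin (n + 1) → ℂ) ∈ ⨆ w, T.maxGenEigenspace w := by
    rw [htop]; trivial
  rw [Submodule.mem_iSup_iff_exists_finsupp] at hmem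
  obtain ⟨x, hx, hsum⟩ := hmem
  have hxe : ∀ w, A *ᵥ (x w) = w • x w := by
    intro w
    obtain ⟨k, hk⟩ := (Module.End.mem_maxGenEigenspace T w (x w)).1 (hx w)
    rw [← Algebra.algebraMap_eq_smul_one] at hk
    have := hpow w k _ hk
    rw [hsub, sub_eq_zero] at this
    exact this
  rw [Finsupp.sum] at hsum
  have hform : star (Pi.single 0 1 : Fin (n + 1) → ℂ) ⬝ᵥ (fundSymm n *ᵥ Pi.single 0 1) =
      ∑ w ∈ x.support, star (x w) ⬝ᵥ (fundSymm n *ᵥ x w) := by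
    rw [← hsum, star_sum, sum_dotProduct]
    refine Finset.sum_congr rfl fun w hw => ?_
    rw [mulVec_sum, dotProduct_sum]
    refine Finset.sum_eq_single_of_mem w hw fun v _ hv => ?_
    refine fundSymm_form_eigenvectors hA (hxe w) (hxe v) ?_
    rw [← him w (x w) (Finsupp.mem_support_iff.1 hw) (hxe w)]
    exact hv
  have hre := congrArg Complex.re hform
  rw [re_fundSymm_form, Complex.re_sum] at hre
  have h1 : 0 ≤ ∑ w ∈ x.support, (star (x w) ⬝ᵥ (fundSymm n *ᵥ x w)).re :=
    Finset.sum_nonneg fun w hw =>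
      (hpos w (x w) (Finsupp.mem_support_iff.1 hw) (hxe w)).le
  rw [← hre] at h1
  simp at h1
  linarith

end Pontryagin

/-! ### The eigenvalue of nonpositive type of the truncation. -/

namespace JacobiData

open Matrix

variable (J : JacobiData)

theorem truncation_conjTranspose_mul (n : ℕ) :
    (J.truncation n)ᴴ * fundSymm n = fundSymm n * J.truncation n := by
  ext i j
  rw [fundSymm, mul_diagonal, diagonal_mul, conjTranspose_apply]
  simp only [truncation, of_apply, Complex.star_def, Complex.conj_ofReal, entry, upper]
  have hi : i = 0 ↔ (i : ℕ) = 0 := by rw [Fin.ext_iff]; simp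
  have hj : j = 0 ↔ (j : ℕ) = 0 := by rw [Fin.ext_iff]; simp
  simp only [hi, hj]
  generalize (i : ℕ) = i
  generalize (j : ℕ) = j
  split_ifs <;> first | omega | (subst_vars; simp)

theorem existsUnique_eigenvalue_truncation (n : ℕ) :
    ∃ l : ℂ, ∀ w : ℂ, IsEigenvalueOfNonposType (J.truncation n) w ↔ w = l := by
  have hA := J.truncation_conjTranspose_mul n
  obtain ⟨l, hl⟩ := exists_eigenvalue_of_nonpos_type hA (fun i j => by simp [truncation])
  refine ⟨l, fun w => ⟨fun hw => eigenvalue_of_nonpos_type_unique hA hw hl, ?_⟩⟩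
  rintro rfl
  exact hl

end JacobiData

/-! ### Gauss quadrature from the symmetric truncation. -/

namespace JacobiData

open Matrix Polynomial

variable (J : JacobiData)

/-- The symmetric Jacobi matrix of size `N` with diagonal `a_1, a_2, …` and off-diagonal
`b_1, b_2, …`. -/
noncomputable def symmTruncation (N : ℕ) : Matrix (Fin N) (Fin N) ℂ :=
  of fun i j => (J.symmEntry i j : ℂ)

theorem isHermitian_symmTruncation (N : ℕ) : (J.symmTruncation N).IsHermitian := by
  ext i j
  simp [symmTruncation, J.symmEntry_comm i j]

theorem sum_symmEntry_zero {N : ℕ} (hN : 0 < N) (x : ℕ → ℂ) (hx : ∀ k, N ≤ k → x k = 0) :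
    ∑ l ∈ Finset.range N, (J.symmEntry 0 l : ℂ) * x l = J.a 1 * x 0 + J.b 1 * x 1 := by
  -- Two extra zero terms ensure that both band entries of the row are in range, even when `N = 1`.
  have h1 : ∑ l ∈ Finset.range N, (J.symmEntry 0 l : ℂ) * x l =
      ∑ l ∈ Finset.range (N + 2), (J.symmEntry 0 l : ℂ) * x l := by
    refine Finset.sum_subset (Finset.range_subset_range.2 (by omega)) fun l _ hl => ?_
    rw [hx l (by simpa using hl), mul_zero]
  have h2 : ∑ l ∈ ({0, 1} : Finset ℕ), (J.symmEntry 0 l : ℂ) * x l =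
      ∑ l ∈ Finset.range (N + 2), (J.symmEntry 0 l : ℂ) * x l := by
    refine Finset.sum_subset (fun l hl => ?_) fun l _ hl => ?_
    · simp only [Finset.mem_insert, Finset.mem_singleton] at hl
      simp only [Finset.mem_range]
      omega
    · simp only [Finset.mem_insert, Finset.mem_singleton, not_or] at hl
      simp only [symmEntry]
      rw [if_neg (by omega), if_neg (by omega), if_neg (by omega)]
      simp
  rw [h1, ← h2, Finset.sum_pair (by omega)]
  simp [symmEntry]

theorem sum_symmEntry_succ {N k : ℕ} (hN : k + 1 < N) (x : ℕ → ℂ) (hx : ∀ k, N ≤ k → x k = 0) :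
    ∑ l ∈ Finset.range N, (J.symmEntry (k + 1) l : ℂ) * x l =
      J.b (k + 1) * x k + J.a (k + 2) * x (k + 1) + J.b (k + 2) * x (k + 2) := by
  have h1 : ∑ l ∈ Finset.range N, (J.symmEntry (k + 1) l : ℂ) * x l =
      ∑ l ∈ Finset.range (N + 2), (J.symmEntry (k + 1) l : ℂ) * x l := by
    refine Finset.sum_subset (Finset.range_subset_range.2 (by omega)) fun l _ hl => ?_
    rw [hx l (by simpa using hl), mul_zero]
  have h2 : ∑ l ∈ ({k, k + 1, k + 2} : Finset ℕ), (J.symmEntry (k + 1) l : ℂ) * x l =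
      ∑ l ∈ Finset.range (N + 2), (J.symmEntry (k + 1) l : ℂ) * x l := by
    refine Finset.sum_subset (fun l hl => ?_) fun l _ hl => ?_
    · simp only [Finset.mem_insert, Finset.mem_singleton] at hl
      simp only [Finset.mem_range]
      omega
    · simp only [Finset.mem_insert, Finset.mem_singleton, not_or] at hl
      simp only [symmEntry]
      rw [if_neg (by omega), if_neg (by omega), if_neg (by omega)]
      simp
  rw [h1, ← h2, Finset.sum_insert (by simp), Finset.sum_pair (by omega)]
  have e1 : J.symmEntry (k + 1) k = J.b (k + 1) := by
    rw [symmEntry, if_neg (by omega), if_neg (by omega), if_pos rfl]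
  have e2 : J.symmEntry (k + 1) (k + 1) = J.a (k + 2) := by rw [symmEntry, if_pos rfl]
  have e3 : J.symmEntry (k + 1) (k + 2) = J.b (k + 2) := by
    rw [symmEntry, if_neg (by omega), if_pos rfl]
  rw [e1, e2, e3]
  ring

/-- The extension of a vector by zero. -/
noncomputable def extendZero {N : ℕ} (v : Fin N → ℂ) (k : ℕ) : ℂ :=
  if h : k < N then v ⟨k, h⟩ else 0

theorem extendZero_coe {N : ℕ} (v : Fin N → ℂ) (k : Fin N) : extendZero v k = v k := by
  simp [extendZero]

theorem extendZero_of_le {N : ℕ} (v : Fin N → ℂ) {k : ℕ} (hk : N ≤ k) : extendZero v k = 0 := by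
  simp [extendZero, hk]

theorem symmTruncation_mulVec {N : ℕ} (v : Fin N → ℂ) (i : Fin N) :
    (J.symmTruncation N *ᵥ v) i =
      ∑ l ∈ Finset.range N, (J.symmEntry i l : ℂ) * extendZero v l := by
  rw [Finset.sum_range, mulVec, dotProduct]
  refine Finset.sum_congr rfl fun l _ => ?_
  simp [symmTruncation, extendZero_coe]

/-- The components of an eigenvector of the symmetric Jacobi matrix are given by the values of the
polynomials `P_k` at the eigenvalue. -/
theorem eigenvector_eq_orthPoly {m : ℕ} {v : Fin (m + 1) → ℂ} {t : ℝ}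
    (hv : J.symmTruncation (m + 1) *ᵥ v = (t : ℂ) • v) (k : ℕ) (hk : k < m + 1) :
    extendZero v k = ((J.orthPoly k).eval t : ℝ) * v 0 := by
  have hrow : ∀ i (hi : i < m + 1), ∑ l ∈ Finset.range (m + 1), (J.symmEntry i l : ℂ) *
      extendZero v l = t * extendZero v i := by
    intro i hi
    have h1 := congrFun hv ⟨i, hi⟩
    rw [symmTruncation_mulVec] at h1
    refine h1.trans ?_
    rw [Pi.smul_apply, smul_eq_mul, ← extendZero_coe v ⟨i, hi⟩]
  have hz := fun k (hk : m + 1 ≤ k) => extendZero_of_le v hk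
  have hb : ∀ k, (J.b k : ℂ) ≠ 0 := fun k => by exact_mod_cast (J.b_pos k).ne'
  have h0 : extendZero v 0 = v 0 := extendZero_coe v 0
  induction k using Nat.strong_induction_on with
  | _ k ih =>
    match k, ih with
    | 0, _ => simp [h0]
    | 1, _ =>
      have h1 := hrow 0 (by omega)
      rw [J.sum_symmEntry_zero (by omega) _ hz, h0] at h1
      have h2 := congrArg (fun p : ℝ[X] => p.eval t) J.X_mul_orthPoly_zero
      simp only [eval_mul, eval_add, eval_X, eval_C, orthPoly_zero, mul_one] at h2
      have h3 : (t : ℂ) = J.b 1 * ((J.orthPoly 1).eval t : ℝ) + J.a 1 := by exact_mod_cast h2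
      refine mul_left_cancel₀ (hb 1) ?_
      linear_combination h1 + v 0 * h3
    | k + 2, ih =>
      have h1 := hrow (k + 1) (by omega)
      rw [J.sum_symmEntry_succ (by omega) _ hz, ih k (by omega) (by omega),
        ih (k + 1) (by omega) (by omega)] at h1
      have h2 := congrArg (fun p : ℝ[X] => p.eval t) (J.X_mul_orthPoly_succ k)
      simp only [eval_mul, eval_add, eval_X, eval_C] at h2
      have h3 : (t : ℂ) * ((J.orthPoly (k + 1)).eval t : ℝ) =
          J.b (k + 2) * ((J.orthPoly (k + 2)).eval t : ℝ) +
          J.a (k + 2) * ((J.orthPoly (k + 1)).eval t : ℝ) +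
          J.b (k + 1) * ((J.orthPoly k).eval t : ℝ) := by exact_mod_cast h2
      refine mul_left_cancel₀ (hb (k + 2)) ?_
      linear_combination h1 + v 0 * h3

theorem truncation_mulVec_zero {m : ℕ} (f : Fin (m + 2) → ℂ) :
    (J.truncation (m + 1) *ᵥ f) 0 = J.a 0 * f 0 - J.b 0 * f 1 := by
  rw [mulVec, dotProduct, Fin.sum_univ_succ, Fin.sum_univ_succ, Finset.sum_eq_zero]
  · simp [truncation, entry, upper, sub_eq_add_neg]
  · intro i _
    simp [truncation, entry]

theorem truncation_mulVec_succ {N : ℕ} (f : Fin (N + 1) → ℂ) (i : Fin N) :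
    (J.truncation N *ᵥ f) i.succ =
      (J.symmTruncation N *ᵥ fun k => f k.succ) i + if (i : ℕ) = 0 then J.b 0 * f 0 else 0 := by
  rw [mulVec, dotProduct, Fin.sum_univ_succ, mulVec, dotProduct, add_comm]
  congr 1
  · refine Finset.sum_congr rfl fun k _ => ?_
    congr 1
    simp only [truncation, symmTruncation, of_apply, entry, symmEntry, upper, Fin.val_succ]
    simp
  · have he : J.entry (i + 1) 0 = if (i : ℕ) = 0 then J.b 0 else 0 := by
      simp [entry]
    change ((J.entry (i + 1) 0 : ℝ) : ℂ) * f 0 = _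
    rw [he]
    split_ifs <;> simp

variable {J} {μ : Measure ℝ} {t₃ t₄ : ℝ}

/-- The Gauss quadrature of `μ` with `n` nodes, and the description of the eigenvalue of nonpositive
type of `H_{[0,n]}` in terms of this quadrature. -/
theorem HasStieltjesForm.exists_quadrature (h : J.HasStieltjesForm μ t₃ t₄) (n : ℕ) :
    ∃ w t : Fin n → ℝ, (∀ j, 0 ≤ w j) ∧ (∀ j, t j ∈ Set.Icc t₃ t₄) ∧
      (∀ p : ℝ[X], p.natDegree < 2 * n - 1 → ∫ x, p.eval x ∂μ = ∑ j, w j * p.eval (t j)) ∧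
      ∀ l, IsEigenvalueOfNonposType (J.truncation n) l →
        (∀ j, (t j : ℂ) - l ≠ 0) ∧
        (J.a 0 : ℂ) - l + ((J.b 0 ^ 2 : ℝ) : ℂ) * ∑ j, (w j : ℂ) * (1 / ((t j : ℂ) - l)) = 0 ∧
        J.b 0 ^ 2 * ∑ j, w j * (1 / Complex.normSq ((t j : ℂ) - l)) ≤ 1 := by
  have := h.1
  rcases n with _ | m
  · refine ⟨0, 0, by simp, by simp, by simp, ?_⟩
    rintro l ⟨-, f, hf0, hf, -⟩
    refine ⟨by simp, ?_, by simp⟩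
    have h1 := congrFun hf 0
    have h2 : f 0 ≠ 0 := by
      intro h2
      apply hf0
      funext i
      have hi : i = 0 := Fin.ext (Nat.lt_one_iff.1 i.2)
      rw [hi, h2]
      rfl
    simp [mulVec, dotProduct, truncation, entry] at h1
    rcases h1 with h1 | h1
    · simp [h1]
    · exact absurd h1 h2
  set B := J.symmTruncation (m + 1) with hB
  have hH : B.IsHermitian := J.isHermitian_symmTruncation _
  set U : Matrix (Fin (m + 1)) (Fin (m + 1)) ℂ := (hH.eigenvectorUnitary).1 with hU
  have hUU : U * star U = 1 := Unitary.coe_mul_star_self _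
  have hUU' : star U * U = 1 := Unitary.coe_star_mul_self _
  set t := hH.eigenvalues with ht
  have hcol : ∀ j, B *ᵥ (fun i => U i j) = (t j : ℂ) • fun i => U i j := by
    intro j
    have h1 := hH.mulVec_eigenvectorBasis j
    have h2 : (fun i => U i j) = ⇑(hH.eigenvectorBasis j) := by
      funext i
      exact hH.eigenvectorUnitary_apply i j
    rw [h2, h1]
    rfl
  have hUP : ∀ j (k : Fin (m + 1)), U k j = ((J.orthPoly k).eval (t j) : ℝ) * U 0 j := by
    intro j k
    have := J.eigenvector_eq_orthPoly (hcol j) k k.2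
    rwa [extendZero_coe (fun i => U i j) k] at this
  -- The recurrence determines an eigenvector from its first component, so this component cannot
  -- vanish.
  have hne : ∀ j, U 0 j ≠ 0 := by
    intro j h0
    have h1 := congrFun (congrFun hUU' j) j
    rw [mul_apply, one_apply_eq] at h1
    refine zero_ne_one (α := ℂ) (h1 ▸ (Finset.sum_eq_zero fun k _ => ?_).symm)
    rw [hUP, h0, mul_zero, mul_zero]
  -- The Christoffel weights are the squared first components of the normalized eigenvectors;
  -- orthonormality of the rows of `U` then becomes discrete orthonormality of the `P_k`.
  set w : Fin (m + 1) → ℝ := fun j => Complex.normSq (U 0 j) with hw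
  have horth : ∀ a b : Fin (m + 1),
      ∑ j, w j * ((J.orthPoly a).eval (t j) * (J.orthPoly b).eval (t j)) =
        if (a : ℕ) = b then 1 else 0 := by
    intro a b
    have h1 := congrFun (congrFun hUU a) b
    rw [mul_apply, one_apply] at h1
    have h2 : ((∑ j, w j * ((J.orthPoly a).eval (t j) * (J.orthPoly b).eval (t j)) : ℝ) : ℂ) =
        ((if (a : ℕ) = b then 1 else 0 : ℝ) : ℂ) := by
      rw [Complex.ofReal_sum]
      have h3 : ((if (a : ℕ) = b then 1 else 0 : ℝ) : ℂ) = if a = b then 1 else 0 := by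
        simp only [Fin.ext_iff]
        split_ifs <;> simp
      rw [h3, ← h1]
      push_cast
      refine Finset.sum_congr rfl fun j _ => ?_
      rw [star_apply, hUP j a, hUP j b, hw, Complex.normSq_eq_conj_mul_self]
      simp only [Complex.star_def, map_mul, Complex.conj_ofReal]
      ring
    exact_mod_cast h2
  have hquad : ∀ p : ℝ[X], p.natDegree < 2 * (m + 1) - 1 →
      ∫ x, p.eval x ∂μ = ∑ j, w j * p.eval (t j) := by
    intro p hp
    -- Both `μ` and the quadrature make `P_0, …, P_m` orthonormal, so their difference annihilates
    -- all products of two of these.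
    let Φ : ℝ[X] →ₗ[ℝ] ℝ := momentFunctional h.measure_compl -
      ∑ j, w j • (Polynomial.leval (t j) : ℝ[X] →ₗ[ℝ] ℝ)
    have hΦ : ∀ q, Φ q = ∫ x, q.eval x ∂μ - ∑ j, w j * q.eval (t j) := by
      intro q
      simp [Φ, momentFunctional_apply, LinearMap.sum_apply]
    have h1 : Φ p = 0 := by
      refine functional_eq_zero_of_natDegree_lt (J := J) Φ (n := m + 1) ?_ hp
      intro j hj k hk
      rw [hΦ, ← momentFunctional_apply h.measure_compl, h.momentFunctional_orthPoly_mul]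
      have := horth ⟨j, hj⟩ ⟨k, hk⟩
      simp only [eval_mul]
      rw [this, sub_self]
    rw [hΦ] at h1
    linarith
  -- At an eigenvector the form of the truncation minus `t_j` is zero, whereas separation of `t_j`
  -- from `[t₃, t₄]` would keep it away from zero.
  have hnodes : ∀ j, t j ∈ Set.Icc t₃ t₄ := by
    intro j
    by_contra hnot
    have hz : ((t j : ℝ) : ℂ) ∉ ((↑) : ℝ → ℂ) '' Set.Icc t₃ t₄ := by
      rintro ⟨x, hx, hxt⟩
      exact hnot (Complex.ofReal_injective hxt ▸ hx)
    obtain ⟨γ, -, δ, hδ, hsep⟩ := exists_separating_functional hz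
    have h1 := h.le_re_quadraticForm hsep (m + 1) (extendZero fun i => U i j)
    have h2 : ∑ a ∈ Finset.range (m + 1), ∑ b ∈ Finset.range (m + 1),
        (starRingEnd ℂ) (extendZero (fun i => U i j) a) * extendZero (fun i => U i j) b *
          (J.symmEntry a b : ℝ) -
        (t j : ℂ) * (∑ k ∈ Finset.range (m + 1),
          Complex.normSq (extendZero (fun i => U i j) k) : ℝ) = 0 := by
      rw [Complex.ofReal_sum, Finset.mul_sum, ← Finset.sum_sub_distrib]
      refine Finset.sum_eq_zero fun a ha => ?_
      rw [Finset.mem_range] at ha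
      have h3 := congrFun (hcol j) ⟨a, ha⟩
      rw [hB, symmTruncation_mulVec, Pi.smul_apply, smul_eq_mul] at h3
      have h4 : extendZero (fun i => U i j) a = U ⟨a, ha⟩ j := extendZero_coe _ ⟨a, ha⟩
      rw [Complex.normSq_eq_conj_mul_self]
      have h5 : ∑ b ∈ Finset.range (m + 1), (starRingEnd ℂ) (extendZero (fun i => U i j) a) *
          extendZero (fun i => U i j) b * (J.symmEntry a b : ℝ) =
          (starRingEnd ℂ) (extendZero (fun i => U i j) a) *
            ∑ b ∈ Finset.range (m + 1), (J.symmEntry a b : ℂ) *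
              extendZero (fun i => U i j) b := by
        rw [Finset.mul_sum]
        exact Finset.sum_congr rfl fun b _ => by ring
      rw [h5, h3, h4]
      ring
    rw [h2, mul_zero, Complex.zero_re] at h1
    have h3 : 0 < ∑ k ∈ Finset.range (m + 1),
        Complex.normSq (extendZero (fun i => U i j) k) := by
      refine Finset.sum_pos' (fun _ _ => Complex.normSq_nonneg _) ⟨0, by simp, ?_⟩
      have h4 : extendZero (fun i => U i j) 0 = U 0 j := extendZero_coe _ 0
      rw [h4]
      exact Complex.normSq_pos.2 (hne j)
    nlinarith
  refine ⟨w, t, fun j => Complex.normSq_nonneg _, hnodes, hquad, ?_⟩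
  rintro l ⟨-, f, hf0, hf, hff⟩
  have hf00 : f 0 ≠ 0 := fun h => hf0 (eq_zero_of_fundSymm_form_nonpos h hff)
  set f' : Fin (m + 1) → ℂ := fun k => f k.succ with hf'
  set φ : Fin (m + 1) → ℂ := star U *ᵥ f' with hφ
  have hfφ : f' = U *ᵥ φ := by rw [hφ, mulVec_mulVec, hUU, one_mulVec]
  have hBf : B *ᵥ f' = l • f' - (J.b 0 * f 0) • Pi.single 0 1 := by
    funext i
    have h1 := congrFun hf i.succ
    rw [truncation_mulVec_succ] at h1
    have h2 : (if (i : ℕ) = 0 then (J.b 0 : ℂ) * f 0 else 0) =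
        ((J.b 0 * f 0) • (Pi.single 0 1 : Fin (m + 1) → ℂ)) i := by
      have : (i : ℕ) = 0 ↔ i = 0 := by rw [Fin.ext_iff]; simp
      simp [this, Pi.single_apply]
    rw [h2] at h1
    rw [Pi.sub_apply]
    exact eq_sub_of_add_eq h1
  -- Rows `1, …, n` of the eigenvalue equation in the eigenbasis of `B`, with `b_0 f_0 e_0` as
  -- source. As `f_0` and the `U 0 j` are nonzero, no node equals `l`.
  have hφj : ∀ j, ((t j : ℂ) - l) * φ j = -(J.b 0 * f 0) * (starRingEnd ℂ) (U 0 j) := by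
    intro j
    have h1 : (star U *ᵥ (B *ᵥ f')) j = t j * φ j := by
      have h2 : (star U *ᵥ (B *ᵥ f')) j = star (B *ᵥ fun i => U i j) ⬝ᵥ f' := by
        rw [star_mulVec, hH.eq, ← dotProduct_mulVec]
        rfl
      rw [h2, hcol, star_smul, smul_dotProduct]
      simp only [Complex.star_def, Complex.conj_ofReal, smul_eq_mul]
      rfl
    rw [hBf, mulVec_sub, mulVec_smul, mulVec_smul, ← hφ] at h1
    simp only [Pi.sub_apply, Pi.smul_apply, smul_eq_mul, mulVec_single_one, col_apply,
      star_apply, Complex.star_def] at h1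
    linear_combination -h1
  have hb0 : (J.b 0 : ℂ) ≠ 0 := by exact_mod_cast (J.b_pos 0).ne'
  have htl : ∀ j, (t j : ℂ) - l ≠ 0 := by
    intro j h0
    have h1 := hφj j
    rw [h0, zero_mul] at h1
    exact neg_ne_zero.2 (mul_ne_zero hb0 hf00)
      ((mul_eq_zero.1 h1.symm).resolve_right ((_root_.map_ne_zero _).2 (hne j)))
  have hφj' : ∀ j, φ j = -(J.b 0 * f 0) * (starRingEnd ℂ) (U 0 j) * (1 / ((t j : ℂ) - l)) := by
    intro j
    rw [← hφj]
    field_simp [htl j]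
  refine ⟨htl, ?_, ?_⟩
  -- Row `0`, divided by `f_0`, is the equation `F_n(l) = 0`.
  · have h1 := congrFun hf 0
    rw [truncation_mulVec_zero] at h1
    have h2 : f 1 = -(J.b 0 * f 0) * ∑ j, (w j : ℂ) * (1 / ((t j : ℂ) - l)) := by
      have h3 := congrFun hfφ 0
      rw [mulVec, dotProduct] at h3
      change f 1 = _ at h3
      rw [h3, Finset.mul_sum]
      refine Finset.sum_congr rfl fun j _ => ?_
      rw [hφj', hw, Complex.normSq_eq_conj_mul_self]
      ring
    rw [h2, Pi.smul_apply, smul_eq_mul] at h1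
    refine mul_left_cancel₀ hf00 ?_
    push_cast
    linear_combination h1
  -- Unitarity turns nonpositivity of the form into `∑ |φ_j|² ≤ |f_0|²`, and `|f_0|²` factors out of
  -- the left side.
  · rw [re_fundSymm_form] at hff
    have h1 : ∑ i, Complex.normSq (f' i) = ∑ j, Complex.normSq (φ j) := by
      have h2 : star f' ⬝ᵥ f' = star φ ⬝ᵥ φ := by
        conv_lhs => rw [hfφ]
        rw [star_mulVec, ← dotProduct_mulVec, mulVec_mulVec, ← star_eq_conjTranspose, hUU',
          one_mulVec]
      have h3 : ∀ x : Fin (m + 1) → ℂ, star x ⬝ᵥ x = ((∑ i, Complex.normSq (x i) : ℝ) : ℂ) := by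
        intro x
        rw [Complex.ofReal_sum, dotProduct]
        exact Finset.sum_congr rfl fun i _ => by
          rw [Complex.normSq_eq_conj_mul_self]; rfl
      rw [h3, h3] at h2
      exact_mod_cast h2
    have h4 : ∑ j, Complex.normSq (φ j) = Complex.normSq (f 0) *
        (J.b 0 ^ 2 * ∑ j, w j * (1 / Complex.normSq ((t j : ℂ) - l))) := by
      rw [Finset.mul_sum, Finset.mul_sum]
      refine Finset.sum_congr rfl fun j _ => ?_
      rw [hφj']
      simp only [map_mul, map_div₀, map_one, Complex.normSq_conj, Complex.normSq_neg,
        Complex.normSq_ofReal, hw]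
      ring
    change -Complex.normSq (f 0) + ∑ i, Complex.normSq (f' i) ≤ 0 at hff
    rw [h1, h4] at hff
    have h5 := Complex.normSq_pos.2 hf00
    by_contra! h6
    nlinarith

end JacobiData

/-! ### Joukowski coordinates, Chebyshev approximation and the quadrature error. -/

/-- The Joukowski map, which sends circles of radius `1 / R` to ellipses with foci `t₃, t₄`. -/
noncomputable def joukowski (t₃ t₄ : ℝ) (w : ℂ) : ℂ :=
  ((t₃ + t₄) / 2 : ℝ) + ((t₄ - t₃) / 4 : ℝ) * (w + w⁻¹)

section Joukowski

variable {t₃ t₄ : ℝ}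

/-- The distances to the foci are `(t₄ - t₃) / 4` times `|w + 1|² / |w|` and `|w - 1|² / |w|`; the
parallelogram law sums them. -/
theorem norm_joukowski_sub_add (ht : t₃ < t₄) {w : ℂ} (hw : w ≠ 0) :
    ‖joukowski t₃ t₄ w - t₃‖ + ‖joukowski t₃ t₄ w - t₄‖ =
      2 * ((t₄ - t₃) / 4 * (‖w‖ + ‖w‖⁻¹)) := by
  have h3 : joukowski t₃ t₄ w - t₃ = ((t₄ - t₃) / 4 : ℝ) * ((w + 1) ^ 2 / w) := by
    rw [joukowski]; push_cast; field_simp; ring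
  have h4 : joukowski t₃ t₄ w - t₄ = ((t₄ - t₃) / 4 : ℝ) * ((w - 1) ^ 2 / w) := by
    rw [joukowski]; push_cast; field_simp; ring
  have hn : 0 < ‖w‖ := norm_pos_iff.2 hw
  rw [h3, h4, norm_mul, norm_mul, Complex.norm_real, Real.norm_eq_abs,
    abs_of_pos (by linarith), norm_div, norm_div, norm_pow, norm_pow]
  have hp : ‖w + 1‖ ^ 2 + ‖w - 1‖ ^ 2 = 2 * (‖w‖ ^ 2 + 1) := by
    have := parallelogram_law_with_norm ℝ w 1
    rw [norm_one] at this
    linarith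
  have : ‖w + 1‖ ^ 2 = 2 * (‖w‖ ^ 2 + 1) - ‖w - 1‖ ^ 2 := by linarith
  rw [this]
  field_simp
  ring

/-- The preimages solve `w² - v w + 1 = 0` and are mutually inverse. If neither is inside the unit
disc, then `|w| = 1` and the image is in the interval. -/
theorem exists_joukowski_eq (ht : t₃ < t₄) {z : ℂ} (hz : z ∉ ((↑) : ℝ → ℂ) '' Set.Icc t₃ t₄) :
    ∃ w : ℂ, w ≠ 0 ∧ ‖w‖ < 1 ∧ joukowski t₃ t₄ w = z := by
  have hκ : (((t₄ - t₃) / 4 : ℝ) : ℂ) ≠ 0 := by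
    rw [Complex.ofReal_ne_zero]; linarith
  set v : ℂ := (z - ((t₃ + t₄) / 2 : ℝ)) / ((t₄ - t₃) / 4 : ℝ) with hv
  obtain ⟨d, hd⟩ := IsAlgClosed.exists_pow_nat_eq (v ^ 2 - 4) (n := 2) (by norm_num)
  set w : ℂ := (v + d) / 2 with hw
  have hroot : w * (v - w) = 1 := by
    rw [hw]
    linear_combination -(1 / 4) * hd
  have hw0 : w ≠ 0 := left_ne_zero_of_mul_eq_one hroot
  have hinv : w⁻¹ = v - w := inv_eq_of_mul_eq_one_right hroot
  have hJ : joukowski t₃ t₄ w = z := by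
    rw [joukowski, hinv, add_sub_cancel, hv, mul_div_cancel₀ _ hκ]
    ring
  rcases lt_trichotomy ‖w‖ 1 with h | h | h
  · exact ⟨w, hw0, h, hJ⟩
  · exfalso
    apply hz
    have hconj : w⁻¹ = (starRingEnd ℂ) w := Complex.inv_eq_conj h
    have h1 : |w.re| ≤ 1 := h ▸ Complex.abs_re_le_norm w
    rw [abs_le] at h1
    refine ⟨(t₃ + t₄) / 2 + (t₄ - t₃) / 4 * (2 * w.re), ⟨by nlinarith, by nlinarith⟩, ?_⟩
    rw [← hJ, joukowski, hconj, Complex.add_conj]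
    push_cast
    ring
  · refine ⟨w⁻¹, inv_ne_zero hw0, ?_, ?_⟩
    · rw [norm_inv]
      exact inv_lt_one_of_one_lt₀ h
    · rw [← hJ, joukowski, joukowski, inv_inv, add_comm w⁻¹ w]

theorem add_inv_lt_add_inv {r s : ℝ} (hr : 0 < r) (hrs : r < s) (hs : s < 1) :
    s + s⁻¹ < r + r⁻¹ := by
  have hs0 : 0 < s := hr.trans hrs
  have h1 : r + r⁻¹ - (s + s⁻¹) = (s - r) * (1 - r * s) / (r * s) := by
    field_simp; ring
  have h2 : 0 < (s - r) * (1 - r * s) / (r * s) := by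
    have : 0 < s - r := by linarith
    have : 0 < 1 - r * s := by nlinarith
    positivity
  linarith

variable {R : ℝ}

theorem two_mul_semiMajor : 2 * semiMajor t₃ t₄ R = 2 * ((t₄ - t₃) / 4 * (R⁻¹ + R⁻¹⁻¹)) := by
  rw [semiMajor, inv_inv, add_comm R]

theorem joukowski_mem_ellipseCurve (ht : t₃ < t₄) {w : ℂ} (hw : w ≠ 0) (hwR : ‖w‖ = R⁻¹) :
    joukowski t₃ t₄ w ∈ ellipseCurve t₃ t₄ R := by
  rw [mem_ellipseCurve, norm_joukowski_sub_add ht hw, two_mul_semiMajor, hwR]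

theorem joukowski_notMem_ellipseRegion (ht : t₃ < t₄) (hR : 1 < R) {w : ℂ} (hw : w ≠ 0)
    (hwR : ‖w‖ < R⁻¹) : joukowski t₃ t₄ w ∉ ellipseRegion t₃ t₄ R := by
  rw [mem_ellipseRegion, norm_joukowski_sub_add ht hw, two_mul_semiMajor, not_le]
  have := add_inv_lt_add_inv (norm_pos_iff.2 hw) hwR (inv_lt_one_of_one_lt₀ hR)
  nlinarith

theorem exists_joukowski_eq_of_mem_ellipseCurve (ht : t₃ < t₄) (hR : 1 < R) {z : ℂ}
    (hz : z ∈ ellipseCurve t₃ t₄ R) : ∃ w : ℂ, w ≠ 0 ∧ ‖w‖ = R⁻¹ ∧ joukowski t₃ t₄ w = z := by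
  obtain ⟨w, hw0, hw1, rfl⟩ := exists_joukowski_eq ht (notMem_Icc_of_mem_ellipseCurve ht hR hz)
  refine ⟨w, hw0, ?_, rfl⟩
  rw [mem_ellipseCurve, norm_joukowski_sub_add ht hw0, two_mul_semiMajor] at hz
  rcases lt_trichotomy ‖w‖ R⁻¹ with h | h | h
  · have := add_inv_lt_add_inv (norm_pos_iff.2 hw0) h (inv_lt_one_of_one_lt₀ hR)
    nlinarith
  · exact h
  · have := add_inv_lt_add_inv (inv_pos.2 (by linarith)) h hw1
    nlinarith

theorem exists_joukowski_eq_of_notMem_ellipseRegion (ht : t₃ < t₄) (hR : 1 < R) {z : ℂ}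
    (hz : z ∉ ellipseRegion t₃ t₄ R) : ∃ w : ℂ, w ≠ 0 ∧ ‖w‖ < R⁻¹ ∧ joukowski t₃ t₄ w = z := by
  have hz' : z ∉ ((↑) : ℝ → ℂ) '' Set.Icc t₃ t₄ := by
    rintro ⟨x, hx, rfl⟩
    exact hz (ofReal_mem_ellipseRegion ht hR hx)
  obtain ⟨w, hw0, hw1, rfl⟩ := exists_joukowski_eq ht hz'
  refine ⟨w, hw0, ?_, rfl⟩
  rw [mem_ellipseRegion, norm_joukowski_sub_add ht hw0, two_mul_semiMajor, not_le] at hz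
  by_contra! h
  rcases h.eq_or_lt with h | h
  · rw [h] at hz
    exact lt_irrefl _ hz
  · have := add_inv_lt_add_inv (inv_pos.2 (by linarith)) h hw1
    nlinarith

/-- Points of `[t₃, t₄]` in terms of an angle. -/
theorem exists_joukowski_sub_eq (ht : t₃ < t₄) {x : ℝ} (hx : x ∈ Set.Icc t₃ t₄) {w : ℂ}
    (hw : w ≠ 0) : ∃ θ : ℝ, (x - (t₃ + t₄) / 2) / ((t₄ - t₃) / 2) = Real.cos θ ∧
      w * (x - joukowski t₃ t₄ w) = -((t₄ - t₃) / 4 : ℝ) *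
        ((1 - w * Complex.exp (θ * Complex.I)) * (1 - w * Complex.exp (-(θ * Complex.I)))) := by
  have hd : 0 < t₄ - t₃ := by linarith
  have h1 : -1 ≤ (x - (t₃ + t₄) / 2) / ((t₄ - t₃) / 2) := by
    rw [le_div_iff₀ (by linarith)]; linarith [hx.1]
  have h2 : (x - (t₃ + t₄) / 2) / ((t₄ - t₃) / 2) ≤ 1 := by
    rw [div_le_iff₀ (by linarith)]; linarith [hx.2]
  refine ⟨Real.arccos ((x - (t₃ + t₄) / 2) / ((t₄ - t₃) / 2)), (Real.cos_arccos h1 h2).symm, ?_⟩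
  set θ := Real.arccos ((x - (t₃ + t₄) / 2) / ((t₄ - t₃) / 2)) with hθ
  have hcos : Real.cos θ = (x - (t₃ + t₄) / 2) / ((t₄ - t₃) / 2) := Real.cos_arccos h1 h2
  have hx' : x = (t₃ + t₄) / 2 + (t₄ - t₃) / 2 * Real.cos θ := by
    rw [hcos]; field_simp; ring
  have hsum : Complex.exp (θ * Complex.I) + Complex.exp (-(θ * Complex.I)) =
      2 * (Real.cos θ : ℝ) := by
    rw [Complex.ofReal_cos, Complex.cos, neg_mul]; ring
  have hprod : Complex.exp (θ * Complex.I) * Complex.exp (-(θ * Complex.I)) = 1 := by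
    rw [← Complex.exp_add, add_neg_cancel, Complex.exp_zero]
  have hxc : (x : ℂ) = (t₃ + t₄) / 2 + (t₄ - t₃) / 2 * (Real.cos θ : ℝ) := by
    exact_mod_cast hx'
  rw [hxc, joukowski]
  push_cast
  push_cast at hsum
  have hwi : w * w⁻¹ = 1 := mul_inv_cancel₀ hw
  linear_combination ((t₄ - t₃) / 4 * w ^ 2 : ℂ) * hprod - ((t₄ - t₃) / 4 * w : ℂ) * hsum -
    ((t₄ - t₃) / 4 : ℂ) * hwi

theorem norm_mul_exp_mul_I (w : ℂ) (θ : ℝ) : ‖w * Complex.exp (θ * Complex.I)‖ = ‖w‖ := by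
  rw [norm_mul, Complex.norm_exp_ofReal_mul_I, mul_one]

theorem norm_mul_exp_neg_mul_I (w : ℂ) (θ : ℝ) :
    ‖w * Complex.exp (-(θ * Complex.I))‖ = ‖w‖ := by
  rw [show -(θ * Complex.I : ℂ) = ((-θ : ℝ) : ℂ) * Complex.I by push_cast; ring,
    norm_mul_exp_mul_I]

theorem one_sub_norm_le (a : ℂ) : 1 - ‖a‖ ≤ ‖1 - a‖ := by
  have := norm_sub_norm_le (1 : ℂ) a
  rwa [norm_one] at this

theorem joukowski_notMem_Icc (ht : t₃ < t₄) {w : ℂ} (hw : w ≠ 0) (hw1 : ‖w‖ < 1) :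
    joukowski t₃ t₄ w ∉ ((↑) : ℝ → ℂ) '' Set.Icc t₃ t₄ := by
  rintro ⟨x, hx, hxz⟩
  obtain ⟨θ, -, h⟩ := exists_joukowski_sub_eq ht hx hw
  rw [← hxz, sub_self, mul_zero] at h
  have ha := one_sub_norm_le (w * Complex.exp (θ * Complex.I))
  have hb := one_sub_norm_le (w * Complex.exp (-(θ * Complex.I)))
  rw [norm_mul_exp_mul_I] at ha
  rw [norm_mul_exp_neg_mul_I] at hb
  have hκ' : (((t₄ - t₃) / 4 : ℝ) : ℂ) ≠ 0 := by
    rw [Complex.ofReal_ne_zero]; linarith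
  refine mul_ne_zero (neg_ne_zero.2 hκ') (mul_ne_zero ?_ ?_) h.symm
  · exact norm_pos_iff.1 (lt_of_lt_of_le (by linarith) ha)
  · exact norm_pos_iff.1 (lt_of_lt_of_le (by linarith) hb)

/-- In the factorization of `w (x - z)` each of the two factors is at least `1 - |w|` in modulus.
The bound serves the case `n = 0` and the behaviour at infinity, `w → 0`. -/
theorem norm_one_div_ofReal_sub_joukowski_le (ht : t₃ < t₄) {x : ℝ} (hx : x ∈ Set.Icc t₃ t₄)
    {w : ℂ} (hw : w ≠ 0) (hw1 : ‖w‖ < 1) :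
    ‖1 / ((x : ℂ) - joukowski t₃ t₄ w)‖ ≤ ‖w‖ / ((t₄ - t₃) / 4 * (1 - ‖w‖) ^ 2) := by
  obtain ⟨θ, -, h⟩ := exists_joukowski_sub_eq ht hx hw
  have h1 := congrArg norm h
  rw [norm_mul, norm_mul, norm_mul, norm_neg, Complex.norm_real, Real.norm_eq_abs,
    abs_of_pos (by linarith)] at h1
  have h2 := one_sub_norm_le (w * Complex.exp (θ * Complex.I))
  have h3 := one_sub_norm_le (w * Complex.exp (-(θ * Complex.I)))
  rw [norm_mul_exp_mul_I] at h2
  rw [norm_mul_exp_neg_mul_I] at h3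
  have hpos : 0 < 1 - ‖w‖ := by linarith
  have hκ : 0 < (t₄ - t₃) / 4 := by linarith
  have h4 : (t₄ - t₃) / 4 * (1 - ‖w‖) ^ 2 ≤ ‖w‖ * ‖(x : ℂ) - joukowski t₃ t₄ w‖ := by
    rw [h1, pow_two]
    gcongr
  have h5 : 0 < ‖w‖ * ‖(x : ℂ) - joukowski t₃ t₄ w‖ :=
    lt_of_lt_of_le (by positivity) h4
  have hwp : 0 < ‖w‖ := norm_pos_iff.2 hw
  have h6 : 0 < ‖(x : ℂ) - joukowski t₃ t₄ w‖ := pos_of_mul_pos_right h5 hwp.le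
  rw [norm_div, norm_one, div_le_div_iff₀ h6 (by positivity), one_mul]
  exact h4

open Polynomial in
/-- The Chebyshev polynomials transplanted to `[t₃, t₄]`. -/
noncomputable def shiftedChebyshev (t₃ t₄ : ℝ) (k : ℕ) : ℝ[X] :=
  (Chebyshev.T ℝ k).comp (C ((t₄ - t₃) / 2)⁻¹ * (X - C ((t₃ + t₄) / 2)))

open Polynomial in
theorem natDegree_shiftedChebyshev_le (k : ℕ) : (shiftedChebyshev t₃ t₄ k).natDegree ≤ k := by
  refine natDegree_comp_le.trans ?_
  have h1 : (Chebyshev.T ℝ k).natDegree ≤ k := by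
    simp
  have h2 : (C ((t₄ - t₃) / 2)⁻¹ * (X - C ((t₃ + t₄) / 2))).natDegree ≤ 1 :=
    (natDegree_C_mul_le _ _).trans (natDegree_X_sub_C _).le
  simpa using Nat.mul_le_mul h1 h2

open Polynomial in
theorem eval_shiftedChebyshev {x θ : ℝ}
    (h : (x - (t₃ + t₄) / 2) / ((t₄ - t₃) / 2) = Real.cos θ) (k : ℕ) :
    (shiftedChebyshev t₃ t₄ k).eval x = Real.cos (k * θ) := by
  have h1 : ((t₄ - t₃) / 2)⁻¹ * (x - (t₃ + t₄) / 2) = Real.cos θ := by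
    rw [← h, div_eq_mul_inv (x - (t₃ + t₄) / 2), mul_comm]
  rw [shiftedChebyshev, eval_comp, eval_mul, eval_C, eval_sub, eval_X, eval_C, h1,
    Chebyshev.T_real_cos]
  simp

/-- The truncated Chebyshev expansion of `1 / (x - z)` for `z` the image of `w` under the Joukowski
map. -/
noncomputable def chebyshevApprox (t₃ t₄ : ℝ) (w : ℂ) (N : ℕ) (x : ℝ) : ℂ :=
  -w / (((t₄ - t₃) / 4 : ℝ) * (1 - w ^ 2)) *
    (∑ k ∈ Finset.range N, 2 * w ^ k * ((shiftedChebyshev t₃ t₄ k).eval x : ℝ) - 1)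

/-- With `a, b = w e^{±iθ}` one has `2 w^k T_k(cos θ) = a^k + b^k` and `1/(1-a) + 1/(1-b) - 1 = (1 -
w²) / ((1-a)(1-b))`. The error is thus the sum of two geometric tails, times the prefactor. -/
theorem norm_one_div_sub_chebyshevApprox_le (ht : t₃ < t₄) {x : ℝ} (hx : x ∈ Set.Icc t₃ t₄)
    {w : ℂ} (hw : w ≠ 0) (hw1 : ‖w‖ < 1) (N : ℕ) :
    ‖1 / ((x : ℂ) - joukowski t₃ t₄ w) - chebyshevApprox t₃ t₄ w N x‖ ≤
      ‖w‖ / ((t₄ - t₃) / 4 * (1 - ‖w‖ ^ 2)) * (2 * ‖w‖ ^ N / (1 - ‖w‖)) := by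
  obtain ⟨θ, hθ, h⟩ := exists_joukowski_sub_eq ht hx hw
  set a := w * Complex.exp (θ * Complex.I) with ha
  set b := w * Complex.exp (-(θ * Complex.I)) with hb
  have hna : ‖a‖ = ‖w‖ := norm_mul_exp_mul_I w θ
  have hnb : ‖b‖ = ‖w‖ := norm_mul_exp_neg_mul_I w θ
  have hpos : 0 < 1 - ‖w‖ := by linarith
  have hκ : 0 < (t₄ - t₃) / 4 := by linarith
  have hκ' : (((t₄ - t₃) / 4 : ℝ) : ℂ) ≠ 0 := by exact_mod_cast hκ.ne'
  have ha1 : ‖(1 : ℂ) - a‖ ≥ 1 - ‖w‖ := hna ▸ one_sub_norm_le a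
  have hb1 : ‖(1 : ℂ) - b‖ ≥ 1 - ‖w‖ := hnb ▸ one_sub_norm_le b
  have ha0 : 1 - a ≠ 0 := norm_pos_iff.1 (hpos.trans_le ha1)
  have hb0 : 1 - b ≠ 0 := norm_pos_iff.1 (hpos.trans_le hb1)
  have hw2 : 1 - ‖w‖ ^ 2 ≤ ‖1 - w ^ 2‖ := by
    have := one_sub_norm_le (w ^ 2)
    rwa [norm_pow] at this
  have hw2p : 0 < 1 - ‖w‖ ^ 2 := by nlinarith [norm_nonneg w]
  have hw20 : 1 - w ^ 2 ≠ 0 := norm_pos_iff.1 (hw2p.trans_le hw2)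
  have hab : a * b = w ^ 2 := by
    have hprod : Complex.exp (θ * Complex.I) * Complex.exp (-(θ * Complex.I)) = 1 := by
      rw [← Complex.exp_add, add_neg_cancel, Complex.exp_zero]
    rw [ha, hb]
    linear_combination w ^ 2 * hprod
  have hsum : ∑ k ∈ Finset.range N, 2 * w ^ k * ((shiftedChebyshev t₃ t₄ k).eval x : ℝ) =
      ∑ k ∈ Finset.range N, a ^ k + ∑ k ∈ Finset.range N, b ^ k := by
    rw [← Finset.sum_add_distrib]
    refine Finset.sum_congr rfl fun k _ => ?_
    rw [eval_shiftedChebyshev hθ, ha, hb, mul_pow, mul_pow, ← Complex.exp_nat_mul,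
      ← Complex.exp_nat_mul, Complex.ofReal_cos, Complex.cos]
    push_cast
    have e1 : (k : ℂ) * θ * Complex.I = k * (θ * Complex.I) := by ring
    have e2 : -((k : ℂ) * θ) * Complex.I = k * (-(θ * Complex.I)) := by ring
    rw [e1, e2]
    ring
  have hga : (∑ k ∈ Finset.range N, a ^ k) * (1 - a) = 1 - a ^ N := geom_sum_mul_neg a N
  have hgb : (∑ k ∈ Finset.range N, b ^ k) * (1 - b) = 1 - b ^ N := geom_sum_mul_neg b N
  have hmain : 1 / ((x : ℂ) - joukowski t₃ t₄ w) - chebyshevApprox t₃ t₄ w N x =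
      -w / (((t₄ - t₃) / 4 : ℝ) * (1 - w ^ 2)) * (a ^ N / (1 - a) + b ^ N / (1 - b)) := by
    have hxz : (x : ℂ) - joukowski t₃ t₄ w ≠ 0 := by
      intro h0
      rw [h0, mul_zero] at h
      exact neg_ne_zero.2 hκ' ((mul_eq_zero.1 h.symm).resolve_right (mul_ne_zero ha0 hb0))
    have h1 : 1 / ((x : ℂ) - joukowski t₃ t₄ w) =
        -w / ((((t₄ - t₃) / 4 : ℝ) : ℂ) * ((1 - a) * (1 - b))) := by
      rw [div_eq_div_iff hxz (mul_ne_zero hκ' (mul_ne_zero ha0 hb0))]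
      linear_combination h
    have hSa : ∑ k ∈ Finset.range N, a ^ k = (1 - a ^ N) / (1 - a) := by
      rw [eq_div_iff ha0, hga]
    have hSb : ∑ k ∈ Finset.range N, b ^ k = (1 - b ^ N) / (1 - b) := by
      rw [eq_div_iff hb0, hgb]
    rw [h1, chebyshevApprox, hsum, hSa, hSb, ← hab]
    rw [← hab] at hw20
    field_simp
    ring
  rw [hmain, norm_mul, norm_div, norm_neg, norm_mul, Complex.norm_real, Real.norm_eq_abs,
    abs_of_pos hκ]
  have ht1 : ‖a ^ N / (1 - a) + b ^ N / (1 - b)‖ ≤ 2 * ‖w‖ ^ N / (1 - ‖w‖) := by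
    refine (norm_add_le _ _).trans ?_
    rw [norm_div, norm_div, norm_pow, norm_pow, hna, hnb]
    have e1 : ‖w‖ ^ N / ‖1 - a‖ ≤ ‖w‖ ^ N / (1 - ‖w‖) := by gcongr
    have e2 : ‖w‖ ^ N / ‖1 - b‖ ≤ ‖w‖ ^ N / (1 - ‖w‖) := by gcongr
    calc _ ≤ ‖w‖ ^ N / (1 - ‖w‖) + ‖w‖ ^ N / (1 - ‖w‖) := add_le_add e1 e2
      _ = _ := by ring
  gcongr

theorem continuous_chebyshevApprox (w : ℂ) (N : ℕ) : Continuous (chebyshevApprox t₃ t₄ w N) := by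
  unfold chebyshevApprox
  refine continuous_const.mul (Continuous.sub (continuous_finsetSum _ fun k _ => ?_)
    continuous_const)
  exact continuous_const.mul (Complex.continuous_ofReal.comp (Polynomial.continuous _))

open Polynomial in
/-- The error of a quadrature that is exact for polynomials of degree less than `N`, applied to
`1 / (x - z)`. -/
theorem norm_stieltjes_sub_quadrature_le (ht : t₃ < t₄) {μ : Measure ℝ} [IsProbabilityMeasure μ]
    (hμ : μ (Set.Icc t₃ t₄)ᶜ = 0) {n N : ℕ} (hN : 0 < N) {c t : Fin n → ℝ} (hc : ∀ j, 0 ≤ c j)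
    (htj : ∀ j, t j ∈ Set.Icc t₃ t₄)
    (hquad : ∀ p : ℝ[X], p.natDegree < N → ∫ x, p.eval x ∂μ = ∑ j, c j * p.eval (t j))
    {w : ℂ} (hw : w ≠ 0) (hw1 : ‖w‖ < 1) :
    ‖stieltjes μ (joukowski t₃ t₄ w) -
        ∑ j, (c j : ℂ) * (1 / ((t j : ℂ) - joukowski t₃ t₄ w))‖ ≤
      2 * (‖w‖ / ((t₄ - t₃) / 4 * (1 - ‖w‖ ^ 2)) * (2 * ‖w‖ ^ N / (1 - ‖w‖))) := by
  set E := ‖w‖ / ((t₄ - t₃) / 4 * (1 - ‖w‖ ^ 2)) * (2 * ‖w‖ ^ N / (1 - ‖w‖)) with hE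
  set z := joukowski t₃ t₄ w with hz
  have hzI : z ∉ ((↑) : ℝ → ℂ) '' Set.Icc t₃ t₄ := joukowski_notMem_Icc ht hw hw1
  have hsum1 : ∑ j, c j = 1 := by
    have := hquad 1 (by simpa using hN)
    simpa using this.symm
  -- The approximant has degree less than `N`, so the quadrature is exact on it. Replacing `1 / (x -
  -- z)` by it costs `E` for `μ` and `E` for the quadrature, both of total mass one.
  have hG : ∫ x, chebyshevApprox t₃ t₄ w N x ∂μ =
      ∑ j, (c j : ℂ) * chebyshevApprox t₃ t₄ w N (t j) := by
    have hint : ∀ k, Integrable (fun x : ℝ => 2 * w ^ k *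
        (((shiftedChebyshev t₃ t₄ k).eval x : ℝ) : ℂ)) μ := fun k =>
      (integrable_eval hμ _).ofReal.const_mul _
    unfold chebyshevApprox
    rw [integral_const_mul, integral_sub (integrable_finsetSum _ fun k _ => hint k)
      (integrable_const _), integral_finsetSum _ fun k _ => hint k]
    have hk : ∀ k ∈ Finset.range N, ∫ x : ℝ, 2 * w ^ k *
        (((shiftedChebyshev t₃ t₄ k).eval x : ℝ) : ℂ) ∂μ =
        ∑ j, (c j : ℂ) * (2 * w ^ k * (((shiftedChebyshev t₃ t₄ k).eval (t j) : ℝ) : ℂ)) := by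
      intro k hk
      rw [integral_const_mul, integral_complex_ofReal, hquad _
        ((natDegree_shiftedChebyshev_le k).trans_lt (Finset.mem_range.1 hk)), Complex.ofReal_sum,
        Finset.mul_sum]
      refine Finset.sum_congr rfl fun j _ => ?_
      push_cast
      ring
    rw [Finset.sum_congr rfl hk, Finset.sum_comm]
    have h1 : (1 : ℂ) = ∑ j, (c j : ℂ) := by exact_mod_cast hsum1.symm
    have h2 : ∫ _ : ℝ, (1 : ℂ) ∂μ = ∑ j, (c j : ℂ) := by rw [← h1]; simp
    rw [h2, ← Finset.sum_sub_distrib, Finset.mul_sum]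
    refine Finset.sum_congr rfl fun j _ => ?_
    rw [← Finset.mul_sum]
    ring
  have hE1 : ‖stieltjes μ z - ∫ x, chebyshevApprox t₃ t₄ w N x ∂μ‖ ≤ E := by
    rw [stieltjes, ← integral_sub (integrable_one_div_sub hμ hzI)
      (integrable_of_continuousOn_Icc hμ (continuous_chebyshevApprox w N).continuousOn)]
    refine (norm_integral_le_of_norm_le_const (C := E) ?_).trans ?_
    · filter_upwards [ae_mem_Icc hμ] with x hx
      exact norm_one_div_sub_chebyshevApprox_le ht hx hw hw1 N
    · simp
  have hE2 : ‖∑ j, (c j : ℂ) * chebyshevApprox t₃ t₄ w N (t j) -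
      ∑ j, (c j : ℂ) * (1 / ((t j : ℂ) - z))‖ ≤ E := by
    rw [← Finset.sum_sub_distrib]
    refine (norm_sum_le _ _).trans ?_
    calc _ ≤ ∑ j, c j * E := by
          refine Finset.sum_le_sum fun j _ => ?_
          rw [← mul_sub, norm_mul, Complex.norm_real, Real.norm_eq_abs, abs_of_nonneg (hc j),
            norm_sub_rev]
          exact mul_le_mul_of_nonneg_left
            (norm_one_div_sub_chebyshevApprox_le ht (htj j) hw hw1 N) (hc j)
      _ = E := by rw [← Finset.sum_mul, hsum1, one_mul]
  have := norm_add_le (stieltjes μ z - ∫ x, chebyshevApprox t₃ t₄ w N x ∂μ)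
    (∑ j, (c j : ℂ) * chebyshevApprox t₃ t₄ w N (t j) - ∑ j, (c j : ℂ) * (1 / ((t j : ℂ) - z)))
  rw [← hG, sub_add_sub_cancel] at this
  rw [hG] at hE1 this
  linarith

theorem norm_stieltjes_joukowski_le (ht : t₃ < t₄) {μ : Measure ℝ} [IsProbabilityMeasure μ]
    (hμ : μ (Set.Icc t₃ t₄)ᶜ = 0) {w : ℂ} (hw : w ≠ 0) (hw1 : ‖w‖ < 1) :
    ‖stieltjes μ (joukowski t₃ t₄ w)‖ ≤ ‖w‖ / ((t₄ - t₃) / 4 * (1 - ‖w‖) ^ 2) := by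
  refine (norm_integral_le_of_norm_le_const
    (C := ‖w‖ / ((t₄ - t₃) / 4 * (1 - ‖w‖) ^ 2)) ?_).trans (by simp)
  filter_upwards [ae_mem_Icc hμ] with x hx
  exact norm_one_div_ofReal_sub_joukowski_le ht hx hw hw1

end Joukowski

/-! ### Numerical inequalities behind the bound on `n`. -/

section Constants

/-- The second factor is the base of the logarithm in the bound on `n`; below it is called `q`, so
that `R = g q`. -/
theorem ellipseParam_eq_mul {g ε : ℝ} (hg : 1 < g) :
    ellipseParam g ε = g * (1 + ε * √(1 - (g ^ 2)⁻¹)) := by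
  have h1 : √(g ^ 2 - 1) = g * √(1 - (g ^ 2)⁻¹) := by
    have h2 : g ^ 2 - 1 = g ^ 2 * (1 - (g ^ 2)⁻¹) := by field_simp
    rw [h2, Real.sqrt_mul (by positivity), Real.sqrt_sq (by linarith)]
  rw [ellipseParam, h1]
  ring

theorem one_lt_one_add_mul_sqrt {g ε : ℝ} (hg : 1 < g) (hε : 0 < ε) :
    1 < 1 + ε * √(1 - (g ^ 2)⁻¹) := by
  have h1 : (g ^ 2)⁻¹ < 1 := inv_lt_one_of_one_lt₀ (by nlinarith)
  have : 0 < √(1 - (g ^ 2)⁻¹) := Real.sqrt_pos.2 (by linarith)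
  nlinarith

theorem lt_pow_of_log_div_log_lt {X q : ℝ} (hX : 0 < X) (hq : 1 < q) {n : ℕ}
    (h : Real.log X / Real.log q < n) : X < q ^ n := by
  rw [div_lt_iff₀ (Real.log_pos hq), ← Real.log_pow] at h
  exact (Real.log_lt_log_iff hX (by positivity)).1 h

/-- The smallness condition for the quadrature error when there is at least one node. -/
theorem quadrature_error_small {β g q M Δ : ℝ} {m : ℕ} (hβ : 0 < β) (hg : 1 < g) (hq : 1 < q)
    (hM : 0 < M) (hΔ : 0 < Δ) (hX : 8 * β * g * M / ((g - 1) ^ 2 * Δ) < q ^ (m + 1)) :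
    M * (β * (2 * ((g * q)⁻¹ / (Δ / 4 * (1 - (g * q)⁻¹ ^ 2)) *
      (2 * (g * q)⁻¹ ^ (2 * (m + 1) - 1) / (1 - (g * q)⁻¹))))) < 1 := by
  set R := g * q with hR
  have hR1 : 1 < R := by nlinarith
  have hg1 : 0 < g - 1 := by linarith
  have hRg : q * (g - 1) ≤ R - 1 := by rw [hR]; nlinarith
  have hexp : 2 * (m + 1) - 1 = 2 * m + 1 := by omega
  rw [div_lt_iff₀ (by positivity)] at hX
  have hR2 : 0 < R ^ 2 - 1 := by nlinarith
  have hR0 : 0 < R := by linarith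
  have hRm : 0 < R - 1 := by linarith
  have e1 : M * (β * (2 * (R⁻¹ / (Δ / 4 * (1 - R⁻¹ ^ 2)) *
      (2 * R⁻¹ ^ (2 * (m + 1) - 1) / (1 - R⁻¹))))) =
      16 * (β * M) * R / (Δ * ((R ^ 2 - 1) * (R - 1)) * R ^ (2 * m)) := by
    have h1 : (1 - R⁻¹ ^ 2) = (R ^ 2 - 1) / R ^ 2 := by field_simp
    have h2 : 1 - R⁻¹ = (R - 1) / R := by field_simp
    rw [hexp, h1, h2, pow_succ, inv_pow]
    field_simp
    ring
  rw [e1, div_lt_one (by positivity)]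
  have hqR : q ^ m ≤ R ^ m := by gcongr; rw [hR]; nlinarith
  have h1R : 1 ≤ R ^ m := one_le_pow₀ hR1.le
  have h2m : q ^ m ≤ R ^ (2 * m) := by
    rw [two_mul, pow_add]
    nlinarith [pow_pos hR0 m]
  -- Here `16 β M R` is `2q` times `8 β g M`. In the next step, `(R² - 1)(R - 1) ≥ 2 (R - 1)² ≥ 2 q²
  -- (g - 1)²`, and only `q ^ m` is kept of the available decay `R ^ (2m)`.
  have k1 : 16 * (β * M) * R < 2 * q ^ (m + 1) * ((g - 1) ^ 2 * Δ) * q := by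
    rw [hR]
    have := mul_lt_mul_of_pos_right hX (show 0 < 2 * q by linarith)
    nlinarith
  have k2 : 2 * q ^ (m + 1) * ((g - 1) ^ 2 * Δ) * q ≤
      Δ * ((R ^ 2 - 1) * (R - 1)) * R ^ (2 * m) := by
    have s1 : (q * (g - 1)) ^ 2 ≤ (R - 1) ^ 2 := by gcongr
    have s2 : 2 * (q * (g - 1)) ^ 2 ≤ (R ^ 2 - 1) * (R - 1) := by
      nlinarith [sq_nonneg (R - 1)]
    calc 2 * q ^ (m + 1) * ((g - 1) ^ 2 * Δ) * q = Δ * (2 * (q * (g - 1)) ^ 2) * q ^ m := by ring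
      _ ≤ Δ * ((R ^ 2 - 1) * (R - 1)) * R ^ (2 * m) := by gcongr
  linarith

/-- The smallness condition for the crude bound of the Stieltjes transform. -/
theorem crude_error_small {β g q M Δ : ℝ} (hβ : 0 < β) (hg : 1 < g) (hq : 1 < q)
    (hM : 0 < M) (hΔ : 0 < Δ) (hX : 8 * β * g * M / ((g - 1) ^ 2 * Δ) < 1) :
    M * (β * ((g * q)⁻¹ / (Δ / 4 * (1 - (g * q)⁻¹) ^ 2))) < 1 := by
  set R := g * q with hR
  have hR1 : 1 < R := by nlinarith
  have hg1 : 0 < g - 1 := by linarith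
  have hRg : q * (g - 1) ≤ R - 1 := by rw [hR]; nlinarith
  rw [div_lt_one (by positivity)] at hX
  have hR0 : 0 < R := by linarith
  have hRm : 0 < R - 1 := by linarith
  have e1 : M * (β * (R⁻¹ / (Δ / 4 * (1 - R⁻¹) ^ 2))) =
      4 * (β * M) * R / (Δ * (R - 1) ^ 2) := by
    have h2 : 1 - R⁻¹ = (R - 1) / R := by field_simp
    rw [h2]
    field_simp
  rw [e1, div_lt_one (by positivity)]
  have s1 : (q * (g - 1)) ^ 2 ≤ (R - 1) ^ 2 := by gcongr
  have k1 : 8 * (β * M) * R < (g - 1) ^ 2 * Δ * q := by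
    rw [hR]
    have := mul_lt_mul_of_pos_right hX (show 0 < q by linarith)
    nlinarith
  have k2 : (g - 1) ^ 2 * Δ * q ≤ Δ * (q * (g - 1)) ^ 2 := by
    have : 0 < (g - 1) ^ 2 * Δ * q := by positivity
    nlinarith
  have k3 : Δ * (q * (g - 1)) ^ 2 ≤ Δ * (R - 1) ^ 2 := by gcongr
  have : 0 < β * M * R := by positivity
  linarith

end Constants

/-! ### Zeros of the quadrature analogue. -/

section FiniteSums

variable {t₃ t₄ R : ℝ}

theorem one_div_re_pos {γ v : ℂ} (h : 0 < (γ * v).re) : 0 < (γ⁻¹ * (1 / v)).re := by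
  rw [one_div, ← mul_inv, Complex.inv_re]
  refine div_pos h (Complex.normSq_pos.2 ?_)
  intro h0
  simp [h0] at h

/-- Moving a real point towards `[t₃, t₄]` decreases its distances to both foci. This keeps the hull
of `[t₃, t₄]` and a real point of the region inside the region. -/
theorem ofReal_mem_ellipseRegion_of_le {x y : ℝ} (hy : (y : ℂ) ∈ ellipseRegion t₃ t₄ R)
    (hR : 1 < R) (ht : t₃ < t₄) (hx : x ∈ Set.Icc (min t₃ y) (max t₄ y)) :
    (x : ℂ) ∈ ellipseRegion t₃ t₄ R := by
  by_cases hxI : x ∈ Set.Icc t₃ t₄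
  · exact ofReal_mem_ellipseRegion ht hR hxI
  rw [mem_ellipseRegion] at hy ⊢
  refine le_trans ?_ hy
  simp only [← Complex.ofReal_sub, Complex.norm_real, Real.norm_eq_abs]
  rcases lt_or_ge x t₃ with h | h
  · have hyx : y ≤ x := by
      rcases min_le_iff.1 hx.1 with h1 | h1
      · linarith
      · exact h1
    rw [abs_of_nonpos (by linarith), abs_of_nonpos (by linarith), abs_of_nonpos (by linarith),
      abs_of_nonpos (by linarith)]
    linarith
  · have h4 : t₄ < x := by
      by_contra! h4
      exact hxI ⟨h, h4⟩
    have hyx : x ≤ y := by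
      rcases le_max_iff.1 hx.2 with h1 | h1
      · linarith
      · exact h1
    rw [abs_of_nonneg (by linarith), abs_of_nonneg (by linarith), abs_of_nonneg (by linarith),
      abs_of_nonneg (by linarith)]
    linarith

theorem re_mem_ellipseRegion {l : ℂ} (hl : l ∈ ellipseRegion t₃ t₄ R) :
    ((l.re : ℝ) : ℂ) ∈ ellipseRegion t₃ t₄ R := by
  rw [mem_ellipseRegion] at hl ⊢
  refine le_trans ?_ hl
  simp only [← Complex.ofReal_sub, Complex.norm_real, Real.norm_eq_abs]
  have h3 := Complex.abs_re_le_norm (l - t₃)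
  have h4 := Complex.abs_re_le_norm (l - t₄)
  simp only [Complex.sub_re, Complex.ofReal_re] at h3 h4
  linarith

/-- If `a - z + β ∑ c_j / (t_j - z)` has a zero of nonpositive type in the region bounded by an
ellipse with foci `t₃, t₄`, then it has no zero outside this region. -/
theorem finite_charFun_ne_zero (ht : t₃ < t₄) (hR : 1 < R) {a β : ℝ} (hβ : 0 < β) {n : ℕ}
    {c t : Fin n → ℝ} (hc : ∀ j, 0 ≤ c j) (htj : ∀ j, t j ∈ Set.Icc t₃ t₄) {l : ℂ}
    (hl : ∀ j, (t j : ℂ) - l ≠ 0)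
    (hl0 : (a : ℂ) - l + β * ∑ j, (c j : ℂ) * (1 / ((t j : ℂ) - l)) = 0)
    (hneg : β * ∑ j, c j * (1 / Complex.normSq ((t j : ℂ) - l)) ≤ 1)
    (hlR : l ∈ ellipseRegion t₃ t₄ R) {z : ℂ} (hz : z ∉ ellipseRegion t₃ t₄ R) :
    (a : ℂ) - z + β * ∑ j, (c j : ℂ) * (1 / ((t j : ℂ) - z)) ≠ 0 := by
  set K := ∑ j, c j * (1 / Complex.normSq ((t j : ℂ) - l)) with hK
  set δ := 1 - β * K with hδ
  have hδ0 : 0 ≤ δ := by linarith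
  -- The imaginary part of `F_n(l) = 0` reads `-δ Im l = 0`, so a positive defect `δ` occurs only at
  -- real `l`.
  have hδl : δ * l.im = 0 := by
    have h1 := congrArg Complex.im hl0
    simp only [Complex.add_im, Complex.sub_im, Complex.ofReal_im, Complex.im_ofReal_mul,
      Complex.im_sum, Complex.zero_im, one_div, Complex.inv_im, zero_sub, neg_neg] at h1
    have h2 : ∑ j, c j * (l.im / Complex.normSq ((t j : ℂ) - l)) = K * l.im := by
      rw [hK, Finset.sum_mul]
      exact Finset.sum_congr rfl fun j _ => by ring
    rw [h2] at h1
    rw [hδ]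
    linarith
  set I := Set.Icc (min t₃ l.re) (max t₄ l.re) with hI
  have hzI : z ∉ ((↑) : ℝ → ℂ) '' I := by
    rintro ⟨x, hx, rfl⟩
    exact hz (ofReal_mem_ellipseRegion_of_le (re_mem_ellipseRegion hlR) hR ht hx)
  have htI : ∀ j, t j ∈ I := fun j =>
    ⟨(min_le_left _ _).trans (htj j).1, (htj j).2.trans (le_max_left _ _)⟩
  have hlI : l.re ∈ I := ⟨min_le_right _ _, le_max_right _ _⟩
  have htz : ∀ j, (t j : ℂ) - z ≠ 0 := fun j => ofReal_sub_ne_zero hzI (htI j)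
  have hlz : (l.re : ℂ) - z ≠ 0 := ofReal_sub_ne_zero hzI hlI
  set u : Fin n → ℝ := fun j => c j * (1 / Complex.normSq ((t j : ℂ) - l)) with hu
  have hu0 : ∀ j, 0 ≤ u j := fun j =>
    mul_nonneg (hc j) (one_div_nonneg.2 (Complex.normSq_nonneg _))
  -- For real `l` the defect contributes a point mass `δ` at `l`; the nonnegative weights satisfy `δ
  -- + β ∑ u_j = 1`, so they do not all vanish.
  set U : ℂ := δ * (1 / ((l.re : ℂ) - z)) + β * ∑ j, (u j : ℂ) * (1 / ((t j : ℂ) - z)) with hU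
  have hfact : (a : ℂ) - z + β * ∑ j, (c j : ℂ) * (1 / ((t j : ℂ) - z)) =
      (z - l) * (z - (starRingEnd ℂ) l) * U := by
    have h1 : ∑ j, (c j : ℂ) * (1 / ((t j : ℂ) - z)) = ∑ j, (c j : ℂ) * (1 / ((t j : ℂ) - l)) +
        (z - l) * ((K : ℂ) + (z - (starRingEnd ℂ) l) *
          ∑ j, (u j : ℂ) * (1 / ((t j : ℂ) - z))) := by
      rw [hK, Complex.ofReal_sum, Finset.mul_sum, ← Finset.sum_add_distrib, Finset.mul_sum,
        ← Finset.sum_add_distrib]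
      refine Finset.sum_congr rfl fun j _ => ?_
      have h2 : ((Complex.normSq ((t j : ℂ) - l) : ℝ) : ℂ) =
          ((t j : ℂ) - l) * (t j - (starRingEnd ℂ) l) := by
        rw [Complex.normSq_eq_conj_mul_self]
        simp [mul_comm]
      have h3 : (t j : ℂ) - (starRingEnd ℂ) l ≠ 0 := by
        intro h0
        apply hl j
        have := congrArg (starRingEnd ℂ) h0
        simpa using this
      have h4 := hl j
      have h5 := htz j
      simp only [hu]
      push_cast
      rw [h2]
      field_simp
      ring
    have h2 : (δ : ℂ) * (z - (starRingEnd ℂ) l) * (1 / ((l.re : ℂ) - z)) = -δ := by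
      rcases mul_eq_zero.1 hδl with h | h
      · simp [h]
      · have hc : (starRingEnd ℂ) l = (l.re : ℂ) := Complex.ext (by simp) (by simp [h])
        rw [hc]
        field_simp
        ring
    have h3 : (δ : ℂ) = 1 - β * K := by rw [hδ]; push_cast; ring
    rw [hU, h1]
    linear_combination hl0 - (z - l) * h2 + (z - l) * h3
  rw [hfact]
  have hzl : z ≠ l := by rintro rfl; exact hz hlR
  have hzl' : z ≠ (starRingEnd ℂ) l := by
    rintro rfl; exact hz (conj_mem_ellipseRegion.2 hlR)
  refine mul_ne_zero (mul_ne_zero (sub_ne_zero.2 hzl) (sub_ne_zero.2 hzl')) ?_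
  obtain ⟨γ, -, η, hη, hsep⟩ := exists_separating_functional hzI
  have hpos : ∀ x ∈ I, 0 < (γ⁻¹ * (1 / ((x : ℂ) - z))).re := fun x hx =>
    one_div_re_pos (hη.trans_le (hsep x hx))
  intro hU0
  have hre : δ * (γ⁻¹ * (1 / ((l.re : ℂ) - z))).re +
      β * ∑ j, u j * (γ⁻¹ * (1 / ((t j : ℂ) - z))).re = 0 := by
    have h1 : γ⁻¹ * U = δ * (γ⁻¹ * (1 / ((l.re : ℂ) - z))) +
        β * ∑ j, (u j : ℂ) * (γ⁻¹ * (1 / ((t j : ℂ) - z))) := by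
      rw [hU, mul_add, Finset.mul_sum, Finset.mul_sum, Finset.mul_sum]
      congr 1
      · ring
      · exact Finset.sum_congr rfl fun j _ => by ring
    rw [hU0, mul_zero] at h1
    have h2 := congrArg Complex.re h1
    simpa only [Complex.zero_re, Complex.add_re, Complex.re_ofReal_mul, Complex.re_sum,
      eq_comm] using h2
  have hn1 : 0 ≤ δ * (γ⁻¹ * (1 / ((l.re : ℂ) - z))).re := mul_nonneg hδ0 (hpos _ hlI).le
  have hn2 : ∀ j, 0 ≤ u j * (γ⁻¹ * (1 / ((t j : ℂ) - z))).re := fun j =>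
    mul_nonneg (hu0 j) (hpos _ (htI j)).le
  have hn3 : 0 ≤ ∑ j, u j * (γ⁻¹ * (1 / ((t j : ℂ) - z))).re :=
    Finset.sum_nonneg fun j _ => hn2 j
  -- A zero of `U` would make a sum of nonnegative terms vanish, hence `δ = 0` and `K = 0`, against
  -- `δ = 1 - β K`.
  have hz1 : δ = 0 := by
    have h1 : δ * (γ⁻¹ * (1 / ((l.re : ℂ) - z))).re = 0 := by nlinarith
    exact (mul_eq_zero.1 h1).resolve_right (hpos _ hlI).ne'
  have hz2 : ∑ j, u j * (γ⁻¹ * (1 / ((t j : ℂ) - z))).re = 0 := by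
    rw [hz1, zero_mul, zero_add] at hre
    exact (mul_eq_zero.1 hre).resolve_left hβ.ne'
  have hK0 : K = 0 := by
    rw [hK]
    refine Finset.sum_eq_zero fun j hj => ?_
    exact (mul_eq_zero.1 ((Finset.sum_eq_zero_iff_of_nonneg fun j _ => hn2 j).1 hz2 j hj)
      ).resolve_right (hpos _ (htI j)).ne'
  rw [hδ, hK0] at hz1
  simp at hz1

end FiniteSums

/-! ### A Rouché argument in the exterior of the ellipse. -/

section MaximumPrinciple

variable {t₃ t₄ R : ℝ}

theorem div_re_pos_of_norm_sub_lt {u v : ℂ} (hv : v ≠ 0) (h : ‖u - v‖ < ‖u‖) : 0 < (u / v).re := by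
  have h1 : Complex.normSq (u - v) < Complex.normSq u := by
    rw [Complex.normSq_eq_norm_sq, Complex.normSq_eq_norm_sq]
    gcongr
  rw [Complex.normSq_sub] at h1
  have h2 : u * (starRingEnd ℂ) v = u / v * (Complex.normSq v : ℝ) := by
    rw [Complex.normSq_eq_conj_mul_self]
    field_simp
  rw [h2, Complex.re_mul_ofReal] at h1
  have h3 := Complex.normSq_pos.2 hv
  by_contra! h4
  nlinarith

/-- At infinity the term `-z` dominates, giving a simple pole at `w = 0` with a coefficient
independent of `s`. The quotient of two such functions therefore tends to `1`. -/
theorem tendsto_mul_charFun_joukowski {a β C : ℝ} {s : ℂ → ℂ}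
    (hs : ∀ᶠ w in nhdsWithin (0 : ℂ) {0}ᶜ, ‖s w‖ ≤ C) :
    Filter.Tendsto (fun w => w * ((a : ℂ) - joukowski t₃ t₄ w + β * s w))
      (nhdsWithin 0 {0}ᶜ) (nhds (-((t₄ - t₃) / 4 : ℝ))) := by
  have h1 : Filter.Tendsto (fun w : ℂ => w * s w) (nhdsWithin 0 {0}ᶜ) (nhds 0) := by
    have h2 : Filter.Tendsto (fun w : ℂ => ‖w‖ * C) (nhdsWithin 0 {0}ᶜ) (nhds 0) := by
      have : Filter.Tendsto (fun w : ℂ => ‖w‖ * C) (nhds 0) (nhds (‖(0 : ℂ)‖ * C)) :=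
        (continuous_norm.mul continuous_const).tendsto 0
      rw [norm_zero, zero_mul] at this
      exact this.mono_left nhdsWithin_le_nhds
    refine squeeze_zero_norm' ?_ h2
    filter_upwards [hs] with w hw
    rw [norm_mul]
    gcongr
  have h3 : Filter.Tendsto (fun w : ℂ => w * a - (w * ((t₃ + t₄) / 2 : ℝ) +
      ((t₄ - t₃) / 4 : ℝ) * (w ^ 2 + 1))) (nhdsWithin 0 {0}ᶜ)
      (nhds ((0 : ℂ) * a - (0 * ((t₃ + t₄) / 2 : ℝ) + ((t₄ - t₃) / 4 : ℝ) * (0 ^ 2 + 1)))) :=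
    (Continuous.tendsto (by fun_prop) 0).mono_left nhdsWithin_le_nhds
  have h4 := h3.add (h1.const_mul (β : ℂ))
  have h5 : (0 : ℂ) * a - (0 * ((t₃ + t₄) / 2 : ℝ) + ((t₄ - t₃) / 4 : ℝ) * (0 ^ 2 + 1)) +
      β * 0 = -((t₄ - t₃) / 4 : ℝ) := by ring
  rw [h5] at h4
  refine h4.congr' ?_
  filter_upwards [self_mem_nhdsWithin] with w hw
  have hw0 : w ≠ 0 := hw
  have hwi : w * w⁻¹ = 1 := mul_inv_cancel₀ hw0
  rw [joukowski]
  linear_combination ((t₄ - t₃) / 4 : ℝ) * hwi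

theorem differentiableAt_joukowski {w : ℂ} (hw : w ≠ 0) :
    DifferentiableAt ℂ (joukowski t₃ t₄) w := by
  unfold joukowski
  exact (differentiableAt_const _).add
    ((differentiableAt_const _).mul (differentiableAt_id.add (differentiableAt_inv hw)))

/-- Two functions `a - z + β s(z)` that are close to each other on an ellipse, the second one being
zero-free outside the ellipse, cannot be such that the first one has a zero outside. -/
theorem ne_zero_of_norm_sub_lt (ht : t₃ < t₄) (hR : 1 < R) {a β : ℝ} {s₁ s₂ : ℂ → ℂ}
    (hd₁ : ∀ z, z ∉ ((↑) : ℝ → ℂ) '' Set.Icc t₃ t₄ → DifferentiableAt ℂ s₁ z)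
    (hd₂ : ∀ z, z ∉ ((↑) : ℝ → ℂ) '' Set.Icc t₃ t₄ → DifferentiableAt ℂ s₂ z)
    {C : ℝ} (hC₁ : ∀ᶠ w in nhdsWithin (0 : ℂ) {0}ᶜ, ‖s₁ (joukowski t₃ t₄ w)‖ ≤ C)
    (hC₂ : ∀ᶠ w in nhdsWithin (0 : ℂ) {0}ᶜ, ‖s₂ (joukowski t₃ t₄ w)‖ ≤ C)
    (hne : ∀ z, z ∉ ellipseRegion t₃ t₄ R → (a : ℂ) - z + β * s₂ z ≠ 0)
    (hlt : ∀ z ∈ ellipseCurve t₃ t₄ R, ‖((a : ℂ) - z + β * s₁ z) - ((a : ℂ) - z + β * s₂ z)‖ <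
      ‖(a : ℂ) - z + β * s₁ z‖) {z : ℂ} (hz : z ∉ ellipseRegion t₃ t₄ R) :
    (a : ℂ) - z + β * s₁ z ≠ 0 := by
  intro hz0
  have hRinv : 0 < R⁻¹ := inv_pos.2 (by linarith)
  have hRinv1 : R⁻¹ < 1 := inv_lt_one_of_one_lt₀ hR
  obtain ⟨w₀, hw₀, hw₀R, rfl⟩ := exists_joukowski_eq_of_notMem_ellipseRegion ht hR hz
  set F₁ : ℂ → ℂ := fun w => (a : ℂ) - joukowski t₃ t₄ w + β * s₁ (joukowski t₃ t₄ w) with hF₁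
  set F₂ : ℂ → ℂ := fun w => (a : ℂ) - joukowski t₃ t₄ w + β * s₂ (joukowski t₃ t₄ w) with hF₂
  -- The value `1` at `w = 0`, the image of infinity, removes the singularity of the quotient.
  set h : ℂ → ℂ := Function.update (fun w => F₁ w / F₂ w) 0 1 with hh
  have hhw : ∀ w, w ≠ 0 → h w = F₁ w / F₂ w := fun w hw => Function.update_of_ne hw _ _
  have hF₂ne : ∀ w, w ≠ 0 → ‖w‖ ≤ R⁻¹ → F₂ w ≠ 0 := by
    intro w hw hwR
    rcases hwR.lt_or_eq with h1 | h1
    · exact hne _ (joukowski_notMem_ellipseRegion ht hR hw h1)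
    · intro h2
      have h3 := hlt _ (joukowski_mem_ellipseCurve ht hw h1)
      change ‖F₁ w - F₂ w‖ < ‖F₁ w‖ at h3
      rw [h2, sub_zero] at h3
      exact lt_irrefl _ h3
  have hdF : ∀ w, w ≠ 0 → ‖w‖ ≤ R⁻¹ → DifferentiableAt ℂ h w := by
    intro w hw hwR
    have hI := joukowski_notMem_Icc ht hw (hwR.trans_lt hRinv1)
    have hJ := differentiableAt_joukowski (t₃ := t₃) (t₄ := t₄) hw
    have d1 : DifferentiableAt ℂ F₁ w := ((differentiableAt_const _).sub hJ).add
      ((differentiableAt_const _).mul ((hd₁ _ hI).comp w hJ))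
    have d2 : DifferentiableAt ℂ F₂ w := ((differentiableAt_const _).sub hJ).add
      ((differentiableAt_const _).mul ((hd₂ _ hI).comp w hJ))
    refine (d1.div d2 (hF₂ne w hw hwR)).congr_of_eventuallyEq ?_
    filter_upwards [isOpen_ne.mem_nhds hw] with v hv using hhw v hv
  have hcont0 : ContinuousAt h 0 := by
    rw [hh, continuousAt_update_same]
    have l1 := tendsto_mul_charFun_joukowski (t₃ := t₃) (t₄ := t₄) (a := a) (β := β) hC₁
    have l2 := tendsto_mul_charFun_joukowski (t₃ := t₃) (t₄ := t₄) (a := a) (β := β) hC₂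
    have hκ : -(((t₄ - t₃) / 4 : ℝ) : ℂ) ≠ 0 := by
      rw [neg_ne_zero, Complex.ofReal_ne_zero]; linarith
    have l3 := l1.div l2 hκ
    rw [div_self hκ] at l3
    refine l3.congr' ?_
    filter_upwards [self_mem_nhdsWithin] with w hw
    exact mul_div_mul_left _ _ hw
  have hd0 : DifferentiableAt ℂ h 0 := by
    refine (Complex.analyticAt_of_differentiable_on_punctured_nhds_of_continuousAt ?_
      hcont0).differentiableAt
    filter_upwards [nhdsWithin_le_nhds (Metric.ball_mem_nhds (0 : ℂ) hRinv),
      self_mem_nhdsWithin] with w hw hw0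
    exact hdF w hw0 (by simpa using (Metric.mem_ball.1 hw).le)
  -- On the bounding circle `Re h > 0`, so `|exp(-h)| < 1`, while `|exp(-h)| = 1` at the zero `w₀`
  -- of `h`. The maximum principle forbids this.
  have hdiff : DiffContOnCl ℂ (fun w => Complex.exp (-h w)) (Metric.ball 0 R⁻¹) := by
    refine DifferentiableOn.diffContOnCl fun w hw => DifferentiableAt.differentiableWithinAt ?_
    rw [closure_ball _ hRinv.ne', mem_closedBall_zero_iff] at hw
    have : DifferentiableAt ℂ h w := by
      rcases eq_or_ne w 0 with rfl | hw0
      · exact hd0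
      · exact hdF w hw0 hw
    exact this.neg.cexp
  obtain ⟨w₁, hw₁, hmax⟩ := Complex.exists_mem_frontier_isMaxOn_norm Metric.isBounded_ball
    ⟨0, Metric.mem_ball_self hRinv⟩ hdiff
  rw [frontier_ball _ hRinv.ne', mem_sphere_zero_iff_norm] at hw₁
  have hw₁0 : w₁ ≠ 0 := by
    rintro rfl
    rw [norm_zero] at hw₁
    exact hRinv.ne hw₁
  have h1 := hmax (subset_closure (mem_ball_zero_iff.2 hw₀R))
  have h2 : h w₀ = 0 := by
    rw [hhw w₀ hw₀, show F₁ w₀ = 0 from hz0, zero_div]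
  have h3 : 0 < (h w₁).re := by
    rw [hhw w₁ hw₁0]
    exact div_re_pos_of_norm_sub_lt (hF₂ne w₁ hw₁0 hw₁.le)
      (hlt _ (joukowski_mem_ellipseCurve ht hw₁0 hw₁))
  simp only [Function.comp_apply, Set.mem_ofPred_eq, h2, Complex.norm_exp, Complex.neg_re,
    Real.exp_le_exp, Complex.zero_re] at h1
  linarith

theorem eventually_norm_lt_half : ∀ᶠ w in nhdsWithin (0 : ℂ) {0}ᶜ, w ≠ 0 ∧ ‖w‖ < 1 / 2 := by
  filter_upwards [nhdsWithin_le_nhds (Metric.ball_mem_nhds (0 : ℂ) (show (0 : ℝ) < 1 / 2 by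
    norm_num)), self_mem_nhdsWithin] with w hw hw0
  exact ⟨hw0, by simpa using hw⟩

theorem crude_bound_le (ht : t₃ < t₄) {r : ℝ} (hr : r < 1 / 2) :
    r / ((t₄ - t₃) / 4 * (1 - r) ^ 2) ≤ 8 / (t₄ - t₃) := by
  have h1 : 0 < t₄ - t₃ := by linarith
  have h2 : 0 < 1 - r := by linarith
  rw [div_le_div_iff₀ (by positivity) h1]
  have h3 : r ≤ 2 * (1 - r) ^ 2 := by nlinarith
  nlinarith

end MaximumPrinciple

/-! ### The comparison of the two functions, and the conclusion. -/

namespace JacobiData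

variable {J : JacobiData} {μ : Measure ℝ} {t₃ t₄ : ℝ}

open Polynomial in
/-- If `H_{[0,n]}` has its eigenvalue of nonpositive type inside the ellipse, then the quadrature
error on the ellipse is not small. -/
theorem HasStieltjesForm.notMem_ellipseRegion (h : J.HasStieltjesForm μ t₃ t₄) {lam : ℂ}
    (hlam : 0 < lam.im) (hpole : J.HasPoleForm lam) {R : ℝ} (hR : 1 < R)
    (hlR : lam ∉ ellipseRegion t₃ t₄ R) {M : ℝ}
    (hM0 : 0 < M) (hM : ∀ z ∈ ellipseCurve t₃ t₄ R, 1 ≤ M * ‖J.charFun μ z‖) {n : ℕ}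
    {c t : Fin n → ℝ} (hc : ∀ j, 0 ≤ c j) (htj : ∀ j, t j ∈ Set.Icc t₃ t₄)
    (herr : ∀ w : ℂ, w ≠ 0 → ‖w‖ = R⁻¹ → M * (J.b 0 ^ 2 * ‖stieltjes μ (joukowski t₃ t₄ w) -
      ∑ j, (c j : ℂ) * (1 / ((t j : ℂ) - joukowski t₃ t₄ w))‖) < 1) {l : ℂ}
    (hl : ∀ j, (t j : ℂ) - l ≠ 0)
    (hl0 : (J.a 0 : ℂ) - l +
      ((J.b 0 ^ 2 : ℝ) : ℂ) * ∑ j, (c j : ℂ) * (1 / ((t j : ℂ) - l)) = 0)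
    (hneg : J.b 0 ^ 2 * ∑ j, c j * (1 / Complex.normSq ((t j : ℂ) - l)) ≤ 1) :
    l ∉ ellipseRegion t₃ t₄ R := by
  have := h.1
  have ht := h.lt
  have hμ := h.measure_compl
  have hb : 0 < J.b 0 ^ 2 := pow_pos (J.b_pos 0) 2
  intro hlmem
  -- If `l` is in the region, the quadrature function is zero-free outside; the comparison would
  -- make `F` zero-free there as well, yet `lam` is a zero of `F` outside.
  refine ne_zero_of_norm_sub_lt ht hR (a := J.a 0) (β := J.b 0 ^ 2) (s₁ := stieltjes μ)
    (s₂ := fun z => ∑ j, (c j : ℂ) * (1 / ((t j : ℂ) - z)))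
    (C := max (8 / (t₄ - t₃)) (∑ j, c j * (8 / (t₄ - t₃))))
    (fun z hz => (hasDerivAt_stieltjes hμ hz).differentiableAt) ?_ ?_ ?_
    (fun z hz => finite_charFun_ne_zero ht hR hb hc htj hl hl0 hneg hlmem hz) ?_ hlR
    (h.charFun_pole hlam hpole)
  · intro z hz
    refine DifferentiableAt.fun_sum fun j _ => (differentiableAt_const _).mul ?_
    exact (differentiableAt_const _).div ((differentiableAt_const _).sub differentiableAt_id)
      (ofReal_sub_ne_zero hz (htj j))
  · filter_upwards [eventually_norm_lt_half] with w hw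
    refine le_trans ?_ (le_max_left _ _)
    exact (norm_stieltjes_joukowski_le ht hμ hw.1 (by linarith [hw.2])).trans
      (crude_bound_le ht hw.2)
  · filter_upwards [eventually_norm_lt_half] with w hw
    refine le_trans ((norm_sum_le _ _).trans (Finset.sum_le_sum fun j _ => ?_)) (le_max_right _ _)
    rw [norm_mul, Complex.norm_real, Real.norm_eq_abs, abs_of_nonneg (hc j)]
    exact mul_le_mul_of_nonneg_left ((norm_one_div_ofReal_sub_joukowski_le ht (htj j) hw.1
      (by linarith [hw.2])).trans (crude_bound_le ht hw.2)) (hc j)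
  · intro z hz
    have h1 := hM z hz
    obtain ⟨w, hw0, hwR, rfl⟩ := exists_joukowski_eq_of_mem_ellipseCurve ht hR hz
    have h2 := herr w hw0 hwR
    rw [charFun] at h1
    rw [add_sub_add_left_eq_sub, ← mul_sub, norm_mul, Complex.norm_real, Real.norm_eq_abs,
      abs_of_pos hb]
    exact lt_of_mul_lt_mul_left (h2.trans_le h1) hM0.le

open Polynomial in
/-- The quadrature error is small on the ellipse as soon as `n` exceeds the bound `N_ε`. -/
theorem HasStieltjesForm.quadrature_error_lt (h : J.HasStieltjesForm μ t₃ t₄) {g q M : ℝ}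
    (hg : 1 < g) (hq : 1 < q) (hM : 0 < M) {n : ℕ}
    (hX : 8 * J.b 0 ^ 2 * g * M / ((g - 1) ^ 2 * (t₄ - t₃)) < q ^ n)
    {c t : Fin n → ℝ} (hc : ∀ j, 0 ≤ c j) (htj : ∀ j, t j ∈ Set.Icc t₃ t₄)
    (hquad : ∀ p : ℝ[X], p.natDegree < 2 * n - 1 →
      ∫ x, p.eval x ∂μ = ∑ j, c j * p.eval (t j))
    {w : ℂ} (hw : w ≠ 0) (hwR : ‖w‖ = (g * q)⁻¹) :
    M * (J.b 0 ^ 2 * ‖stieltjes μ (joukowski t₃ t₄ w) -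
      ∑ j, (c j : ℂ) * (1 / ((t j : ℂ) - joukowski t₃ t₄ w))‖) < 1 := by
  have := h.1
  have ht := h.lt
  have hμ := h.measure_compl
  have hb : 0 < J.b 0 ^ 2 := pow_pos (J.b_pos 0) 2
  have hw1 : ‖w‖ < 1 := by
    rw [hwR]
    exact inv_lt_one_of_one_lt₀ (by nlinarith)
  rcases n with _ | m
  -- With no nodes the error is `S` itself, and the crude bound suffices because the assumption now
  -- has `1` on the right.
  · rw [pow_zero] at hX
    refine lt_of_le_of_lt ?_ (crude_error_small hb hg hq hM (sub_pos.2 ht) hX)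
    have h1 := norm_stieltjes_joukowski_le ht hμ hw hw1
    rw [hwR] at h1
    simp only [Finset.univ_eq_empty, Finset.sum_empty, sub_zero]
    gcongr
  · refine lt_of_le_of_lt ?_ (quadrature_error_small hb hg hq hM (sub_pos.2 ht) hX)
    have h1 := norm_stieltjes_sub_quadrature_le ht hμ (by omega) hc htj hquad hw hw1
    rw [hwR] at h1
    gcongr

end JacobiData
theorem theoremA1 (J : JacobiData) (lam : ℂ) (hlam : 0 < lam.im)
    (μ : MeasureTheory.Measure ℝ) (t₃ t₄ : ℝ)
    (hpole : J.HasPoleForm lam) (hst : J.HasStieltjesForm μ t₃ t₄)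
    (g : ℝ) (hg : g = recipEccentricity t₃ t₄ lam) (ε : ℝ) (hε : ε ∈ Set.Ioo (0 : ℝ) 1) :
    ∃ M : ℝ,
      IsGreatest ((fun z : ℂ => ‖J.m z‖) '' ellipseCurve t₃ t₄ (ellipseParam g ε)) M ∧
      ∀ n : ℕ,
        Real.log (8 * J.b 0 ^ 2 * g * M / ((g - 1) ^ 2 * (t₄ - t₃))) /
            Real.log (1 + ε * √(1 - (g ^ 2)⁻¹)) < n →
        ∃ l : ℂ, (∀ w : ℂ, IsEigenvalueOfNonposType (J.truncation n) w ↔ w = l) ∧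
          l ∉ ellipseRegion t₃ t₄ (ellipseParam g ε) ∧
          l ∉ ((↑) : ℝ → ℂ) '' Set.Icc t₃ t₄ := by

  subst hg
  have ht := hst.lt
  have hg1 := one_lt_recipEccentricity ht hlam
  set g := recipEccentricity t₃ t₄ lam with hg
  have hR := one_lt_ellipseParam hg1 hε
  have hlR : lam ∉ ellipseRegion t₃ t₄ (ellipseParam g ε) := lam_notMem_ellipseRegion ht hlam hε
  obtain ⟨M, hM, hM0, hMF⟩ := hst.exists_isGreatest hlam hpole hR hlR
  refine ⟨M, hM, fun n hn => ?_⟩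
  obtain ⟨l, hl⟩ := J.existsUnique_eigenvalue_truncation n
  have hq := one_lt_one_add_mul_sqrt hg1 hε.1
  have hX : 0 < 8 * J.b 0 ^ 2 * g * M / ((g - 1) ^ 2 * (t₄ - t₃)) := by
    have := J.b_pos 0
    have : 0 < g - 1 := sub_pos.2 hg1
    have : 0 < t₄ - t₃ := sub_pos.2 ht
    positivity
  obtain ⟨c, t, hc, htj, hquad, hev⟩ := hst.exists_quadrature n
  obtain ⟨hl1, hl2, hl3⟩ := hev l ((hl l).2 rfl)
  have hout : l ∉ ellipseRegion t₃ t₄ (ellipseParam g ε) := by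
    refine hst.notMem_ellipseRegion hlam hpole hR hlR hM0 hMF hc htj ?_ hl1 hl2 hl3
    intro w hw hwR
    -- The factorization `R = g q` matches the ellipse parameter with the power `q ^ n` extracted
    -- from the logarithmic bound.
    rw [ellipseParam_eq_mul hg1] at hwR
    exact hst.quadrature_error_lt hg1 hq hM0 (lt_pow_of_log_div_log_lt hX hq hn) hc htj hquad hw hwR
  refine ⟨l, hl, hout, ?_⟩
  rintro ⟨x, hx, rfl⟩
  exact hout (ofReal_mem_ellipseRegion ht hR hx)
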